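/- **Model.** Let $h\in\mathbb C^p\setminus\{0\}$ and let $B\in\mathbb C^{q\times q}$ be positive semidefinite, $B\ne0$. For $\sigma>0$ let the training samples be $x_m=\tau_m\,(h\otimes c_m)+\sigma z_m\in\mathbb C^{pq}$, $m=1,2,\dots$, where $c_m\sim\mathcal{CN}(0,B)$, $z_m\sim\mathcal{CN}(0,I_{pq})$ (circularly symmetric complex Gaussian), $\tau_m>0$ almost surely with an arbitrary law such that $E[\tau^2]<\infty$, the variables $\tau_m,c_m,z_m$ are independent, and the triples $(\tau_m,c_m,z_m)$ are i.i.d. The clutter-plus-noise covariance is $\Sigma=E[\tau^2]\,(hh^H)\otimes B+\sigma^2I$, and $S=\frac1n\sum_{m=1}^n x_mx_m^H$ is the sample covariance matrix. For vectors and matrices on $\mathbb C^{pq}$ write the index as (channel, pulse). **Estimators.** Let $\hat h$ be a (measurable) unit leading eigenvector of the $p\times p$ matrix $\frac1q\sum_{i=1}^qS(i,i)$, where $S(i,i)$ is the $p\times p$ block of $S$ belonging to pulse $i$; that is, $\hat h$ spans the range of the rank-one truncation of this matrix. For $0\le r\le\operatorname{rank}B$ let the columns of $\hat U_B\in\mathbb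 C^{q\times r}$ be (measurable) $r$ leading orthonormal eigenvectors of $\sum_{i,j}\overline{a_{ij}}\,S_{ij}/\|a\|_F^2$, where $a=\hat h\hat h^H$ and $S_{ij}$ is the $q\times q$ block of $S$ belonging to the channels $i,j$. The Kron STAP filter is $\hat F=(I-\hat h\hat h^H)\otimes(I-\hat U_B\hat U_B^H)$; for $r=0$ it is the spatial filter $(I-\hat h\hat h^H)\otimes I$. **SINR loss.** Let $d\in\mathbb C^{pq}$ be a unit steering vector orthogonal to the spatial clutter subspace, $(h^H\otimes I)d=0$, and, if $r\ge1$, also to the temporal one, $(I\otimes B)d=0$. For a target amplitude $\alpha\ne0$ let $\mathrm{SINR}(w)=|\alpha|^2|w^Hd|^2/(w^H\Sigma w)$, and let $\rho=\mathrm{SINR}(\hat Fd)/\mathrm{SINR}(\Sigma^{-1}d)$ be the SINR loss. Put $$\kappa(B,d)=\frac{d^H(I\otimes B)d}{\operatorname{tr}B},$$ which is $b^HBb/\operatorname{tr}B$ when $d=a\otimes b$ with unit vectors $a,b$. **Claim.** For large $n$ and small $\sigma$, the expected SINR loss is at least $1-\frac1n$ to first order in $\frac1n$, and $1-\frac1n$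 is its worst-case value, whatever the temporal rank. Precisely: 1. $n\,(1-E[\rho])\to\kappa(B,d)$ as $n\to\infty$ and $\sigma\to0^+$ jointly, i.e. $E[\rho]=1-\frac{\kappa(B,d)}n+o(\frac1n)$. 2. For every $\varepsilon>0$, $E[\rho]\ge1-\frac{1+\varepsilon}n$ for all sufficiently large $n$ and all sufficiently small $\sigma>0$. 3. $\kappa(B,d)\le1$, with equality if and only if $d=a\otimes b$ and $B=\operatorname{tr}(B)\,bb^H$ for some $a\in\mathbb C^p$ and some unit vector $b\in\mathbb C^q$ (fully coherent clutter aligned with the target); in this case $E[\rho]=1-\frac1n+o(\frac1n)$. 4. For every temporal rank $1\le s\le q$, the supremum of $\kappa(B',d')$ over all positive semidefinite $B'$ of rank $s$ and all unit $d'$ with $(h^H\otimes I)d'=0$ equals $1$. -/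

import Mathlib

open MeasureTheory ProbabilityTheory Filter Topology Matrix
open scoped Kronecker ComplexOrder

namespace KronSTAP

/-- `X` is a centred circularly symmetric complex Gaussian vector with covariance
`E[X Xᴴ] = C`: for every `w`, the real part of `wᴴ X` is a real centred Gaussian of variance
`wᴴ C w / 2`.  (Replacing `w` by `i w` covers the imaginary part, and by the Cramér–Wold device
these one-dimensional laws determine the law of `X`.) -/
def IsComplexGaussian {Ω ι : Type*} [MeasurableSpace Ω] [Fintype ι]
    (X : Ω → ι → ℂ) (C : Matrix ι ι ℂ) (μ : Measure Ω) : Prop :=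
  ∀ w : ι → ℂ, μ.map (fun ω => (star w ⬝ᵥ X ω).re) =
    gaussianReal 0 (Real.toNNReal ((star w ⬝ᵥ (C *ᵥ w)).re / 2))

/-- The random ingredients of i.i.d. target-free training samples in the SIRV model, one triple for
each range bin `m`: the texture `τ m`, the temporal speckle `c m` with covariance `B`, and the
normalized sensor noise `z m` with identity covariance.  The three are independent, and the
triples are independent and identically distributed.  The law of the texture is an arbitrary law on
the positive reals with `E[τ²] < ∞`. -/
structure IsSIRVTraining {Ω : Type*} [MeasurableSpace Ω] {p q : ℕ} (μ : Measure Ω)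
    (B : Matrix (Fin q) (Fin q) ℂ) (τ : ℕ → Ω → ℝ) (c : ℕ → Ω → Fin q → ℂ)
    (z : ℕ → Ω → Fin p × Fin q → ℂ) : Prop where
  measurable_texture : ∀ m, Measurable (τ m)
  measurable_speckle : ∀ m, Measurable (c m)
  measurable_noise : ∀ m, Measurable (z m)
  indep_samples : iIndepFun (fun m ω => (τ m ω, c m ω, z m ω)) μ
  indep_texture_speckle : ∀ m, IndepFun (τ m) (c m) μ
  indep_clutter_noise : ∀ m, IndepFun (fun ω => (τ m ω, c m ω)) (z m) μ
  texture_identDistrib : ∀ m, IdentDistrib (τ m) (τ 0) μ μ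
  texture_pos : ∀ m, ∀ᵐ ω ∂μ, 0 < τ m ω
  texture_memLp : MemLp (τ 0) 2 μ
  speckle_gaussian : ∀ m, IsComplexGaussian (c m) B μ
  noise_gaussian : ∀ m, IsComplexGaussian (z m) 1 μ

section Model

variable {p q : ℕ}

/-- The Kronecker product `a ⊗ b` of two vectors; entry `(i, j)` belongs to channel `i`
and pulse `j`. -/
def kronVec (a : Fin p → ℂ) (b : Fin q → ℂ) : Fin p × Fin q → ℂ :=
  fun x => a x.1 * b x.2

/-- A clutter-plus-noise sample `τ (h ⊗ c) + σ z`. -/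
def sample (h : Fin p → ℂ) (σ t : ℝ) (c : Fin q → ℂ) (z : Fin p × Fin q → ℂ) :
    Fin p × Fin q → ℂ :=
  (t : ℂ) • kronVec h c + (σ : ℂ) • z

/-- The sample covariance matrix `S = (1/n) ∑_{m < n} x_m x_mᴴ`. -/
noncomputable def sampleCov {ι : Type*} (n : ℕ) (x : ℕ → ι → ℂ) : Matrix ι ι ℂ :=
  (n : ℂ)⁻¹ • ∑ m ∈ Finset.range n, vecMulVec (x m) (star (x m))

/-- The clutter-plus-noise covariance `Σ = E[τ²] (h hᴴ) ⊗ B + σ² I`, where `t2 = E[τ²]`. -/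
noncomputable def clutterNoiseCov (t2 : ℝ) (h : Fin p → ℂ) (B : Matrix (Fin q) (Fin q) ℂ)
    (σ : ℝ) : Matrix (Fin p × Fin q) (Fin p × Fin q) ℂ :=
  (t2 : ℂ) • (vecMulVec h (star h) ⊗ₖ B) + ((σ : ℂ) ^ 2) • 1

/-- The matrix `(1/q) ∑_i S(i,i)`, where `S(i,i)` is the `p × p` block of `S` that belongs to
pulse `i`. -/
noncomputable def spatialAverage (S : Matrix (Fin p × Fin q) (Fin p × Fin q) ℂ) :
    Matrix (Fin p) (Fin p) ℂ :=
  (q : ℂ)⁻¹ • ∑ i : Fin q, S.submatrix (fun k => (k, i)) (fun l => (l, i))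

/-- The matrix `∑_{i,j} conj(a_{ij}) S(i,j) / ‖A‖_F²`, where `S(i,j)` is the `q × q` block of `S`
that belongs to the channels `i` and `j`. -/
noncomputable def temporalAverage (A : Matrix (Fin p) (Fin p) ℂ)
    (S : Matrix (Fin p × Fin q) (Fin p × Fin q) ℂ) : Matrix (Fin q) (Fin q) ℂ :=
  (((∑ i, ∑ j, ‖A i j‖ ^ 2 : ℝ) : ℂ)⁻¹) •
    ∑ i : Fin p, ∑ j : Fin p, star (A i j) • S.submatrix (fun k => (i, k)) (fun l => (j, l))

/-- The columns of `U` are `r` leading principal components of the Hermitian matrix `M`: they are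
orthonormal eigenvectors, and the quadratic form of `M` on their orthogonal complement does not
exceed any of their eigenvalues.  Thus `U diag(s) Uᴴ = EIG_r(M)`. -/
def IsPrincipalComponents {ι : Type*} [Fintype ι] {r : ℕ}
    (M : Matrix ι ι ℂ) (U : Matrix ι (Fin r) ℂ) : Prop :=
  Uᴴ * U = 1 ∧ ∃ s : Fin r → ℝ,
    M * U = U * diagonal (fun k => (s k : ℂ)) ∧
    ∀ k, ∀ v : ι → ℂ, Uᴴ *ᵥ v = 0 → (star v ⬝ᵥ (M *ᵥ v)).re ≤ s k * (star v ⬝ᵥ v).re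

/-- The Kron STAP filter `(I - U_A U_Aᴴ) ⊗ (I - U_B U_Bᴴ)`.  With no temporal components
(`U_B` without columns) it is the spatial filter `(I - U_A U_Aᴴ) ⊗ I`. -/
noncomputable def kronFilter {ra rb : ℕ} (UA : Matrix (Fin p) (Fin ra) ℂ)
    (UB : Matrix (Fin q) (Fin rb) ℂ) : Matrix (Fin p × Fin q) (Fin p × Fin q) ℂ :=
  (1 - UA * UAᴴ) ⊗ₖ (1 - UB * UBᴴ)

end Model

/-- The output SINR `|α|² |wᴴ d|² / (wᴴ Σ w)` of the filter vector `w`. -/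
noncomputable def sinr {ι : Type*} [Fintype ι] (α : ℂ) (Sig : Matrix ι ι ℂ) (d w : ι → ℂ) : ℝ :=
  ‖α‖ ^ 2 * ‖star w ⬝ᵥ d‖ ^ 2 / (star w ⬝ᵥ (Sig *ᵥ w)).re

/-- The SINR loss `ρ = SINR_out / SINR_max` of the filter matrix `F`: the SINR for `w = F d`
relative to that of the optimal filter vector `Σ⁻¹ d`. -/
noncomputable def sinrLoss {ι : Type*} [Fintype ι] [DecidableEq ι] (α : ℂ) (Sig : Matrix ι ι ℂ)
    (d : ι → ℂ) (F : Matrix ι ι ℂ) : ℝ :=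
  sinr α Sig d (F *ᵥ d) / sinr α Sig d (Sig⁻¹ *ᵥ d)

/-- The temporal alignment `dᴴ (I ⊗ B) d / trace B` of the unit steering vector `d` with the
clutter; for `d = a ⊗ b` with unit `a`, `b` it is `bᴴ B b / trace B`. -/
noncomputable def alignment {p q : ℕ} (B : Matrix (Fin q) (Fin q) ℂ) (d : Fin p × Fin q → ℂ) : ℝ :=
  (star d ⬝ᵥ (((1 : Matrix (Fin p) (Fin p) ℂ) ⊗ₖ B) *ᵥ d)).re / B.trace.re

end KronSTAP

namespace KronSTAP

set_option linter.unusedSectionVars false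

/-! Write `u m = τ m • c m` for the clutter, a for the estimated spatial eigenvector and s for the
clutter energy `energy n u`. Since h ⟂ d, the vector d is an eigenvector of Σ with eigenvalue σ², so
the optimal SINR is |α|²/σ². The filter is an orthogonal projection, hence (`sinrLoss_kronFilter`) ρ
= g²/(g + b), where g = ‖F̂d‖² and b is the clutter power leaking through the filter, divided by σ².
The loss 1 - g of target energy has order σ², whereas b survives as σ → 0: the leaked amplitude is
proportional to σ, and b divides its square by σ².

The unnormalized spatial average is s hhᴴ plus a noise perturbation plus a multiple of the identity.
Testing its eigenvector equation against the columns of d, which are orthogonal to h, expresses (aᴴ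
⊗ I)d to first order through the clutter-noise cross term. Hence b is close to `leadTerm`, a
quadratic form in that cross term over s². If r ≥ 1, the rows of d lie in ker B, so κ and `leadTerm`
vanish, and near orthogonality of the temporal components to ker B makes b negligible
(`temporal_stage`). The theorem `sinrLoss_bounds` turns this into deterministic two-sided bounds,
valid when the clutter scatter is bounded below by a multiple of n on the range of B and the
fluctuations are not too large.

In expectation, `leadTerm` is handled conditionally on the clutter, which is independent of the
noise. With B = AᴴA, the form is a sum of squared moduli of Gaussian sums, with conditional mean
dᴴ(I ⊗ B)d · s (`IsSIRVTraining.qform_steerCross_moments`). The lead term therefore has conditional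
mean E[τ²] dᴴ(I ⊗ B)d / s. The strong law gives s/n → E[τ²] tr B, and truncated inverses with
dominated convergence give the limit κ (`IsSIRVTraining.tendsto_integral_inv_energy`). The texture
cancels.

The exceptional clutter event must have probability o(1/n) although τ has only two moments.
Replacing τ² by a bounded smaller weight makes Hoeffding's inequality applicable
(`IsSIRVTraining.exists_scatterEvent`). Large noise fluctuations need no separate tail bound: with
threshold δ = √σ, the trivial bounds 0 ≤ ρ ≤ 1 are absorbed by a term σΦ/n², and Φ = `fluct` has
mean of order n (`deficit_bounds_of_imp`, `IsSIRVTraining.fluct_moment`).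

The bound κ ≤ 1 is Cauchy–Schwarz applied to the rows of A; its equality case gives the coherent
clutter. Adding small eigenvalues to a rank-one matrix approaches equality at every rank. -/

/-- The squared Euclidean norm of a complex vector. -/
noncomputable def sumSq {ι : Type*} [Fintype ι] (v : ι → ℂ) : ℝ := ∑ i, ‖v i‖ ^ 2

/-- The squared Frobenius norm of a complex matrix. -/
noncomputable def frobSq {ι κ : Type*} [Fintype ι] [Fintype κ] (M : Matrix ι κ ℂ) : ℝ :=
  ∑ i, ∑ j, ‖M i j‖ ^ 2

/-! ### Norm inequalities and a min-max bound for leading eigenvalues. -/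

section Euclidean

variable {ι κ : Type*} [Fintype ι] [Fintype κ]

lemma sumSq_nonneg (v : ι → ℂ) : 0 ≤ sumSq v := Finset.sum_nonneg fun _ _ => by positivity

lemma frobSq_nonneg (M : Matrix ι κ ℂ) : 0 ≤ frobSq M :=
  Finset.sum_nonneg fun _ _ => Finset.sum_nonneg fun _ _ => by positivity

lemma star_dotProduct_self (v : ι → ℂ) : star v ⬝ᵥ v = (sumSq v : ℂ) := by
  simp only [dotProduct, sumSq, Pi.star_apply, Complex.ofReal_sum]
  refine Finset.sum_congr rfl fun i _ => ?_
  rw [Complex.star_def, Complex.conj_mul']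
  push_cast; rfl

lemma sumSq_eq_re (v : ι → ℂ) : sumSq v = (star v ⬝ᵥ v).re := by
  rw [star_dotProduct_self, Complex.ofReal_re]

lemma sumSq_eq_zero {v : ι → ℂ} : sumSq v = 0 ↔ v = 0 := by
  rw [← Complex.ofReal_eq_zero, ← star_dotProduct_self, dotProduct_star_self_eq_zero]

lemma sumSq_pos {v : ι → ℂ} (hv : v ≠ 0) : 0 < sumSq v :=
  lt_of_le_of_ne (sumSq_nonneg v) fun h => hv (sumSq_eq_zero.1 h.symm)

lemma sumSq_smul (a : ℂ) (v : ι → ℂ) : sumSq (a • v) = ‖a‖ ^ 2 * sumSq v := by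
  simp [sumSq, mul_pow, Finset.mul_sum]

lemma sumSq_star (v : ι → ℂ) : sumSq (star v) = sumSq v := by simp [sumSq]

lemma norm_dotProduct_sq_le (v w : ι → ℂ) : ‖v ⬝ᵥ w‖ ^ 2 ≤ sumSq v * sumSq w := by
  calc ‖v ⬝ᵥ w‖ ^ 2 ≤ (∑ i, ‖v i‖ * ‖w i‖) ^ 2 := by
        gcongr
        refine (norm_sum_le _ _).trans (le_of_eq ?_)
        simp
    _ ≤ _ := Finset.sum_mul_sq_le_sq_mul_sq _ _ _

lemma norm_star_dotProduct_sq_le (v w : ι → ℂ) : ‖star v ⬝ᵥ w‖ ^ 2 ≤ sumSq v * sumSq w := by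
  simpa only [sumSq_star] using norm_dotProduct_sq_le (star v) w

lemma norm_star_dotProduct_comm (v w : ι → ℂ) : ‖star v ⬝ᵥ w‖ = ‖star w ⬝ᵥ v‖ := by
  rw [← norm_star, Matrix.star_dotProduct]
  simp

lemma sumSq_mulVec_le (M : Matrix ι κ ℂ) (v : κ → ℂ) :
    sumSq (M *ᵥ v) ≤ frobSq M * sumSq v := by
  rw [frobSq, Finset.sum_mul]
  exact Finset.sum_le_sum fun i _ => norm_dotProduct_sq_le (M i) v

lemma norm_bilin_sq_le (M : Matrix ι κ ℂ) (v : ι → ℂ) (w : κ → ℂ) :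
    ‖star v ⬝ᵥ (M *ᵥ w)‖ ^ 2 ≤ frobSq M * sumSq v * sumSq w := by
  calc _ ≤ sumSq v * sumSq (M *ᵥ w) := norm_star_dotProduct_sq_le _ _
    _ ≤ sumSq v * (frobSq M * sumSq w) := by
        gcongr
        · exact sumSq_nonneg v
        · exact sumSq_mulVec_le M w
    _ = _ := by ring

lemma norm_le_sqrt_mul {a x y : ℝ} (hx : 0 ≤ x) (h : a ^ 2 ≤ x * y) : a ≤ √x * √y := by
  rw [← Real.sqrt_mul hx]; exact Real.le_sqrt_of_sq_le h

lemma norm_star_dotProduct_le (v w : ι → ℂ) : ‖star v ⬝ᵥ w‖ ≤ √(sumSq v) * √(sumSq w) :=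
  norm_le_sqrt_mul (sumSq_nonneg v) (norm_star_dotProduct_sq_le v w)

lemma norm_bilin_le (M : Matrix ι κ ℂ) (v : ι → ℂ) (w : κ → ℂ) :
    ‖star v ⬝ᵥ (M *ᵥ w)‖ ≤ √(frobSq M) * √(sumSq v) * √(sumSq w) := by
  rw [← Real.sqrt_mul (frobSq_nonneg M)]
  exact norm_le_sqrt_mul (mul_nonneg (frobSq_nonneg M) (sumSq_nonneg v)) (norm_bilin_sq_le M v w)

/-- A Hermitian matrix whose quadratic form is at least `c` on a subspace of dimension at least
`r` has its `r` leading eigenvalues at least `c`. -/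
lemma le_principal_eigenvalue {r : ℕ} {M : Matrix ι ι ℂ} (hM : M.IsHermitian)
    {U : Matrix ι (Fin r) ℂ} {s : Fin r → ℝ} (hU : Uᴴ * U = 1)
    (hMU : M * U = U * diagonal (fun k => (s k : ℂ)))
    (hs : ∀ k, ∀ v : ι → ℂ, Uᴴ *ᵥ v = 0 → (star v ⬝ᵥ (M *ᵥ v)).re ≤ s k * (star v ⬝ᵥ v).re)
    (V : Submodule ℂ (ι → ℂ)) (hV : r ≤ Module.finrank ℂ V) {c : ℝ}
    (hc : ∀ v ∈ V, c * sumSq v ≤ (star v ⬝ᵥ (M *ᵥ v)).re) (k : Fin r) : c ≤ s k := by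
  classical
  -- Only r - 1 linear conditions are imposed on a space of dimension at least r, so V contains a
  -- nonzero v whose sole nonzero component along the columns of `U` is the k-th.
  let f : V →ₗ[ℂ] ({j : Fin r // j ≠ k} → ℂ) :=
    (LinearMap.funLeft ℂ ℂ (Subtype.val : {j : Fin r // j ≠ k} → Fin r)).comp
      ((Matrix.mulVecLin Uᴴ).comp V.subtype)
  have hf : LinearMap.ker f ≠ ⊥ := by
    apply LinearMap.ker_ne_bot_of_finrank_lt
    have := k.pos
    simp only [Module.finrank_fintype_fun_eq_card, Fintype.card_subtype_compl, Fintype.card_fin,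
      Fintype.card_subtype_eq]
    omega
  obtain ⟨x, hx, hx0⟩ := (Submodule.ne_bot_iff _).1 hf
  set v : ι → ℂ := x.1
  have hv0 : v ≠ 0 := fun h => hx0 (Subtype.ext h)
  have hvj : ∀ j, j ≠ k → (Uᴴ *ᵥ v) j = 0 := fun j hj => congrFun hx ⟨j, hj⟩
  set a : ℂ := (Uᴴ *ᵥ v) k
  have hUv : Uᴴ *ᵥ v = Pi.single k a := by
    ext j
    by_cases hj : j = k
    · subst hj; simp [a]
    · rw [hvj j hj, Pi.single_eq_of_ne hj]
  set u : ι → ℂ := U *ᵥ Pi.single k 1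
  have hu : U *ᵥ Pi.single k a = a • u := by
    rw [← Matrix.mulVec_smul]; congr 1; ext j
    by_cases hj : j = k
    · subst hj; simp
    · simp [hj]
  set y : ι → ℂ := v - a • u
  have hy : Uᴴ *ᵥ y = 0 := by
    simp only [y]
    rw [Matrix.mulVec_sub, hUv, ← hu, Matrix.mulVec_mulVec, hU, Matrix.one_mulVec, sub_self]
  have huu : star u ⬝ᵥ u = 1 := by
    simp only [u]
    rw [Matrix.star_mulVec, ← Matrix.dotProduct_mulVec, Matrix.mulVec_mulVec, hU,
      Matrix.one_mulVec]
    simp [dotProduct, Pi.single_apply]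
  have huy : star u ⬝ᵥ y = 0 := by
    simp only [u]
    rw [Matrix.star_mulVec, ← Matrix.dotProduct_mulVec, hy, dotProduct_zero]
  have hyu : star y ⬝ᵥ u = 0 := by
    have := congrArg star huy
    rwa [Matrix.star_dotProduct, star_star, star_zero] at this
  have hMu : M *ᵥ u = (s k : ℂ) • u := by
    simp only [u]
    rw [Matrix.mulVec_mulVec, hMU, ← Matrix.mulVec_mulVec, ← Matrix.mulVec_smul]
    congr 1; ext j
    by_cases hj : j = k
    · subst hj; simp
    · simp [Matrix.mulVec_diagonal, hj]
  have huM : star u ⬝ᵥ (M *ᵥ y) = 0 := by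
    have h1 : star u ᵥ* M = star (M *ᵥ u) := by rw [Matrix.star_mulVec M u, hM.eq]
    rw [Matrix.dotProduct_mulVec, h1, hMu, star_smul, smul_dotProduct, huy, smul_zero]
  have hv : v = a • u + y := by simp [y]
  -- The cross terms vanish because u is an eigenvector of the Hermitian `M` and y ⟂ u; the y-part
  -- is then controlled by `hs`.
  have hform : star v ⬝ᵥ (M *ᵥ v) = (s k : ℂ) * (star a * a) + star y ⬝ᵥ (M *ᵥ y) := by
    rw [hv]
    simp only [Matrix.mulVec_add, Matrix.mulVec_smul, star_add, star_smul, add_dotProduct,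
      dotProduct_add, smul_dotProduct, dotProduct_smul, hMu, huM, huu, hyu, smul_eq_mul]
    ring
  have hself : star v ⬝ᵥ v = star a * a + star y ⬝ᵥ y := by
    rw [hv]
    simp only [star_add, star_smul, add_dotProduct,
      dotProduct_add, smul_dotProduct, dotProduct_smul, huy, huu, hyu, smul_eq_mul]
    ring
  have key : (star v ⬝ᵥ (M *ᵥ v)).re ≤ s k * sumSq v := by
    have h1 := hs k y hy
    have h2 : star a * a = ((‖a‖ ^ 2 : ℝ) : ℂ) := by
      rw [Complex.star_def, Complex.conj_mul']; push_cast; rfl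
    rw [sumSq_eq_re, hform, hself, h2, Complex.add_re, Complex.add_re, ← Complex.ofReal_mul,
      Complex.ofReal_re, Complex.ofReal_re, mul_add]
    linarith
  exact le_of_mul_le_mul_right ((hc v x.2).trans key) (sumSq_pos hv0)

end Euclidean

/-! ### The noise sums and their contractions. -/

section Fluctuations

variable {p q : ℕ}

/-- The clutter energy `∑_m ‖u_m‖²`. -/
noncomputable def energy (n : ℕ) (u : ℕ → Fin q → ℂ) : ℝ := ∑ m ∈ Finset.range n, sumSq (u m)

/-- The clutter-noise cross term `∑_m u_m z_mᴴ`. -/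
noncomputable def crossSum (n : ℕ) (u : ℕ → Fin q → ℂ) (z : ℕ → Fin p × Fin q → ℂ) :
    Matrix (Fin q) (Fin p × Fin q) ℂ :=
  ∑ m ∈ Finset.range n, vecMulVec (u m) (star (z m))

/-- The centred noise scatter `∑_m (z_m z_mᴴ - I)`. -/
noncomputable def noiseDev (n : ℕ) (z : ℕ → Fin p × Fin q → ℂ) :
    Matrix (Fin p × Fin q) (Fin p × Fin q) ℂ :=
  ∑ m ∈ Finset.range n, (vecMulVec (z m) (star (z m)) - 1)

/-- The total squared size of the cross term and of the centred noise scatter. -/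
noncomputable def fluct (n : ℕ) (u : ℕ → Fin q → ℂ) (z : ℕ → Fin p × Fin q → ℂ) : ℝ :=
  frobSq (crossSum n u z) + frobSq (noiseDev n z)

/-- The contraction `∑_m ∑_i z_m(·, i) conj(u_m(i))` of the cross term. -/
noncomputable def crossVec (n : ℕ) (u : ℕ → Fin q → ℂ) (z : ℕ → Fin p × Fin q → ℂ) :
    Fin p → ℂ :=
  fun k => ∑ i, star (crossSum n u z i (k, i))

/-- The contraction of the centred noise scatter over the pulses. -/
noncomputable def noiseSpatial (n : ℕ) (z : ℕ → Fin p × Fin q → ℂ) : Matrix (Fin p) (Fin p) ℂ :=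
  fun k l => ∑ i, noiseDev n z (k, i) (l, i)

/-- The contraction of the cross term with the spatial vector `a`. -/
noncomputable def crossTemporal (n : ℕ) (u : ℕ → Fin q → ℂ) (z : ℕ → Fin p × Fin q → ℂ)
    (a : Fin p → ℂ) : Matrix (Fin q) (Fin q) ℂ :=
  fun k l => ∑ i, crossSum n u z k (i, l) * a i

/-- The contraction of the centred noise scatter with the spatial vector `a`. -/
noncomputable def noiseTemporal (n : ℕ) (z : ℕ → Fin p × Fin q → ℂ)
    (a : Fin p → ℂ) : Matrix (Fin q) (Fin q) ℂ :=
  fun k l => ∑ x : Fin p × Fin p, noiseDev n z (x.1, k) (x.2, l) * (star (a x.1) * a x.2)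

lemma energy_nonneg (n : ℕ) (u : ℕ → Fin q → ℂ) : 0 ≤ energy n u :=
  Finset.sum_nonneg fun _ _ => sumSq_nonneg _

lemma fluct_nonneg (n : ℕ) (u : ℕ → Fin q → ℂ) (z : ℕ → Fin p × Fin q → ℂ) :
    0 ≤ fluct n u z := add_nonneg (frobSq_nonneg _) (frobSq_nonneg _)

lemma crossSum_apply (n : ℕ) (u : ℕ → Fin q → ℂ) (z : ℕ → Fin p × Fin q → ℂ) (k x) :
    crossSum n u z k x = ∑ m ∈ Finset.range n, u m k * star (z m x) := by
  simp [crossSum, Matrix.sum_apply, vecMulVec_apply]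

lemma noiseDev_apply (n : ℕ) (z : ℕ → Fin p × Fin q → ℂ) (x y) :
    noiseDev n z x y = ∑ m ∈ Finset.range n, (z m x * star (z m y) - if x = y then 1 else 0) := by
  simp [noiseDev, Matrix.sum_apply, vecMulVec_apply, Matrix.one_apply]

lemma crossVec_apply (n : ℕ) (u : ℕ → Fin q → ℂ) (z : ℕ → Fin p × Fin q → ℂ) (k) :
    crossVec n u z k = ∑ m ∈ Finset.range n, ∑ i, z m (k, i) * star (u m i) := by
  rw [Finset.sum_comm]
  simp [crossVec, crossSum_apply, mul_comm]

lemma sumSq_crossVec_le (n : ℕ) (u : ℕ → Fin q → ℂ) (z : ℕ → Fin p × Fin q → ℂ) :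
    sumSq (crossVec n u z) ≤ q * frobSq (crossSum n u z) := by
  have h1 : ∀ k, ‖crossVec n u z k‖ ^ 2 ≤ q * ∑ i, ‖crossSum n u z i (k, i)‖ ^ 2 := by
    intro k
    calc _ ≤ (∑ i, ‖crossSum n u z i (k, i)‖) ^ 2 := by
          gcongr
          refine (norm_sum_le _ _).trans (le_of_eq ?_)
          simp
      _ ≤ _ := by
          simpa using sq_sum_le_card_mul_sum_sq (s := Finset.univ)
            (f := fun i => ‖crossSum n u z i (k, i)‖)
  calc _ ≤ ∑ k, (q : ℝ) * ∑ i, ‖crossSum n u z i (k, i)‖ ^ 2 := Finset.sum_le_sum fun k _ => h1 k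
    _ = q * ∑ i, ∑ k, ‖crossSum n u z i (k, i)‖ ^ 2 := by
        rw [← Finset.mul_sum, Finset.sum_comm]
    _ ≤ _ := by
        unfold frobSq
        gcongr with i _
        rw [Fintype.sum_prod_type]
        refine Finset.sum_le_sum fun k _ => ?_
        exact Finset.single_le_sum (f := fun j => ‖crossSum n u z i (k, j)‖ ^ 2)
          (fun _ _ => by positivity) (Finset.mem_univ i)

lemma frobSq_noiseSpatial_le (n : ℕ) (z : ℕ → Fin p × Fin q → ℂ) :
    frobSq (noiseSpatial n z) ≤ q * frobSq (noiseDev n z) := by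
  have h1 : ∀ k l, ‖noiseSpatial n z k l‖ ^ 2 ≤
      q * ∑ i, ‖noiseDev n z (k, i) (l, i)‖ ^ 2 := by
    intro k l
    calc _ ≤ (∑ i, ‖noiseDev n z (k, i) (l, i)‖) ^ 2 := by
          gcongr
          exact norm_sum_le _ _
      _ ≤ _ := by
          simpa using sq_sum_le_card_mul_sum_sq (s := Finset.univ)
            (f := fun i => ‖noiseDev n z (k, i) (l, i)‖)
  calc _ ≤ ∑ k, ∑ l, (q : ℝ) * ∑ i, ‖noiseDev n z (k, i) (l, i)‖ ^ 2 :=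
        Finset.sum_le_sum fun k _ => Finset.sum_le_sum fun l _ => h1 k l
    _ = q * ∑ k, ∑ i, ∑ l, ‖noiseDev n z (k, i) (l, i)‖ ^ 2 := by
        simp_rw [← Finset.mul_sum]
        congr 1
        exact Finset.sum_congr rfl fun k _ => Finset.sum_comm
    _ ≤ _ := by
        unfold frobSq
        rw [Fintype.sum_prod_type]
        gcongr with k _ i _
        rw [Fintype.sum_prod_type]
        refine Finset.sum_le_sum fun l _ => ?_
        exact Finset.single_le_sum (f := fun j => ‖noiseDev n z (k, i) (l, j)‖ ^ 2)
          (fun _ _ => by positivity) (Finset.mem_univ i)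

/-- Cauchy–Schwarz over the channel index; contraction with a unit vector costs no constant. -/
lemma frobSq_crossTemporal_le (n : ℕ) (u : ℕ → Fin q → ℂ) (z : ℕ → Fin p × Fin q → ℂ)
    {a : Fin p → ℂ} (ha : sumSq a = 1) :
    frobSq (crossTemporal n u z a) ≤ frobSq (crossSum n u z) := by
  unfold frobSq
  refine Finset.sum_le_sum fun k _ => ?_
  rw [Fintype.sum_prod_type_right]
  refine Finset.sum_le_sum fun l _ => ?_
  have := norm_dotProduct_sq_le (fun i => crossSum n u z k (i, l)) a
  rwa [ha, mul_one] at this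

/-- Cauchy–Schwarz over pairs of channels, against the unit vector with entries conj(a_i) a_j. -/
lemma frobSq_noiseTemporal_le (n : ℕ) (z : ℕ → Fin p × Fin q → ℂ)
    {a : Fin p → ℂ} (ha : sumSq a = 1) :
    frobSq (noiseTemporal n z a) ≤ frobSq (noiseDev n z) := by
  have h0 : sumSq (fun x : Fin p × Fin p => star (a x.1) * a x.2) = 1 := by
    have : sumSq (fun x : Fin p × Fin p => star (a x.1) * a x.2) = sumSq a * sumSq a := by
      simp [sumSq, Fintype.sum_prod_type, mul_pow, Finset.sum_mul_sum]
    rw [this, ha, one_mul]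
  have h1 : ∀ k l, ‖noiseTemporal n z a k l‖ ^ 2 ≤
      ∑ i, ∑ j, ‖noiseDev n z (i, k) (j, l)‖ ^ 2 := by
    intro k l
    have := norm_dotProduct_sq_le (fun x : Fin p × Fin p => noiseDev n z (x.1, k) (x.2, l))
      (fun x : Fin p × Fin p => star (a x.1) * a x.2)
    rw [h0, mul_one] at this
    refine this.trans (le_of_eq ?_)
    simp [sumSq, Fintype.sum_prod_type]
  calc _ ≤ ∑ k, ∑ l, ∑ i, ∑ j, ‖noiseDev n z (i, k) (j, l)‖ ^ 2 :=
        Finset.sum_le_sum fun k _ => Finset.sum_le_sum fun l _ => h1 k l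
    _ = _ := by
        unfold frobSq
        rw [Fintype.sum_prod_type_right]
        refine Finset.sum_congr rfl fun k _ => ?_
        rw [Finset.sum_comm]
        refine Finset.sum_congr rfl fun i _ => ?_
        rw [Fintype.sum_prod_type_right]

end Fluctuations

/-! ### Exact expansion of the two averaged matrices into clutter, perturbation and identity. -/

section Averages

variable {p q : ℕ} (h : Fin p → ℂ) (σ : ℝ) (u : ℕ → Fin q → ℂ) (z : ℕ → Fin p × Fin q → ℂ)

lemma isHermitian_sampleCov {ι : Type*} (n : ℕ) (x : ℕ → ι → ℂ) :
    (sampleCov n x).IsHermitian := by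
  ext i j
  simp [sampleCov, Matrix.sum_apply, vecMulVec_apply, mul_comm]

lemma isHermitian_spatialAverage {S : Matrix (Fin p × Fin q) (Fin p × Fin q) ℂ}
    (hS : S.IsHermitian) : (spatialAverage S).IsHermitian := by
  ext i j
  have h1 : ∀ x y, (starRingEnd ℂ) (S x y) = S y x := fun x y => hS.apply y x
  simp [spatialAverage, Matrix.sum_apply, h1]

lemma isHermitian_temporalAverage {A : Matrix (Fin p) (Fin p) ℂ} (hA : A.IsHermitian)
    {S : Matrix (Fin p × Fin q) (Fin p × Fin q) ℂ}
    (hS : S.IsHermitian) : (temporalAverage A S).IsHermitian := by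
  ext i j
  have h1 : ∀ x y, (starRingEnd ℂ) (S x y) = S y x := fun x y => hS.apply y x
  have h2 : ∀ x y, (starRingEnd ℂ) (A x y) = A y x := fun x y => hA.apply y x
  simp only [temporalAverage, Matrix.sum_apply, conjTranspose_apply, Matrix.smul_apply,
    smul_eq_mul, submatrix_apply, star_mul', star_sum, Complex.star_def, map_inv₀, h1, h2,
    Complex.conj_ofReal]
  congr 1
  rw [Finset.sum_comm]

lemma sampleCov_apply {ι : Type*} (n : ℕ) (x : ℕ → ι → ℂ) (i j : ι) :
    sampleCov n x i j = (n : ℂ)⁻¹ * ∑ m ∈ Finset.range n, x m i * star (x m j) := by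
  simp [sampleCov, Matrix.sum_apply, vecMulVec_apply]

/-- The perturbation of the spatial average caused by the noise. -/
noncomputable def spatialError (n : ℕ) : Matrix (Fin p) (Fin p) ℂ :=
  (σ : ℂ) • (vecMulVec h (star (crossVec n u z)) + vecMulVec (crossVec n u z) (star h)) +
    ((σ : ℂ) ^ 2) • noiseSpatial n z

/-- The perturbation of the temporal average caused by the noise. -/
noncomputable def temporalError (a : Fin p → ℂ) (n : ℕ) : Matrix (Fin q) (Fin q) ℂ :=
  (σ : ℂ) • ((star a ⬝ᵥ h) • crossTemporal n u z a + (star h ⬝ᵥ a) • (crossTemporal n u z a)ᴴ) +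
    ((σ : ℂ) ^ 2) • noiseTemporal n z a

/-- Centring the noise scatter isolates a multiple of the identity, which shifts eigenvalues but
leaves eigenvectors alone. The factor nq clears the normalizations. -/
lemma smul_spatialAverage_sampleCov {n : ℕ} (hn : n ≠ 0) (hq : q ≠ 0) :
    ((n : ℂ) * q) • spatialAverage (sampleCov n fun m => kronVec h (u m) + (σ : ℂ) • z m) =
      (energy n u : ℂ) • vecMulVec h (star h) + spatialError h σ u z n +
        (((σ ^ 2 * (n * q) : ℝ)) : ℂ) • 1 := by
  ext k l
  have hn' : (n : ℂ) ≠ 0 := by exact_mod_cast hn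
  have hq' : (q : ℂ) ≠ 0 := by exact_mod_cast hq
  have e1 : (energy n u : ℂ) = ∑ m ∈ Finset.range n, ∑ i, u m i * star (u m i) := by
    rw [energy, Complex.ofReal_sum]
    refine Finset.sum_congr rfl fun m _ => ?_
    rw [← star_dotProduct_self]
    exact Finset.sum_congr rfl fun i _ => mul_comm _ _
  have e2 : (((σ ^ 2 * (n * q) : ℝ)) : ℂ) * (1 : Matrix (Fin p) (Fin p) ℂ) k l =
      (σ : ℂ) ^ 2 * ∑ m ∈ Finset.range n, ∑ i : Fin q, if k = l then 1 else 0 := by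
    simp [Matrix.one_apply]
  have e3 : noiseSpatial n z k l = ∑ m ∈ Finset.range n, ∑ i : Fin q,
      (z m (k, i) * star (z m (l, i)) - if k = l then 1 else 0) := by
    simp only [noiseSpatial, noiseDev_apply, Prod.mk.injEq, and_true]
    rw [Finset.sum_comm]
  have e4 : ((n : ℂ) * q) * spatialAverage (sampleCov n fun m => kronVec h (u m) + (σ : ℂ) • z m)
      k l = ∑ m ∈ Finset.range n, ∑ i : Fin q, (h k * u m i + σ * z m (k, i)) *
        star (h l * u m i + σ * z m (l, i)) := by
    simp only [spatialAverage, Matrix.smul_apply, Matrix.sum_apply, submatrix_apply,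
      sampleCov_apply, ← Finset.mul_sum, smul_eq_mul, kronVec, Pi.add_apply, Pi.smul_apply]
    rw [Finset.sum_comm]
    field_simp
    simp only [mul_comm (u _ _) (h _)]
  simp only [Matrix.smul_apply, Matrix.add_apply, smul_eq_mul, spatialError, vecMulVec_apply,
    Pi.star_apply]
  rw [e4, e2, e3, e1, crossVec_apply, crossVec_apply]
  simp only [star_sum, Finset.sum_mul, Finset.mul_sum, ← Finset.sum_add_distrib]
  refine Finset.sum_congr rfl fun m _ => Finset.sum_congr rfl fun i _ => ?_
  simp only [star_add, star_mul', Complex.star_def, Complex.conj_ofReal,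
    Complex.conj_conj]
  ring

/-- For weights a aᴴ with unit a, the temporal average is the sample covariance of the projected
samples (aᴴ ⊗ I)x_m. Their clutter part is (aᴴh) u_m, whence the factor |hᴴa|². -/
lemma smul_temporalAverage_sampleCov {n : ℕ} (hn : n ≠ 0) {UA : Matrix (Fin p) (Fin 1) ℂ}
    {a : Fin p → ℂ} (hUA : ∀ i, UA i 0 = a i) (ha : sumSq a = 1) :
    (n : ℂ) • temporalAverage (UA * UAᴴ)
        (sampleCov n fun m => kronVec h (u m) + (σ : ℂ) • z m) =
      ((‖star h ⬝ᵥ a‖ ^ 2 : ℝ) : ℂ) • ∑ m ∈ Finset.range n, vecMulVec (u m) (star (u m)) +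
        temporalError h σ u z a n + ((σ ^ 2 * n : ℝ) : ℂ) • 1 := by
  have hA : ∀ i j, (UA * UAᴴ) i j = a i * star (a j) := by
    intro i j; simp [Matrix.mul_apply, hUA]
  have hnorm : (∑ i, ∑ j, ‖(UA * UAᴴ) i j‖ ^ 2 : ℝ) = 1 := by
    have : (∑ i, ∑ j, ‖(UA * UAᴴ) i j‖ ^ 2 : ℝ) = sumSq a * sumSq a := by
      simp [hA, sumSq, mul_pow, Finset.sum_mul_sum]
    rw [this, ha, one_mul]
  have hn' : (n : ℂ) ≠ 0 := by exact_mod_cast hn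
  ext k l
  set t : ℕ → Fin q → ℂ := fun m k => ∑ i, star (a i) * z m (i, k)
  have e0 : star (star a ⬝ᵥ h) = star h ⬝ᵥ a := by
    rw [Matrix.star_dotProduct, star_star]
  have e1 : (n : ℂ) * temporalAverage (UA * UAᴴ)
        (sampleCov n fun m => kronVec h (u m) + (σ : ℂ) • z m) k l =
      ∑ m ∈ Finset.range n, ((star a ⬝ᵥ h) * u m k + σ * t m k) *
        star ((star a ⬝ᵥ h) * u m l + σ * t m l) := by
    have e2 : ∀ m k, (star a ⬝ᵥ h) * u m k + σ * t m k =
        ∑ i, star (a i) * (h i * u m k + σ * z m (i, k)) := by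
      intro m k
      simp only [t, dotProduct, Finset.sum_mul, Finset.mul_sum, ← Finset.sum_add_distrib,
        Pi.star_apply]
      exact Finset.sum_congr rfl fun i _ => by ring
    simp only [temporalAverage, Matrix.smul_apply, Matrix.sum_apply, submatrix_apply,
      sampleCov_apply, smul_eq_mul, kronVec, Pi.add_apply, Pi.smul_apply, e2]
    rw [hnorm]
    simp only [Complex.ofReal_one, inv_one, one_mul, star_sum, Finset.sum_mul_sum, hA]
    symm
    rw [Finset.sum_comm, Finset.mul_sum]
    refine Finset.sum_congr rfl fun i _ => ?_
    rw [Finset.sum_comm, Finset.mul_sum]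
    refine Finset.sum_congr rfl fun j _ => ?_
    simp only [Finset.mul_sum]
    refine Finset.sum_congr rfl fun m _ => ?_
    simp only [star_mul', star_star]
    field_simp
  have e3 : ∀ k l, crossTemporal n u z a k l =
      ∑ m ∈ Finset.range n, u m k * star (t m l) := by
    intro k l
    simp only [crossTemporal, crossSum_apply, t, star_sum, Finset.mul_sum, Finset.sum_mul]
    rw [Finset.sum_comm]
    exact Finset.sum_congr rfl fun m _ => Finset.sum_congr rfl fun i _ => by
      rw [star_mul', star_star]; ring
  have e4 : noiseTemporal n z a k l + n * (1 : Matrix (Fin q) (Fin q) ℂ) k l =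
      ∑ m ∈ Finset.range n, t m k * star (t m l) := by
    have e5 : (1 : Matrix (Fin q) (Fin q) ℂ) k l = ∑ x : Fin p × Fin p,
        (if (x.1, k) = (x.2, l) then 1 else 0) * (star (a x.1) * a x.2) := by
      have : (sumSq a : ℂ) = 1 := by rw [ha]; rfl
      rw [Fintype.sum_prod_type]
      by_cases hkl : k = l
      · subst hkl
        rw [← star_dotProduct_self] at this
        simpa [dotProduct] using this.symm
      · simp [hkl]
    have e6 : (n : ℂ) * (1 : Matrix (Fin q) (Fin q) ℂ) k l = ∑ m ∈ Finset.range n,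
        (1 : Matrix (Fin q) (Fin q) ℂ) k l := by simp
    rw [e6]
    simp only [noiseTemporal, noiseDev_apply, e5, t, star_sum, Finset.sum_mul_sum]
    simp only [Finset.sum_mul]
    rw [Finset.sum_comm, ← Finset.sum_add_distrib]
    refine Finset.sum_congr rfl fun m _ => ?_
    rw [← Finset.sum_add_distrib, Fintype.sum_prod_type]
    refine Finset.sum_congr rfl fun i _ => Finset.sum_congr rfl fun j _ => ?_
    rw [star_mul', star_star]
    ring
  have e7 : ((‖star h ⬝ᵥ a‖ ^ 2 : ℝ) : ℂ) = (star a ⬝ᵥ h) * star (star a ⬝ᵥ h) := by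
    rw [Complex.star_def, Complex.mul_conj', norm_star_dotProduct_comm]; push_cast; rfl
  simp only [Matrix.smul_apply, Matrix.add_apply, smul_eq_mul, temporalError, vecMulVec_apply,
    Pi.star_apply, Matrix.sum_apply, conjTranspose_apply]
  rw [e1, e7, e3, e3, ← e0]
  have e8 : ((σ ^ 2 * n : ℝ) : ℂ) * (1 : Matrix (Fin q) (Fin q) ℂ) k l =
    (σ : ℂ) ^ 2 * (n * (1 : Matrix (Fin q) (Fin q) ℂ) k l) := by push_cast; ring
  rw [e8, add_assoc, add_assoc, ← mul_add, e4]
  simp only [star_sum, Finset.mul_sum, ← Finset.sum_add_distrib]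
  refine Finset.sum_congr rfl fun m _ => ?_
  simp only [star_add, star_mul', Complex.star_def, Complex.conj_ofReal,
    Complex.conj_conj]
  ring

end Averages

/-! ### Eigenvalue bounds and the tested eigenvector equation under perturbation. -/

section Perturbation

variable {ι : Type*} [Fintype ι]

lemma vecMulVec_bilin (v a b w : ι → ℂ) :
    star v ⬝ᵥ (vecMulVec a (star b) *ᵥ w) = (star v ⬝ᵥ a) * (star b ⬝ᵥ w) := by
  rw [Matrix.vecMulVec_mulVec]
  simp [mul_comm]

lemma norm_re_le_of_bilin {M : Matrix ι ι ℂ} {e : ℝ}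
    (hE : ∀ v w : ι → ℂ, ‖star v ⬝ᵥ (M *ᵥ w)‖ ≤ e * √(sumSq v) * √(sumSq w)) (v : ι → ℂ) :
    |(star v ⬝ᵥ (M *ᵥ v)).re| ≤ e * sumSq v := by
  refine (Complex.abs_re_le_norm _).trans ((hE v v).trans (le_of_eq ?_))
  rw [mul_assoc, Real.mul_self_sqrt (sumSq_nonneg v)]

lemma sumSq_col_eq_one {r : ℕ} {U : Matrix ι (Fin r) ℂ} (hU : Uᴴ * U = 1) (k : Fin r) : sumSq (U.col k) = 1 := by
  have h1 : star (U.col k) ⬝ᵥ U.col k = 1 := by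
    have := congrFun (congrFun hU k) k
    rwa [Matrix.one_apply_eq] at this
  rw [sumSq_eq_re, h1, Complex.one_re]

variable [DecidableEq ι] {r : ℕ} {M P E : Matrix ι ι ℂ} {U : Matrix ι (Fin r) ℂ} {s : Fin r → ℝ}
  {N β : ℝ}

/-- A Weyl-type bound: on V the perturbation lowers the form of `P` by at most e, and the min-max
lemma applies. Subtracting β removes the noise floor. -/
lemma sub_le_principal_eigenvalue (hM : M.IsHermitian) (hN : 0 < N)
    (hMeq : (N : ℂ) • M = P + E + (β : ℂ) • 1) (hU : Uᴴ * U = 1)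
    (hMU : M * U = U * diagonal (fun k => (s k : ℂ)))
    (hs : ∀ k, ∀ v : ι → ℂ, Uᴴ *ᵥ v = 0 → (star v ⬝ᵥ (M *ᵥ v)).re ≤ s k * (star v ⬝ᵥ v).re)
    (V : Submodule ℂ (ι → ℂ)) (hV : r ≤ Module.finrank ℂ V) {a e : ℝ}
    (hP : ∀ v ∈ V, a * sumSq v ≤ (star v ⬝ᵥ (P *ᵥ v)).re)
    (hE : ∀ v w : ι → ℂ, ‖star v ⬝ᵥ (E *ᵥ w)‖ ≤ e * √(sumSq v) * √(sumSq w)) (k : Fin r) :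
    a - e ≤ N * s k - β := by
  have h1 : (a - e + β) / N ≤ s k := by
    refine le_principal_eigenvalue hM hU hMU hs V hV (fun v hv => ?_) k
    have h2 := congrArg (fun A => (star v ⬝ᵥ (A *ᵥ v)).re) hMeq
    simp only [Matrix.add_mulVec, Matrix.smul_mulVec, Matrix.one_mulVec, dotProduct_add,
      dotProduct_smul, smul_eq_mul, Complex.add_re, Complex.re_ofReal_mul, ← sumSq_eq_re] at h2
    have h3 := hP v hv
    have h4 := (abs_le.1 (norm_re_le_of_bilin hE v)).1
    rw [div_mul_eq_mul_div, div_le_iff₀ hN]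
    nlinarith
  rw [div_le_iff₀ hN] at h1
  linarith

lemma principal_component_equation (hMeq : (N : ℂ) • M = P + E + (β : ℂ) • 1)
    (hMU : M * U = U * diagonal (fun k => (s k : ℂ))) (k : Fin r) (v : ι → ℂ) :
    ((N * s k - β : ℝ) : ℂ) * (star v ⬝ᵥ U.col k) =
      star v ⬝ᵥ (P *ᵥ U.col k) + star v ⬝ᵥ (E *ᵥ U.col k) := by
  have h1 : M *ᵥ U.col k = (s k : ℂ) • U.col k := by
    ext i
    have := congrFun (congrFun hMU i) k
    rw [Matrix.mul_diagonal] at this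
    rw [Pi.smul_apply, smul_eq_mul, mul_comm]
    exact this
  have h2 := congrArg (fun A => star v ⬝ᵥ (A *ᵥ U.col k)) hMeq
  simp only [Matrix.add_mulVec, Matrix.smul_mulVec, Matrix.one_mulVec, dotProduct_add,
      dotProduct_smul, smul_eq_mul, h1] at h2
  push_cast
  linear_combination h2

end Perturbation

/-! ### The spatial and temporal estimation stages. -/

section Stages

variable {p q : ℕ} (h : Fin p → ℂ) {σ : ℝ} (u : ℕ → Fin q → ℂ) (z : ℕ → Fin p × Fin q → ℂ)

/-- A constant that bounds the perturbations of both averages in terms of `fluct`. -/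
noncomputable def errConst (q : ℕ) (h : Fin p → ℂ) : ℝ := (2 * √(sumSq h) + 1) * √q

lemma errConst_nonneg (q : ℕ) : 0 ≤ errConst q h := by unfold errConst; positivity

lemma sqrt_sumSq_crossVec_le (n : ℕ) :
    √(sumSq (crossVec n u z)) ≤ √q * √(fluct n u z) := by
  rw [← Real.sqrt_mul (Nat.cast_nonneg q)]
  refine Real.sqrt_le_sqrt ((sumSq_crossVec_le n u z).trans ?_)
  exact mul_le_mul_of_nonneg_left (le_add_of_nonneg_right (frobSq_nonneg _)) (Nat.cast_nonneg q)

lemma sqrt_frobSq_noiseSpatial_le (n : ℕ) :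
    √(frobSq (noiseSpatial n z)) ≤ √q * √(fluct n u z) := by
  rw [← Real.sqrt_mul (Nat.cast_nonneg q)]
  refine Real.sqrt_le_sqrt ((frobSq_noiseSpatial_le n z).trans ?_)
  exact mul_le_mul_of_nonneg_left (le_add_of_nonneg_left (frobSq_nonneg _)) (Nat.cast_nonneg q)

lemma sqrt_frobSq_crossTemporal_le (n : ℕ) {a : Fin p → ℂ} (ha : sumSq a = 1) :
    √(frobSq (crossTemporal n u z a)) ≤ √(fluct n u z) :=
  Real.sqrt_le_sqrt ((frobSq_crossTemporal_le n u z ha).trans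
    (le_add_of_nonneg_right (frobSq_nonneg _)))

lemma sqrt_frobSq_noiseTemporal_le (n : ℕ) {a : Fin p → ℂ} (ha : sumSq a = 1) :
    √(frobSq (noiseTemporal n z a)) ≤ √(fluct n u z) :=
  Real.sqrt_le_sqrt ((frobSq_noiseTemporal_le n z ha).trans
    (le_add_of_nonneg_left (frobSq_nonneg _)))

lemma spatialError_bilin (n : ℕ) (v w : Fin p → ℂ) :
    star v ⬝ᵥ (spatialError h σ u z n *ᵥ w) =
      σ * ((star v ⬝ᵥ h) * (star (crossVec n u z) ⬝ᵥ w) +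
        (star v ⬝ᵥ crossVec n u z) * (star h ⬝ᵥ w)) +
      σ ^ 2 * (star v ⬝ᵥ (noiseSpatial n z *ᵥ w)) := by
  simp only [spatialError, Matrix.add_mulVec, Matrix.smul_mulVec, dotProduct_add,
      dotProduct_smul, smul_eq_mul, vecMulVec_bilin]

/-- The two cross terms contribute 2√(`sumSq h`) and the noise scatter contributes 1 to `errConst`,
since σ² ≤ σ; contraction over the pulses costs √q. -/
lemma norm_spatialError_le (h0 : 0 ≤ σ) (h1 : σ ≤ 1) (n : ℕ) (v w : Fin p → ℂ) :
    ‖star v ⬝ᵥ (spatialError h σ u z n *ᵥ w)‖ ≤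
      (errConst q h * σ * √(fluct n u z)) * √(sumSq v) * √(sumSq w) := by
  rw [spatialError_bilin]
  have b1 := norm_star_dotProduct_le v h
  have b2 := norm_star_dotProduct_le (crossVec n u z) w
  have b3 := norm_star_dotProduct_le v (crossVec n u z)
  have b4 := norm_star_dotProduct_le h w
  have b5 := norm_bilin_le (noiseSpatial n z) v w
  have c1 := sqrt_sumSq_crossVec_le u z n
  have c2 := sqrt_frobSq_noiseSpatial_le u z n
  set F := √(fluct n u z)
  set Q := √(q : ℝ)
  set H := √(sumSq h)
  have hσ : σ ^ 2 ≤ σ := by nlinarith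
  calc _ ≤ σ * (√(sumSq v) * H * ((Q * F) * √(sumSq w)) + √(sumSq v) * (Q * F) * (H * √(sumSq w)))
        + σ * (Q * F * √(sumSq v) * √(sumSq w)) := by
        refine (norm_add_le _ _).trans (add_le_add ?_ ?_)
        · rw [norm_mul, Complex.norm_of_nonneg h0]
          refine mul_le_mul_of_nonneg_left ((norm_add_le _ _).trans ?_) h0
          rw [norm_mul, norm_mul]
          gcongr
          · exact b2.trans (by gcongr)
          · exact b3.trans (by gcongr)
        · rw [norm_mul, norm_pow, Complex.norm_of_nonneg h0]
          gcongr
          exact b5.trans (by gcongr)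
    _ = _ := by unfold errConst; ring

lemma norm_temporalError_le (h0 : 0 ≤ σ) (h1 : σ ≤ 1) (hq : q ≠ 0) (n : ℕ) {a : Fin p → ℂ}
    (ha : sumSq a = 1) (v w : Fin q → ℂ) :
    ‖star v ⬝ᵥ (temporalError h σ u z a n *ᵥ w)‖ ≤
      (errConst q h * σ * √(fluct n u z)) * √(sumSq v) * √(sumSq w) := by
  have e1 : star v ⬝ᵥ ((crossTemporal n u z a)ᴴ *ᵥ w) =
      star (star w ⬝ᵥ (crossTemporal n u z a *ᵥ v)) := by
    rw [← Matrix.star_dotProduct, Matrix.star_mulVec, Matrix.dotProduct_mulVec]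
  have e2 : star v ⬝ᵥ (temporalError h σ u z a n *ᵥ w) =
      σ * ((star a ⬝ᵥ h) * (star v ⬝ᵥ (crossTemporal n u z a *ᵥ w)) +
        (star h ⬝ᵥ a) * star (star w ⬝ᵥ (crossTemporal n u z a *ᵥ v))) +
      σ ^ 2 * (star v ⬝ᵥ (noiseTemporal n z a *ᵥ w)) := by
    simp only [temporalError, Matrix.add_mulVec, Matrix.smul_mulVec, dotProduct_add,
      dotProduct_smul, smul_eq_mul, e1]
  rw [e2]
  have b1 := norm_star_dotProduct_le a h
  have b2 := norm_star_dotProduct_le h a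
  have b3 := norm_bilin_le (crossTemporal n u z a) v w
  have b4 := norm_bilin_le (crossTemporal n u z a) w v
  have b5 := norm_bilin_le (noiseTemporal n z a) v w
  have c1 := sqrt_frobSq_crossTemporal_le u z n ha
  have c2 := sqrt_frobSq_noiseTemporal_le u z n ha
  rw [ha, Real.sqrt_one] at b1 b2
  set F := √(fluct n u z)
  set H := √(sumSq h)
  have hσ : σ ^ 2 ≤ σ := by nlinarith
  have hQ : 1 ≤ √(q : ℝ) := by
    rw [Real.one_le_sqrt]; exact_mod_cast Nat.one_le_iff_ne_zero.2 hq
  calc _ ≤ σ * (1 * H * (F * √(sumSq v) * √(sumSq w)) + H * 1 * (F * √(sumSq w) * √(sumSq v)))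
        + σ * (F * √(sumSq v) * √(sumSq w)) := by
        refine (norm_add_le _ _).trans (add_le_add ?_ ?_)
        · rw [norm_mul, Complex.norm_of_nonneg h0]
          refine mul_le_mul_of_nonneg_left ((norm_add_le _ _).trans ?_) h0
          rw [norm_mul, norm_mul, norm_star]
          gcongr
          · exact b3.trans (by gcongr)
          · exact b4.trans (by gcongr)
        · rw [norm_mul, norm_pow, Complex.norm_of_nonneg h0]
          gcongr
          exact b5.trans (by gcongr)
    _ = ((2 * H + 1) * 1 * σ * F) * √(sumSq v) * √(sumSq w) := by ring
    _ ≤ _ := by unfold errConst; gcongr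

/-- The spatial stage: the leading eigenvalue, shifted by the noise power, and its equation. -/
lemma spatial_stage (hh : h ≠ 0) (h0 : 0 ≤ σ) (h1 : σ ≤ 1) {n : ℕ} (hn : n ≠ 0) (hq : q ≠ 0)
    {UA : Matrix (Fin p) (Fin 1) ℂ}
    (hUA : IsPrincipalComponents
      (spatialAverage (sampleCov n fun m => kronVec h (u m) + (σ : ℂ) • z m)) UA) :
    ∃ l : ℝ, energy n u * sumSq h - errConst q h * σ * √(fluct n u z) ≤ l ∧
      |l - energy n u * ‖star h ⬝ᵥ UA.col 0‖ ^ 2| ≤ errConst q h * σ * √(fluct n u z) ∧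
      ∀ v, (l : ℂ) * (star v ⬝ᵥ UA.col 0) =
        energy n u * ((star v ⬝ᵥ h) * (star h ⬝ᵥ UA.col 0)) +
          star v ⬝ᵥ (spatialError h σ u z n *ᵥ UA.col 0) := by
  obtain ⟨hU, s, hMU, hs⟩ := hUA
  have hM := isHermitian_spatialAverage
    (isHermitian_sampleCov n fun m => kronVec h (u m) + (σ : ℂ) • z m)
  have hMeq := smul_spatialAverage_sampleCov h σ u z hn hq
  have hN : (0 : ℝ) < n * q := by positivity
  have hE := norm_spatialError_le h u z h0 h1 n
  have hnq : (n : ℂ) * q = ((n * q : ℝ) : ℂ) := by push_cast; rfl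
  rw [hnq] at hMeq
  have heq := principal_component_equation hMeq hMU 0
  have ha := sumSq_col_eq_one hU 0
  simp only [Matrix.smul_mulVec, dotProduct_smul, smul_eq_mul, vecMulVec_bilin] at heq
  refine ⟨_, ?_, ?_, heq⟩
  -- The line through h is the trial space; there the clutter form has Rayleigh quotient `energy n u
  -- * sumSq h`.
  · refine sub_le_principal_eigenvalue hM hN hMeq hU hMU hs (Submodule.span ℂ {h})
      (by rw [finrank_span_singleton hh]) (fun v hv => ?_) hE 0
    obtain ⟨c, rfl⟩ := Submodule.mem_span_singleton.1 hv
    simp only [Matrix.smul_mulVec, dotProduct_smul, smul_eq_mul, vecMulVec_bilin,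
      Complex.re_ofReal_mul, sumSq_smul, star_smul, smul_dotProduct, star_dotProduct_self]
    rw [show star c * ((sumSq h : ℂ) * (c * sumSq h)) = (star c * c) * ((sumSq h * sumSq h : ℝ) : ℂ) by
      push_cast; ring, Complex.star_def, Complex.conj_mul', ← Complex.ofReal_pow,
      ← Complex.ofReal_mul, Complex.ofReal_re]
    exact le_of_eq (by ring)
  -- Testing the eigenvector equation against the unit eigenvector itself expresses l as energy
  -- times |hᴴa|² plus an error.
  · have h2 := heq (UA.col 0)
    have h3 := norm_re_le_of_bilin hE (UA.col 0)
    rw [star_dotProduct_self, ha, Complex.ofReal_one, mul_one] at h2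
    rw [ha, mul_one] at h3
    have h4 := congrArg Complex.re h2
    have h5 : (star (UA.col 0) ⬝ᵥ h) * (star h ⬝ᵥ UA.col 0) =
        ((‖star h ⬝ᵥ UA.col 0‖ ^ 2 : ℝ) : ℂ) := by
      have : star (UA.col 0) ⬝ᵥ h = star (star h ⬝ᵥ UA.col 0) := by
        rw [Matrix.star_dotProduct]
      rw [this, Complex.star_def, Complex.conj_mul']; push_cast; rfl
    rw [h5, Complex.add_re, ← Complex.ofReal_mul, Complex.ofReal_re, Complex.ofReal_re] at h4
    rw [h4, add_sub_cancel_left]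
    exact h3

/-- The temporal stage: the leading eigenvectors are nearly orthogonal to every vector that is
orthogonal to the clutter. -/
lemma temporal_stage (h0 : 0 ≤ σ) (h1 : σ ≤ 1) {n : ℕ} (hn : n ≠ 0) (hq : q ≠ 0)
    {UA : Matrix (Fin p) (Fin 1) ℂ} (hUA : sumSq (UA.col 0) = 1) {r : ℕ}
    {UB : Matrix (Fin q) (Fin r) ℂ}
    (hUB : IsPrincipalComponents (temporalAverage (UA * UAᴴ)
      (sampleCov n fun m => kronVec h (u m) + (σ : ℂ) • z m)) UB)
    (V : Submodule ℂ (Fin q → ℂ)) (hV : r ≤ Module.finrank ℂ V) {c : ℝ}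
    (hc : ∀ v ∈ V, c * sumSq v ≤ ∑ m ∈ Finset.range n, ‖star v ⬝ᵥ u m‖ ^ 2)
    {v : Fin q → ℂ} (hv : ∀ m < n, star v ⬝ᵥ u m = 0) (k : Fin r) :
    (‖star h ⬝ᵥ UA.col 0‖ ^ 2 * c - errConst q h * σ * √(fluct n u z)) * ‖star v ⬝ᵥ UB.col k‖ ≤
      errConst q h * σ * √(fluct n u z) * √(sumSq v) := by
  obtain ⟨hU, s, hMU, hs⟩ := hUB
  have hM := isHermitian_temporalAverage (Matrix.isHermitian_mul_conjTranspose_self UA)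
    (isHermitian_sampleCov n fun m => kronVec h (u m) + (σ : ℂ) • z m)
  have hMeq := smul_temporalAverage_sampleCov h σ u z hn (UA := UA) (a := UA.col 0)
    (fun _ => rfl) hUA
  rw [← Complex.ofReal_natCast n] at hMeq
  have hN : (0 : ℝ) < n := by positivity
  have hE := norm_temporalError_le h u z h0 h1 hq n hUA
  have heq := principal_component_equation hMeq hMU k v
  have hform : ∀ w w' : Fin q → ℂ,
      star w ⬝ᵥ ((∑ m ∈ Finset.range n, vecMulVec (u m) (star (u m))) *ᵥ w') =
      ∑ m ∈ Finset.range n, (star w ⬝ᵥ u m) * (star (u m) ⬝ᵥ w') := by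
    intro w w'
    rw [Matrix.sum_mulVec, dotProduct_sum]
    exact Finset.sum_congr rfl fun m _ => vecMulVec_bilin _ _ _ _
  -- The test vector annihilates the clutter scatter, so the shifted eigenvalue times the overlap
  -- equals the error term alone. The lower bound on that eigenvalue makes the overlap small.
  rw [Matrix.smul_mulVec, dotProduct_smul, hform, Finset.sum_eq_zero, smul_zero, zero_add] at heq
  · have hl := sub_le_principal_eigenvalue hM hN hMeq hU hMU hs V hV
      (a := ‖star h ⬝ᵥ UA.col 0‖ ^ 2 * c) (fun w hw => ?_) hE k
    · have h2 := hE v (UB.col k)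
      rw [← heq, norm_mul, Complex.norm_real, sumSq_col_eq_one hU k, Real.sqrt_one, mul_one] at h2
      refine le_trans ?_ h2
      gcongr
      exact hl.trans (le_abs_self _)
    · rw [Matrix.smul_mulVec, dotProduct_smul, hform, smul_eq_mul, Complex.re_ofReal_mul, mul_assoc]
      refine mul_le_mul_of_nonneg_left ((hc w hw).trans (le_of_eq ?_)) (by positivity)
      rw [Complex.re_sum]
      refine Finset.sum_congr rfl fun m _ => ?_
      have : star (u m) ⬝ᵥ w = star (star w ⬝ᵥ u m) := by
        rw [Matrix.star_dotProduct]
      rw [this, Complex.star_def, Complex.mul_conj', ← Complex.ofReal_pow, Complex.ofReal_re]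
  · intro m hm
    rw [hv m (Finset.mem_range.1 hm), zero_mul]

end Stages

/-! ### Orthogonal projections built from isometries. -/

section Projection

variable {ι : Type*} [Fintype ι] {r : ℕ} {U : Matrix ι (Fin r) ℂ}

lemma sumSq_mulVec_of_isometry (hU : Uᴴ * U = 1) (v : Fin r → ℂ) :
    sumSq (U *ᵥ v) = sumSq v := by
  rw [sumSq_eq_re, sumSq_eq_re, Matrix.star_mulVec, ← Matrix.dotProduct_mulVec,
    Matrix.mulVec_mulVec, hU, Matrix.one_mulVec]

lemma sumSq_sub_projection [DecidableEq ι] (hU : Uᴴ * U = 1) (v : ι → ℂ) :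
    sumSq ((1 - U * Uᴴ) *ᵥ v) = sumSq v - sumSq (Uᴴ *ᵥ v) := by
  have h1 : (1 - U * Uᴴ)ᴴ * (1 - U * Uᴴ) = 1 - U * Uᴴ := by
    have : U * Uᴴ * (U * Uᴴ) = U * Uᴴ := by
      rw [Matrix.mul_assoc, ← Matrix.mul_assoc Uᴴ U, hU, Matrix.one_mul]
    simp [Matrix.sub_mul, Matrix.mul_sub, this]
  rw [sumSq_eq_re, sumSq_eq_re, sumSq_eq_re, Matrix.star_mulVec, ← Matrix.dotProduct_mulVec,
    Matrix.mulVec_mulVec, h1, Matrix.star_mulVec, ← Matrix.dotProduct_mulVec,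
    Matrix.mulVec_mulVec, conjTranspose_conjTranspose, Matrix.sub_mulVec, dotProduct_sub,
    Matrix.one_mulVec, Complex.sub_re]

lemma projection_mul_self [DecidableEq ι] (hU : Uᴴ * U = 1) :
    (1 - U * Uᴴ) * (1 - U * Uᴴ) = 1 - U * Uᴴ := by
  have : U * Uᴴ * (U * Uᴴ) = U * Uᴴ := by
    rw [Matrix.mul_assoc, ← Matrix.mul_assoc Uᴴ U, hU, Matrix.one_mul]
  simp [Matrix.sub_mul, Matrix.mul_sub, this]

end Projection

/-! ### The Kronecker filter, target energy, clutter leakage and the exact SINR loss. -/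

section Filter

variable {p q : ℕ}

/-- The contraction `(aᴴ ⊗ I) d`. -/
noncomputable def contract (a : Fin p → ℂ) (d : Fin p × Fin q → ℂ) : Fin q → ℂ :=
  fun j => ∑ i, star (a i) * d (i, j)

variable {r s : ℕ} {UA : Matrix (Fin p) (Fin s) ℂ} {UB : Matrix (Fin q) (Fin r) ℂ}

lemma isHermitian_kronFilter : (kronFilter UA UB)ᴴ = kronFilter UA UB := by
  simp [kronFilter, Matrix.conjTranspose_kronecker]

lemma kronFilter_mul_self (hA : UAᴴ * UA = 1) (hB : UBᴴ * UB = 1) :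
    kronFilter UA UB * kronFilter UA UB = kronFilter UA UB := by
  rw [kronFilter, ← Matrix.mul_kronecker_mul, projection_mul_self hA, projection_mul_self hB]

lemma star_kronFilter_dotProduct (hA : UAᴴ * UA = 1) (hB : UBᴴ * UB = 1)
    (d : Fin p × Fin q → ℂ) :
    star (kronFilter UA UB *ᵥ d) ⬝ᵥ d = (sumSq (kronFilter UA UB *ᵥ d) : ℂ) := by
  rw [← star_dotProduct_self, Matrix.star_mulVec, isHermitian_kronFilter,
    ← Matrix.dotProduct_mulVec, ← Matrix.dotProduct_mulVec, Matrix.mulVec_mulVec,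
    kronFilter_mul_self hA hB]

lemma kronFilter_mulVec_apply (d : Fin p × Fin q → ℂ) (i j) :
    (kronFilter UA UB *ᵥ d) (i, j) =
      ((1 - UB * UBᴴ) *ᵥ fun l => ((1 - UA * UAᴴ) *ᵥ fun k => d (k, l)) i) j := by
  simp only [kronFilter, Matrix.mulVec, dotProduct, Fintype.sum_prod_type, kroneckerMap_apply,
    Finset.mul_sum]
  rw [Finset.sum_comm]
  exact Finset.sum_congr rfl fun _ _ => Finset.sum_congr rfl fun _ _ => by ring

lemma mulVec_mulVec_comm {ι κ ι' κ' : Type*} [Fintype ι] [Fintype κ] (A : Matrix ι' ι ℂ)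
    (B : Matrix κ' κ ℂ) (d : ι × κ → ℂ) (i j) :
    (B *ᵥ fun l => (A *ᵥ fun k => d (k, l)) i) j = (A *ᵥ fun k => (B *ᵥ fun l => d (k, l)) j) i := by
  simp only [Matrix.mulVec, dotProduct, Finset.mul_sum]
  rw [Finset.sum_comm]
  exact Finset.sum_congr rfl fun _ _ => Finset.sum_congr rfl fun _ _ => by ring

lemma sumSq_prod (d : Fin p × Fin q → ℂ) : sumSq d = ∑ i, sumSq fun j => d (i, j) := by
  simp [sumSq, Fintype.sum_prod_type]

lemma sumSq_prod_right (d : Fin p × Fin q → ℂ) : sumSq d = ∑ j, sumSq fun i => d (i, j) := by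
  simp [sumSq, Fintype.sum_prod_type_right]

lemma conjTranspose_mulVec_fin_one (UA : Matrix (Fin p) (Fin 1) ℂ) (d : Fin p × Fin q → ℂ) (j) :
    UAᴴ *ᵥ (fun i => d (i, j)) = fun _ => contract (UA.col 0) d j := by
  ext k
  fin_cases k
  simp [Matrix.mulVec, dotProduct, contract]

lemma projection_fin_one_apply (UA : Matrix (Fin p) (Fin 1) ℂ) (v : Fin p → ℂ) (i) :
    ((1 - UA * UAᴴ) *ᵥ v) i = v i - UA.col 0 i * (star (UA.col 0) ⬝ᵥ v) := by
  rw [Matrix.sub_mulVec, Matrix.one_mulVec, ← Matrix.mulVec_mulVec]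
  simp [Matrix.mulVec, dotProduct, -Matrix.mulVec_mulVec]

/-- The vector `((I - U Uᴴ) ⊗ I) d`. -/
noncomputable def spatialProj (UA : Matrix (Fin p) (Fin 1) ℂ) (d : Fin p × Fin q → ℂ) :
    Fin p × Fin q → ℂ :=
  fun x => ((1 - UA * UAᴴ) *ᵥ fun k => d (k, x.2)) x.1

lemma sumSq_spatialProj {UA : Matrix (Fin p) (Fin 1) ℂ} (hA : UAᴴ * UA = 1)
    (d : Fin p × Fin q → ℂ) :
    sumSq (spatialProj UA d) = sumSq d - sumSq (contract (UA.col 0) d) := by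
  have h1 : ∀ j, sumSq (fun i => spatialProj UA d (i, j)) =
      sumSq (fun i => d (i, j)) - ‖contract (UA.col 0) d j‖ ^ 2 := by
    intro j
    have h2 := sumSq_sub_projection hA fun i => d (i, j)
    rw [conjTranspose_mulVec_fin_one] at h2
    refine h2.trans ?_
    simp [sumSq]
  rw [sumSq_prod_right, sumSq_prod_right d, sumSq, ← Finset.sum_sub_distrib]
  exact Finset.sum_congr rfl fun j _ => h1 j

lemma sumSq_kronFilter {UA : Matrix (Fin p) (Fin 1) ℂ}
    (hB : UBᴴ * UB = 1) (d : Fin p × Fin q → ℂ) :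
    sumSq (kronFilter UA UB *ᵥ d) = sumSq (spatialProj UA d) -
      ∑ i, sumSq (UBᴴ *ᵥ fun l => spatialProj UA d (i, l)) := by
  rw [sumSq_prod, sumSq_prod, ← Finset.sum_sub_distrib]
  refine Finset.sum_congr rfl fun i _ => ?_
  rw [← sumSq_sub_projection hB]
  congr 1
  ext j
  exact kronFilter_mulVec_apply d i j

lemma sumSq_kronFilter_le {UA : Matrix (Fin p) (Fin 1) ℂ} (hA : UAᴴ * UA = 1)
    (hB : UBᴴ * UB = 1) (d : Fin p × Fin q → ℂ) :
    sumSq (kronFilter UA UB *ᵥ d) ≤ sumSq d := by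
  rw [sumSq_kronFilter hB, sumSq_spatialProj hA]
  have := Finset.sum_nonneg fun i (_ : i ∈ Finset.univ) =>
    sumSq_nonneg (UBᴴ *ᵥ fun l => spatialProj UA d (i, l))
  linarith [sumSq_nonneg (contract (UA.col 0) d)]

/-- The two factors act on different indices and commute, so the spatial projection, being a
contraction, can only shrink the energy that the temporal factor removes. -/
lemma sumSq_sub_kronFilter_le {UA : Matrix (Fin p) (Fin 1) ℂ} (hA : UAᴴ * UA = 1)
    (hB : UBᴴ * UB = 1) (d : Fin p × Fin q → ℂ) :
    sumSq d - sumSq (kronFilter UA UB *ᵥ d) ≤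
      sumSq (contract (UA.col 0) d) + ∑ i, sumSq (UBᴴ *ᵥ fun j => d (i, j)) := by
  have h3 : ∑ i, sumSq (UBᴴ *ᵥ fun l => spatialProj UA d (i, l)) ≤
      ∑ i, sumSq (UBᴴ *ᵥ fun j => d (i, j)) := by
    have h4 : ∀ i k, (UBᴴ *ᵥ fun l => spatialProj UA d (i, l)) k =
        ((1 - UA * UAᴴ) *ᵥ fun i' => (UBᴴ *ᵥ fun j => d (i', j)) k) i :=
      fun i k => mulVec_mulVec_comm _ _ d i k
    have h5 : ∀ k, ∑ i, ‖(UBᴴ *ᵥ fun l => spatialProj UA d (i, l)) k‖ ^ 2 ≤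
        ∑ i, ‖(UBᴴ *ᵥ fun j => d (i, j)) k‖ ^ 2 := by
      intro k
      have h6 := sumSq_sub_projection hA fun i' => (UBᴴ *ᵥ fun j => d (i', j)) k
      have h7 := sumSq_nonneg (UAᴴ *ᵥ fun i' => (UBᴴ *ᵥ fun j => d (i', j)) k)
      simp only [h4]
      rw [sumSq] at h6
      rw [h6, sumSq]
      linarith
    unfold sumSq
    rw [Finset.sum_comm]
    nth_rw 2 [Finset.sum_comm]
    exact Finset.sum_le_sum fun k _ => h5 k
  rw [sumSq_kronFilter hB, sumSq_spatialProj hA]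
  linarith

/-- As hᴴd = 0, only the rank-one part of I - aaᴴ contributes: hᴴ(I - aaᴴ)d = -(hᴴa)(aᴴd). -/
lemma contract_kronFilter {UA : Matrix (Fin p) (Fin 1) ℂ}
    {h : Fin p → ℂ} {d : Fin p × Fin q → ℂ} (hdA : ∀ j, ∑ i, star (h i) * d (i, j) = 0) :
    contract h (kronFilter UA UB *ᵥ d) =
      (-(star h ⬝ᵥ UA.col 0)) • ((1 - UB * UBᴴ) *ᵥ contract (UA.col 0) d) := by
  rw [← Matrix.mulVec_smul]
  ext j
  have h1 : ∀ l, ∑ i, star (h i) * ((1 - UA * UAᴴ) *ᵥ fun k => d (k, l)) i =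
      (-(star h ⬝ᵥ UA.col 0)) * contract (UA.col 0) d l := by
    intro l
    simp only [projection_fin_one_apply, mul_sub, Finset.sum_sub_distrib, hdA, zero_sub,
      ← mul_assoc, ← Finset.sum_mul, neg_mul]
    rfl
  have h2 : (-(star h ⬝ᵥ UA.col 0)) • contract (UA.col 0) d =
      fun l => ∑ i, star (h i) * ((1 - UA * UAᴴ) *ᵥ fun k => d (k, l)) i := by
    ext l; rw [h1]; rfl
  rw [h2]
  simp only [contract, kronFilter_mulVec_apply]
  generalize 1 - UA * UAᴴ = A
  generalize 1 - UB * UBᴴ = B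
  simp only [Matrix.mulVec, dotProduct, Finset.mul_sum]
  rw [Finset.sum_comm]
  refine Finset.sum_congr rfl fun _ _ => Finset.sum_congr rfl fun _ _ =>
    Finset.sum_congr rfl fun _ _ => by ring

/-- The quadratic form of `B`. -/
noncomputable def qform {ι : Type*} [Fintype ι] (B : Matrix ι ι ℂ) (v : ι → ℂ) : ℝ :=
  (star v ⬝ᵥ (B *ᵥ v)).re

lemma qform_nonneg {ι : Type*} [Fintype ι] {B : Matrix ι ι ℂ} (hB : B.PosSemidef) (v : ι → ℂ) :
    0 ≤ qform B v := hB.re_dotProduct_nonneg v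

lemma qform_smul {ι : Type*} [Fintype ι] (B : Matrix ι ι ℂ) (a : ℂ) (v : ι → ℂ) :
    qform B (a • v) = ‖a‖ ^ 2 * qform B v := by
  simp only [qform, Matrix.mulVec_smul, star_smul, smul_dotProduct, dotProduct_smul, smul_eq_mul]
  rw [← mul_assoc, Complex.star_def, Complex.mul_conj', ← Complex.ofReal_pow,
    Complex.re_ofReal_mul]

lemma qform_le {ι : Type*} [Fintype ι] (B : Matrix ι ι ℂ) (v : ι → ℂ) :
    qform B v ≤ √(frobSq B) * sumSq v :=
  (le_abs_self _).trans (norm_re_le_of_bilin (norm_bilin_le B) v)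

lemma abs_qform_add_sub_le {ι : Type*} [Fintype ι] (B : Matrix ι ι ℂ) (v w : ι → ℂ) :
    |qform B (v + w) - qform B v| ≤
      √(frobSq B) * (2 * √(sumSq v) * √(sumSq w) + sumSq w) := by
  have h1 : qform B (v + w) - qform B v =
      (star v ⬝ᵥ (B *ᵥ w)).re + (star w ⬝ᵥ (B *ᵥ v)).re + (star w ⬝ᵥ (B *ᵥ w)).re := by
    simp only [qform, Matrix.mulVec_add, star_add, add_dotProduct, dotProduct_add, Complex.add_re]
    ring
  have h2 := (Complex.abs_re_le_norm _).trans (norm_bilin_le B v w)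
  have h3 := (Complex.abs_re_le_norm _).trans (norm_bilin_le B w v)
  have h4 := norm_re_le_of_bilin (norm_bilin_le B) w
  rw [h1]
  refine (abs_add_le _ _).trans ((add_le_add (abs_add_le _ _) le_rfl).trans ?_)
  linarith

lemma qform_clutter (h : Fin p → ℂ) (B : Matrix (Fin q) (Fin q) ℂ) (w : Fin p × Fin q → ℂ) :
    star w ⬝ᵥ ((vecMulVec h (star h) ⊗ₖ B) *ᵥ w) =
      star (contract h w) ⬝ᵥ (B *ᵥ contract h w) := by
  have e1 : ∀ x, ((vecMulVec h (star h) ⊗ₖ B) *ᵥ w) x = h x.1 * (B *ᵥ contract h w) x.2 := by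
    intro x
    simp only [Matrix.mulVec, dotProduct, contract, Finset.mul_sum, Fintype.sum_prod_type_right,
      kroneckerMap_apply, vecMulVec_apply, Pi.star_apply]
    exact Finset.sum_congr rfl fun _ _ => Finset.sum_congr rfl fun _ _ => by ring
  simp only [dotProduct, e1, Fintype.sum_prod_type_right, contract, Pi.star_apply, star_sum,
    Finset.sum_mul]
  refine Finset.sum_congr rfl fun _ _ => Finset.sum_congr rfl fun _ _ => ?_
  rw [star_mul', star_star]; ring

/-- Here d is an eigenvector of Σ with eigenvalue σ², which fixes the optimal SINR, and for a
projection wᴴd = ‖w‖² with w = Fd. The target amplitude cancels. -/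
lemma sinrLoss_kronFilter {h : Fin p → ℂ} {B : Matrix (Fin q) (Fin q) ℂ} (hB : B.PosSemidef)
    {α : ℂ} (hα : α ≠ 0) {d : Fin p × Fin q → ℂ} (hd : sumSq d = 1)
    (hdA : ∀ j, ∑ i, star (h i) * d (i, j) = 0) {σ t2 : ℝ} (hσ : 0 < σ) (ht2 : 0 ≤ t2)
    {UA : Matrix (Fin p) (Fin 1) ℂ} (hUA : UAᴴ * UA = 1) (hUB : UBᴴ * UB = 1) :
    sinrLoss α (clutterNoiseCov t2 h B σ) d (kronFilter UA UB) =
      sumSq (kronFilter UA UB *ᵥ d) ^ 2 / (sumSq (kronFilter UA UB *ᵥ d) +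
        t2 / σ ^ 2 * (‖star h ⬝ᵥ UA.col 0‖ ^ 2 *
          qform B ((1 - UB * UBᴴ) *ᵥ contract (UA.col 0) d))) := by
  have hform : ∀ w, (star w ⬝ᵥ (clutterNoiseCov t2 h B σ *ᵥ w)).re =
      t2 * qform B (contract h w) + σ ^ 2 * sumSq w := by
    intro w
    simp only [clutterNoiseCov, Matrix.add_mulVec, Matrix.smul_mulVec, Matrix.one_mulVec,
      dotProduct_add, dotProduct_smul, smul_eq_mul, qform_clutter, Complex.add_re,
      ← Complex.ofReal_pow, Complex.re_ofReal_mul, ← sumSq_eq_re]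
    rfl
  have hcd : contract h d = 0 := funext hdA
  have hSd : clutterNoiseCov t2 h B σ *ᵥ d = ((σ ^ 2 : ℝ) : ℂ) • d := by
    have : (vecMulVec h (star h) ⊗ₖ B) *ᵥ d = 0 := by
      ext x
      have e1 : ((vecMulVec h (star h) ⊗ₖ B) *ᵥ d) x = h x.1 * (B *ᵥ contract h d) x.2 := by
        simp only [Matrix.mulVec, dotProduct, contract, Finset.mul_sum,
          Fintype.sum_prod_type_right, kroneckerMap_apply, vecMulVec_apply, Pi.star_apply]
        exact Finset.sum_congr rfl fun _ _ => Finset.sum_congr rfl fun _ _ => by ring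
      rw [e1, hcd]; simp
    simp [clutterNoiseCov, Matrix.add_mulVec, Matrix.smul_mulVec, this]
  have hdet : IsUnit (clutterNoiseCov t2 h B σ).det := by
    rw [← Matrix.isUnit_iff_isUnit_det]
    rw [← Matrix.mulVec_injective_iff_isUnit]
    intro v w hvw
    have h1 : clutterNoiseCov t2 h B σ *ᵥ (v - w) = 0 := by
      rw [Matrix.mulVec_sub]; exact sub_eq_zero.2 hvw
    have h2 := hform (v - w)
    rw [h1, dotProduct_zero, Complex.zero_re] at h2
    have h3 := mul_nonneg ht2 (qform_nonneg hB (contract h (v - w)))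
    have h4 : sumSq (v - w) = 0 := by
      refine le_antisymm ?_ (sumSq_nonneg _)
      by_contra h5
      push Not at h5
      have : 0 < σ ^ 2 * sumSq (v - w) := by positivity
      linarith
    exact sub_eq_zero.1 (sumSq_eq_zero.1 h4)
  have hinv : (clutterNoiseCov t2 h B σ)⁻¹ *ᵥ d = (((σ ^ 2)⁻¹ : ℝ) : ℂ) • d := by
    have h1 : d = clutterNoiseCov t2 h B σ *ᵥ ((((σ ^ 2)⁻¹ : ℝ) : ℂ) • d) := by
      rw [Matrix.mulVec_smul, hSd, smul_smul, ← Complex.ofReal_mul, inv_mul_cancel₀ (by positivity)]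
      simp
    conv_lhs => rw [h1]
    rw [Matrix.mulVec_mulVec, Matrix.nonsing_inv_mul _ hdet, Matrix.one_mulVec]
  have hα' : ‖α‖ ≠ 0 := norm_ne_zero_iff.2 hα
  have hmax : sinr α (clutterNoiseCov t2 h B σ) d ((clutterNoiseCov t2 h B σ)⁻¹ *ᵥ d) =
      ‖α‖ ^ 2 / σ ^ 2 := by
    rw [sinr, hform, hinv]
    have h1 : contract h ((((σ ^ 2)⁻¹ : ℝ) : ℂ) • d) = 0 := by
      ext j
      have : contract h ((((σ ^ 2)⁻¹ : ℝ) : ℂ) • d) j = (((σ ^ 2)⁻¹ : ℝ) : ℂ) * contract h d j := by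
        simp only [contract, Pi.smul_apply, smul_eq_mul, Finset.mul_sum]
        exact Finset.sum_congr rfl fun _ _ => by ring
      rw [this, hcd]; simp
    rw [h1, star_smul, smul_dotProduct, star_dotProduct_self, hd, sumSq_smul, hd]
    simp [qform]
    field_simp
  rw [sinrLoss, hmax, sinr, hform, star_kronFilter_dotProduct hUA hUB, contract_kronFilter hdA,
    qform_smul, norm_neg, Complex.norm_real, Real.norm_of_nonneg (sumSq_nonneg _)]
  field_simp
  rw [add_comm]

end Filter

/-- From g² ≥ g² - b² = (g - b)(g + b). -/
lemma one_sub_div_le {g b : ℝ} (hg0 : 0 ≤ g) (hb : 0 ≤ b) :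
    1 - g ^ 2 / (g + b) ≤ (1 - g) + b := by
  rcases (add_nonneg hg0 hb).eq_or_lt with h | h
  · have : g = 0 := by linarith
    subst this; simp [hb]
  · have : g - b ≤ g ^ 2 / (g + b) := by
      rw [le_div_iff₀ h]; nlinarith [sq_nonneg b]
    linarith

/-- The ratio increases in g, so g = 1 is the worst case; then b/(1 + b) is 1-Lipschitz in b and
L/(1 + L) ≥ L - L². -/
lemma le_one_sub_div {g b L ε : ℝ} (hg0 : 0 ≤ g) (hg1 : g ≤ 1) (hb : 0 ≤ b) (hL : 0 ≤ L)
    (hε : |b - L| ≤ ε) : L - L ^ 2 - ε ≤ 1 - g ^ 2 / (g + b) := by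
  have h1 : g ^ 2 / (g + b) ≤ 1 / (1 + b) := by
    rcases (add_nonneg hg0 hb).eq_or_lt with h | h
    · rw [← h, div_zero]; positivity
    · rw [div_le_div_iff₀ h (by positivity)]; nlinarith [mul_nonneg hg0 hb]
  have h2 : 1 / (1 + b) ≤ 1 - (L - L ^ 2 - ε) := by
    have hε' := (abs_le.1 hε).1
    have hε0 := (abs_nonneg _).trans hε
    rw [div_le_iff₀ (by positivity)]
    nlinarith [mul_nonneg hb (sq_nonneg L), mul_nonneg hb hε0, mul_nonneg hb hL, sq_nonneg (L - 1),
      mul_nonneg hb (sq_nonneg (L - 1)), mul_nonneg hL hε0]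
  linarith

/-! ### The leading term, the clutter scatter bound and scalar estimates. -/

section Deterministic

variable {p q r : ℕ}

/-- The contraction `∑_i d(i, ·) conj(g_i)` of the steering vector with the cross term. -/
noncomputable def steerCross (n : ℕ) (u : ℕ → Fin q → ℂ) (z : ℕ → Fin p × Fin q → ℂ)
    (d : Fin p × Fin q → ℂ) : Fin q → ℂ :=
  fun j => ∑ i, d (i, j) * star (crossVec n u z i)

/-- The leading term of the SINR loss deficit. -/
noncomputable def leadTerm (t2 : ℝ) (B : Matrix (Fin q) (Fin q) ℂ) (d : Fin p × Fin q → ℂ)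
    (n : ℕ) (u : ℕ → Fin q → ℂ) (z : ℕ → Fin p × Fin q → ℂ) : ℝ :=
  t2 * qform B (steerCross n u z d) / energy n u ^ 2

/-- The clutter scatter is at least `a` on the range of `B`. -/
def ScatterBound (B : Matrix (Fin q) (Fin q) ℂ) (a : ℝ) (n : ℕ) (u : ℕ → Fin q → ℂ) : Prop :=
  ∀ v ∈ LinearMap.range B.mulVecLin, a * sumSq v ≤ ∑ m ∈ Finset.range n, ‖star v ⬝ᵥ u m‖ ^ 2

/-- One nonzero vector in the range of `B` suffices, by Cauchy–Schwarz for each sample. -/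
lemma ScatterBound.le_energy {B : Matrix (Fin q) (Fin q) ℂ} (hB0 : B ≠ 0) {a : ℝ} {n : ℕ}
    {u : ℕ → Fin q → ℂ} (hu : ScatterBound B a n u) : a ≤ energy n u := by
  obtain ⟨x, hx⟩ : ∃ x, B *ᵥ x ≠ 0 := by
    by_contra! hx
    exact hB0 (Matrix.ext_of_mulVec_single fun i => by rw [hx, Matrix.zero_mulVec])
  have h1 := hu (B *ᵥ x) ⟨x, rfl⟩
  have h2 : ∑ m ∈ Finset.range n, ‖star (B *ᵥ x) ⬝ᵥ u m‖ ^ 2 ≤ energy n u * sumSq (B *ᵥ x) := by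
    rw [energy, Finset.sum_mul]
    exact Finset.sum_le_sum fun m _ => (norm_star_dotProduct_sq_le _ _).trans
      (le_of_eq (mul_comm _ _))
  exact le_of_mul_le_mul_right (h1.trans h2) (sumSq_pos hx)

lemma sumSq_steerCross_le {d : Fin p × Fin q → ℂ} (hd : sumSq d = 1) (n : ℕ)
    (u : ℕ → Fin q → ℂ) (z : ℕ → Fin p × Fin q → ℂ) :
    sumSq (steerCross n u z d) ≤ sumSq (crossVec n u z) := by
  calc _ ≤ ∑ j, sumSq (fun i => d (i, j)) * sumSq (crossVec n u z) := by
        refine Finset.sum_le_sum fun j _ => ?_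
        have := norm_dotProduct_sq_le (fun i => d (i, j)) (star (crossVec n u z))
        rwa [sumSq_star] at this
    _ = _ := by rw [← Finset.sum_mul, ← sumSq_prod_right, hd, one_mul]

/-- The test vector is the j-th column of d. It is orthogonal to h, so the clutter term and one of
the two cross terms drop out. The other cross term is the first-order leakage; the noise scatter is
second order in σ. -/
lemma contract_eq {h : Fin p → ℂ} {σ : ℝ} {u : ℕ → Fin q → ℂ} {z : ℕ → Fin p × Fin q → ℂ}
    {n : ℕ} {d : Fin p × Fin q → ℂ} (hdA : ∀ j, ∑ i, star (h i) * d (i, j) = 0)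
    {a : Fin p → ℂ} {l : ℝ}
    (hl : ∀ v, (l : ℂ) * (star v ⬝ᵥ a) =
        energy n u * ((star v ⬝ᵥ h) * (star h ⬝ᵥ a)) +
          star v ⬝ᵥ (spatialError h σ u z n *ᵥ a)) (j : Fin q) :
    (l : ℂ) * contract a d j = star (star (fun i => d (i, j)) ⬝ᵥ (spatialError h σ u z n *ᵥ a)) ∧
    (l : ℂ) * contract a d j = σ * star (star h ⬝ᵥ a) * steerCross n u z d j +
      σ ^ 2 * star (star (fun i => d (i, j)) ⬝ᵥ (noiseSpatial n z *ᵥ a)) := by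
  have h0 : star (fun i => d (i, j)) ⬝ᵥ h = 0 := by
    rw [Matrix.star_dotProduct]
    have := hdA j
    simpa [dotProduct] using congrArg star this
  have h1 := hl fun i => d (i, j)
  rw [h0, zero_mul, mul_zero, zero_add] at h1
  have h2 : (l : ℂ) * contract a d j = star ((l : ℂ) * (star (fun i => d (i, j)) ⬝ᵥ a)) := by
    rw [star_mul', Complex.star_def, Complex.conj_ofReal, ← Complex.star_def,
      ← Matrix.star_dotProduct]
    rfl
  refine ⟨by rw [h2, h1], ?_⟩
  rw [h2, h1, spatialError_bilin, h0, zero_mul, zero_add]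
  have h3 : star (star (fun i => d (i, j)) ⬝ᵥ crossVec n u z) = steerCross n u z d j := by
    rw [← Matrix.star_dotProduct]
    simp [steerCross, dotProduct, mul_comm]
  rw [star_add, star_mul', star_mul', star_mul', h3, star_pow]
  simp only [Complex.star_def, Complex.conj_ofReal]
  ring

/-- The bounds on the scalars of the spatial stage. -/
lemma spatial_scalar_bounds {c n H K δ e s T l : ℝ} (hc : 0 < c) (hn : 0 < n) (hH : 0 < H)
    (hδ : K * δ ≤ c * H / 4) (he : e ≤ K * δ * n) (hs : c * n ≤ s)
    (h1 : s * H - e ≤ l) (h2 : |l - s * T| ≤ e) :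
    c * H * n / 2 ≤ l ∧ H / 2 ≤ T ∧ c * H * n / 4 ≤ T * (c * n) - e := by
  have hs0 : 0 < s := lt_of_lt_of_le (by positivity) hs
  have e1 : e ≤ c * H / 4 * n := he.trans (by gcongr)
  have e2 : c * n * H ≤ s * H := by gcongr
  have h3 := (abs_le.1 h2).2
  have hT : H / 2 ≤ T := by
    have : s * (H / 2) ≤ s * T := by nlinarith
    exact le_of_mul_le_mul_left this hs0
  refine ⟨by nlinarith, hT, ?_⟩
  have : H / 2 * (c * n) ≤ T * (c * n) := by gcongr
  nlinarith

/-- The leading term approximates the clutter leakage of the spatial filter. -/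
lemma leakage_approx {c n H K δ σ F e s T l t2 C G X R : ℝ} (hc : 0 < c) (hn : 0 < n)
    (hH : 0 < H) (hK : 0 ≤ K) (hσ : 0 < σ) (hσδ : σ ≤ δ) (he : e ≤ K * δ * n)
    (hs : c * n ≤ s)
    (hT0 : 0 ≤ T) (hTH : T ≤ H) (hl : c * H * n / 2 ≤ l) (h2 : |l - s * T| ≤ e) (ht2 : 0 ≤ t2)
    (hG0 : 0 ≤ G) (hG : G ≤ C * F ^ 2) (hC : 0 ≤ C)
    (hX : |l ^ 2 * X - σ ^ 2 * T * G| ≤ R * (σ ^ 3 * F ^ 2)) (hR : 0 ≤ R) :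
    |t2 / σ ^ 2 * (T * X) - t2 * G / s ^ 2| ≤
      (t2 * H * (4 * R) / (c * H) ^ 2 + t2 * C * (6 * K / (c ^ 3 * H))) * (δ * (F ^ 2 / n ^ 2)) := by
  have hs0 : 0 < s := lt_of_lt_of_le (by positivity) hs
  have hl0 : 0 < l := lt_of_lt_of_le (by positivity) hl
  have hδ0 : 0 ≤ δ := hσ.le.trans hσδ
  -- First X is replaced by σ²TG/l², then (T/l)² by (1/s)², the latter factored as a difference of
  -- squares. Since l is close to sT, the unknown overlap T cancels from the leading term.
  have key : t2 / σ ^ 2 * (T * X) - t2 * G / s ^ 2 =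
      t2 * T / (σ ^ 2 * l ^ 2) * (l ^ 2 * X - σ ^ 2 * T * G) +
        t2 * G * ((T / l - 1 / s) * (T / l + 1 / s)) := by
    field_simp
    ring
  have b1 : |t2 * T / (σ ^ 2 * l ^ 2) * (l ^ 2 * X - σ ^ 2 * T * G)| ≤
      t2 * H * (4 * R) / (c * H) ^ 2 * (δ * (F ^ 2 / n ^ 2)) := by
    rw [abs_mul, abs_of_nonneg (by positivity)]
    calc _ ≤ t2 * H / (σ ^ 2 * (c * H * n / 2) ^ 2) * (R * (σ ^ 2 * δ * F ^ 2)) := by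
          gcongr
          refine hX.trans ?_
          rw [pow_succ σ 2]
          gcongr
      _ = _ := by field_simp; ring
  have b2 : |T / l - 1 / s| ≤ 2 * K * δ / (c ^ 2 * H * n) := by
    have : T / l - 1 / s = -(l - s * T) / (l * s) := by field_simp; ring
    rw [this, abs_div, abs_neg, abs_of_pos (by positivity : 0 < l * s)]
    calc _ ≤ (K * δ * n) / (c * H * n / 2 * (c * n)) := by
          gcongr
          exact h2.trans he
      _ = _ := by field_simp
  have b3 : |T / l + 1 / s| ≤ 3 / (c * n) := by
    rw [abs_of_nonneg (by positivity)]
    calc _ ≤ H / (c * H * n / 2) + 1 / (c * n) := by gcongr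
      _ = _ := by field_simp; norm_num
  have b4 : |t2 * G * ((T / l - 1 / s) * (T / l + 1 / s))| ≤
      t2 * C * (6 * K / (c ^ 3 * H)) * (δ * (F ^ 2 / n ^ 2)) := by
    rw [abs_mul, abs_mul (T / l - 1 / s), abs_of_nonneg (mul_nonneg ht2 hG0)]
    calc _ ≤ t2 * (C * F ^ 2) * ((2 * K * δ / (c ^ 2 * H * n)) * (3 / (c * n))) := by gcongr
      _ = _ := by field_simp; ring
  rw [key, add_mul]
  exact (abs_add_le _ _).trans (add_le_add b1 b4)

end Deterministic

/-! ### Deterministic two-sided bounds for the SINR loss. -/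

section Deterministic

variable {p q r : ℕ}

/-- The tested equation bounds each column; summing over columns reassembles ‖d‖² = 1 and costs no
extra constant. -/
lemma sumSq_contract_le {h : Fin p → ℂ} {σ : ℝ} {u : ℕ → Fin q → ℂ} {z : ℕ → Fin p × Fin q → ℂ}
    (h0 : 0 ≤ σ) (h1 : σ ≤ 1) {n : ℕ} {d : Fin p × Fin q → ℂ} (hd : sumSq d = 1)
    (hdA : ∀ j, ∑ i, star (h i) * d (i, j) = 0) {a : Fin p → ℂ} (ha : sumSq a = 1) {l : ℝ}
    (hl : ∀ v, (l : ℂ) * (star v ⬝ᵥ a) =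
        energy n u * ((star v ⬝ᵥ h) * (star h ⬝ᵥ a)) +
          star v ⬝ᵥ (spatialError h σ u z n *ᵥ a)) :
    l ^ 2 * sumSq (contract a d) ≤ (errConst q h * σ * √(fluct n u z)) ^ 2 := by
  set e := errConst q h * σ * √(fluct n u z)
  calc l ^ 2 * sumSq (contract a d) = ∑ j, ‖(l : ℂ) * contract a d j‖ ^ 2 := by
        simp [sumSq, Finset.mul_sum, mul_pow]
    _ ≤ ∑ j, e ^ 2 * sumSq (fun i => d (i, j)) := by
        refine Finset.sum_le_sum fun j _ => ?_
        rw [(contract_eq hdA hl j).1, norm_star]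
        have h2 := norm_spatialError_le h u z h0 h1 n (fun i => d (i, j)) a
        rw [ha, Real.sqrt_one, mul_one] at h2
        calc _ ≤ (e * √(sumSq fun i => d (i, j))) ^ 2 := by gcongr
          _ = _ := by rw [mul_pow, Real.sq_sqrt (sumSq_nonneg _)]
    _ = e ^ 2 := by rw [← Finset.mul_sum, ← sumSq_prod_right, hd, mul_one]

/-- Split l times the contraction into a part of order σ and one of order σ². The error in the
quadratic form then has order σ³, so it remains small after division by σ². -/
lemma abs_qform_contract_le {h : Fin p → ℂ} {σ : ℝ} {u : ℕ → Fin q → ℂ}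
    {z : ℕ → Fin p × Fin q → ℂ} (B : Matrix (Fin q) (Fin q) ℂ)
    (h0 : 0 ≤ σ) (h1 : σ ≤ 1) {n : ℕ} {d : Fin p × Fin q → ℂ} (hd : sumSq d = 1)
    (hdA : ∀ j, ∑ i, star (h i) * d (i, j) = 0) {a : Fin p → ℂ} (ha : sumSq a = 1) {l : ℝ}
    (hl : ∀ v, (l : ℂ) * (star v ⬝ᵥ a) =
        energy n u * ((star v ⬝ᵥ h) * (star h ⬝ᵥ a)) +
          star v ⬝ᵥ (spatialError h σ u z n *ᵥ a)) :
    |l ^ 2 * qform B (contract a d) -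
        σ ^ 2 * ‖star h ⬝ᵥ a‖ ^ 2 * qform B (steerCross n u z d)| ≤
      √(frobSq B) * q * (2 * √(sumSq h) + 1) * (σ ^ 3 * √(fluct n u z) ^ 2) := by
  set F := √(fluct n u z) with hF
  set H := √(sumSq h)
  set v : Fin q → ℂ := ((σ : ℂ) * star (star h ⬝ᵥ a)) • steerCross n u z d with hv
  set w : Fin q → ℂ :=
    ((σ : ℂ) ^ 2) • fun j => star (star (fun i => d (i, j)) ⬝ᵥ (noiseSpatial n z *ᵥ a)) with hw
  have hsum : (l : ℂ) • contract a d = v + w := by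
    ext j; exact (contract_eq hdA hl j).2
  have e1 : qform B ((l : ℂ) • contract a d) = l ^ 2 * qform B (contract a d) := by
    rw [qform_smul, Complex.norm_real, Real.norm_eq_abs, sq_abs]
  have e2 : qform B v = σ ^ 2 * ‖star h ⬝ᵥ a‖ ^ 2 * qform B (steerCross n u z d) := by
    rw [hv, qform_smul, norm_mul, norm_star, Complex.norm_real, Real.norm_eq_abs, mul_pow, sq_abs]
  have hθ : ‖star h ⬝ᵥ a‖ ≤ H := by
    have := norm_star_dotProduct_le h a
    rwa [ha, Real.sqrt_one, mul_one] at this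
  have bv : √(sumSq v) ≤ σ * H * (√q * F) := by
    rw [hv, sumSq_smul, Real.sqrt_mul (by positivity), Real.sqrt_sq (by positivity), norm_mul,
      norm_star, Complex.norm_real, Real.norm_of_nonneg h0]
    gcongr
    exact (Real.sqrt_le_sqrt (sumSq_steerCross_le hd n u z)).trans (sqrt_sumSq_crossVec_le u z n)
  have bw : √(sumSq w) ≤ σ ^ 2 * (√q * F) := by
    rw [hw, sumSq_smul, Real.sqrt_mul (by positivity), Real.sqrt_sq (by positivity), norm_pow,
      Complex.norm_real, Real.norm_of_nonneg h0]
    gcongr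
    refine (Real.sqrt_le_sqrt ?_).trans (sqrt_frobSq_noiseSpatial_le u z n)
    calc _ ≤ ∑ j, frobSq (noiseSpatial n z) * sumSq (fun i => d (i, j)) := by
          refine Finset.sum_le_sum fun j _ => ?_
          rw [norm_star]
          have := norm_bilin_sq_le (noiseSpatial n z) (fun i => d (i, j)) a
          rwa [ha, mul_one] at this
      _ = _ := by rw [← Finset.mul_sum, ← sumSq_prod_right, hd, mul_one]
  rw [← e1, hsum, ← e2]
  refine (abs_qform_add_sub_le B v w).trans ?_
  have bw' : sumSq w ≤ (σ ^ 2 * (√q * F)) ^ 2 := by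
    rw [← Real.sq_sqrt (sumSq_nonneg w)]; gcongr
  have hq : √(q : ℝ) ^ 2 = q := Real.sq_sqrt (Nat.cast_nonneg q)
  have h4 : σ ^ 4 ≤ σ ^ 3 := by
    rw [pow_succ σ 3]; exact mul_le_of_le_one_right (by positivity) h1
  calc _ ≤ √(frobSq B) * (2 * (σ * H * (√q * F)) * (σ ^ 2 * (√q * F)) +
        (σ ^ 2 * (√q * F)) ^ 2) := by gcongr
    _ = √(frobSq B) * √q ^ 2 * (2 * H * σ ^ 3 + σ ^ 4) * F ^ 2 := by ring
    _ ≤ √(frobSq B) * √q ^ 2 * (2 * H * σ ^ 3 + σ ^ 3) * F ^ 2 := by gcongr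
    _ = _ := by rw [hq]; ring

lemma sumSq_conjTranspose_mulVec_le {U : Matrix (Fin q) (Fin r) ℂ} {v : Fin q → ℂ} {b : ℝ}
    (hb : ∀ k, ‖star v ⬝ᵥ U.col k‖ ≤ b * √(sumSq v)) :
    sumSq (Uᴴ *ᵥ v) ≤ r * b ^ 2 * sumSq v := by
  calc sumSq (Uᴴ *ᵥ v) ≤ ∑ _k : Fin r, b ^ 2 * sumSq v := by
        refine Finset.sum_le_sum fun k _ => ?_
        have h1 : (Uᴴ *ᵥ v) k = star (U.col k) ⬝ᵥ v := rfl
        rw [h1, norm_star_dotProduct_comm]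
        calc _ ≤ (b * √(sumSq v)) ^ 2 := pow_le_pow_left₀ (norm_nonneg _) (hb k) 2
          _ = _ := by rw [mul_pow, Real.sq_sqrt (sumSq_nonneg v)]
    _ = _ := by simp [mul_assoc]

/-- A vector in the kernel contributes nothing on either side of the Hermitian form; only the
removed component U Uᴴ v is seen by `B`. -/
lemma qform_projection_of_mulVec_eq_zero {B : Matrix (Fin q) (Fin q) ℂ} (hB : B.IsHermitian)
    {U : Matrix (Fin q) (Fin r) ℂ} (hU : Uᴴ * U = 1) {v : Fin q → ℂ} (hv : B *ᵥ v = 0) :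
    qform B ((1 - U * Uᴴ) *ᵥ v) ≤ √(frobSq B) * sumSq (Uᴴ *ᵥ v) := by
  have h1 : (1 - U * Uᴴ) *ᵥ v = v - U *ᵥ (Uᴴ *ᵥ v) := by
    rw [Matrix.sub_mulVec, Matrix.one_mulVec, Matrix.mulVec_mulVec]
  have h2 : ∀ w, star v ⬝ᵥ (B *ᵥ w) = 0 := by
    intro w
    rw [Matrix.star_dotProduct, Matrix.star_mulVec, hB.eq, ← Matrix.dotProduct_mulVec, hv,
      dotProduct_zero, star_zero]
  have h3 : qform B ((1 - U * Uᴴ) *ᵥ v) = qform B (U *ᵥ (Uᴴ *ᵥ v)) := by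
    rw [h1, qform, qform, Matrix.mulVec_sub, hv, zero_sub, star_sub, sub_dotProduct,
      dotProduct_neg, dotProduct_neg, h2, neg_zero, zero_sub, neg_neg]
  rw [h3, ← sumSq_mulVec_of_isometry hU (Uᴴ *ᵥ v)]
  exact qform_le B _

/-- On the event where the clutter scatter is large and the fluctuations are small, the SINR loss
deficit is the leading term up to a small multiple of the normalized fluctuations. -/
theorem sinrLoss_bounds {h : Fin p → ℂ} (hh : h ≠ 0) {B : Matrix (Fin q) (Fin q) ℂ}
    (hB : B.PosSemidef) (hB0 : B ≠ 0) {α : ℂ} (hα : α ≠ 0) {d : Fin p × Fin q → ℂ}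
    (hd : sumSq d = 1) (hdA : ∀ j, ∑ i, star (h i) * d (i, j) = 0) (hr : r ≤ B.rank)
    (hdB : r = 0 ∨ ∀ i, B *ᵥ (fun j => d (i, j)) = 0) {t2 c : ℝ} (ht2 : 0 ≤ t2) (hc : 0 < c) :
    ∃ C δ₀ : ℝ, 0 < C ∧ 0 < δ₀ ∧ ∀ n : ℕ, n ≠ 0 → ∀ σ δ : ℝ, 0 < σ → σ ≤ δ → δ ≤ δ₀ →
      ∀ (u : ℕ → Fin q → ℂ) (z : ℕ → Fin p × Fin q → ℂ) (UA : Matrix (Fin p) (Fin 1) ℂ)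
        (UB : Matrix (Fin q) (Fin r) ℂ),
      IsPrincipalComponents
        (spatialAverage (sampleCov n fun m => kronVec h (u m) + (σ : ℂ) • z m)) UA →
      IsPrincipalComponents (temporalAverage (UA * UAᴴ)
        (sampleCov n fun m => kronVec h (u m) + (σ : ℂ) • z m)) UB →
      ScatterBound B (c * n) n u →
      (r = 0 ∨ ∀ i, ∀ m < n, star (fun j => d (i, j)) ⬝ᵥ u m = 0) →
      σ ^ 2 * fluct n u z ≤ δ ^ 2 * n ^ 2 →
      1 - sinrLoss α (clutterNoiseCov t2 h B σ) d (kronFilter UA UB) ≤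
          leadTerm t2 B d n u z + C * (δ * (fluct n u z / n ^ 2)) ∧
      leadTerm t2 B d n u z - leadTerm t2 B d n u z ^ 2 - C * (δ * (fluct n u z / n ^ 2)) ≤
          1 - sinrLoss α (clutterNoiseCov t2 h B σ) d (kronFilter UA UB) := by
  have hq : q ≠ 0 := by
    rintro rfl
    exact hB0 (Matrix.ext fun i => i.elim0)
  have hH := sumSq_pos hh
  set H := sumSq h with hHdef
  set K := errConst q h with hKdef
  have hK : 0 ≤ K := errConst_nonneg h q
  set b := √(frobSq B) with hbdef
  have hb : 0 ≤ b := Real.sqrt_nonneg _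
  set A := K / (c * H) with hA
  have hA0 : 0 ≤ A := by positivity
  set C0 := (4 + 16 * r) * A ^ 2
  set C1 := t2 * H * (4 * (b * q * (2 * √H + 1))) / (c * H) ^ 2 +
    t2 * (b * q) * (6 * K / (c ^ 3 * H))
  set C2 := t2 * H * b * (r * (4 * A) ^ 2) * (4 * A ^ 2)
  have hC0 : 0 ≤ C0 := by positivity
  have hC1 : 0 ≤ C1 := by positivity
  have hC2 : 0 ≤ C2 := by positivity
  -- `C0` accounts for lost target energy, `C1` for leakage without temporal filtering, `C2` for
  -- leakage with it. The second entry of the minimum keeps the perturbation within a quarter of the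
  -- lower bound on the clutter eigenvalue.
  refine ⟨C0 + (C1 + C2) + 1, min 1 (c * H / (4 * (K + 1))), by positivity, by positivity, ?_⟩
  intro n hn σ δ hσ hσδ hδ u z UA UB hUA hUB hscat hdu hfl
  have hδ1 : δ ≤ 1 := hδ.trans (min_le_left _ _)
  have hδ0 : 0 < δ := hσ.trans_le hσδ
  have hσ1 : σ ≤ 1 := hσδ.trans hδ1
  have hKδ : K * δ ≤ c * H / 4 := by
    have := hδ.trans (min_le_right _ _)
    rw [le_div_iff₀ (by positivity)] at this
    have h4 : δ * (4 * (K + 1)) = 4 * (K * δ) + 4 * δ := by ring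
    linarith
  have hn0 : (0 : ℝ) < n := by positivity
  set F := √(fluct n u z) with hF
  have hF2 : F ^ 2 = fluct n u z := Real.sq_sqrt (fluct_nonneg n u z)
  have hσF : σ * F ≤ δ * n := by
    rw [← abs_of_nonneg (by positivity : 0 ≤ σ * F),
      ← abs_of_nonneg (by positivity : 0 ≤ δ * n), ← sq_le_sq, mul_pow, mul_pow, hF2]
    exact hfl
  obtain ⟨l, hl1, hl2, hl3⟩ := spatial_stage h u z hh hσ.le hσ1 hn hq hUA
  have hUA1 := hUA.1
  have hUB1 := hUB.1
  have ha := sumSq_col_eq_one hUA1 0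
  set a := UA.col 0 with hadef
  set e := K * σ * F with hedef
  have he0 : 0 ≤ e := by positivity
  have he : e ≤ K * δ * n := by rw [hedef, mul_assoc, mul_assoc]; gcongr
  have hs : c * n ≤ energy n u := hscat.le_energy hB0
  set T := ‖star h ⬝ᵥ a‖ ^ 2 with hTdef
  have hTH : T ≤ H := by
    have := norm_star_dotProduct_sq_le h a
    rwa [ha, mul_one] at this
  obtain ⟨hl, hT, hTe⟩ := spatial_scalar_bounds hc hn0 hH hKδ he hs hl1 hl2
  have hl0 : 0 < l := lt_of_lt_of_le (by positivity) hl
  set y := contract a d with hydef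
  have hy : sumSq y ≤ 4 * A ^ 2 * (σ ^ 2 * (F ^ 2 / n ^ 2)) := by
    have h1 := sumSq_contract_le hσ.le hσ1 hd hdA ha hl3
    rw [← le_div_iff₀' (by positivity)] at h1
    refine h1.trans ?_
    calc _ ≤ e ^ 2 / (c * H * n / 2) ^ 2 := by gcongr
      _ = _ := by rw [hA, hedef]; field_simp; ring
  have hVfin : r ≤ Module.finrank ℂ (LinearMap.range B.mulVecLin) := hr
  have htemp : ∀ v : Fin q → ℂ, (∀ m < n, star v ⬝ᵥ u m = 0) → ∀ k,
      ‖star v ⬝ᵥ UB.col k‖ ≤ e / (c * H * n / 4) * √(sumSq v) := by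
    intro v hv k
    have h1 := temporal_stage h u z hσ.le hσ1 hn hq ha hUB _ hVfin hscat hv k
    rw [div_mul_eq_mul_div, le_div_iff₀ (by positivity), mul_comm]
    exact le_trans (mul_le_mul_of_nonneg_right hTe (norm_nonneg _)) h1
  have heA : e / (c * H * n / 4) = 4 * A * (σ * F / n) := by
    rw [hA, hedef]; field_simp
  have hUd : ∀ v : Fin q → ℂ, (∀ m < n, star v ⬝ᵥ u m = 0) →
      sumSq (UBᴴ *ᵥ v) ≤ r * (4 * A * (σ * F / n)) ^ 2 * sumSq v := by
    intro v hv
    rw [← heA]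
    exact sumSq_conjTranspose_mulVec_le (htemp v hv)
  set g := sumSq (kronFilter UA UB *ᵥ d) with hgdef
  have hg0 : 0 ≤ g := sumSq_nonneg _
  have hg1 : g ≤ 1 := hd ▸ sumSq_kronFilter_le hUA1 hUB1 d
  have hσδF : σ ^ 2 * (F ^ 2 / n ^ 2) ≤ δ * (F ^ 2 / n ^ 2) := by
    gcongr
    rw [sq]
    exact (mul_le_mul hσδ hσ1 hσ.le hδ0.le).trans_eq (mul_one δ)
  have hg : 1 - g ≤ C0 * (δ * (F ^ 2 / n ^ 2)) := by
    have h1 := sumSq_sub_kronFilter_le hUA1 hUB1 d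
    rw [hd] at h1
    have h2 : ∑ i, sumSq (UBᴴ *ᵥ fun j => d (i, j)) ≤
        r * (4 * A * (σ * F / n)) ^ 2 := by
      rcases hdu with h0 | hdu
      · subst h0; simp [sumSq]
      · calc _ ≤ ∑ i, r * (4 * A * (σ * F / n)) ^ 2 * sumSq (fun j => d (i, j)) :=
              Finset.sum_le_sum fun i _ => hUd _ (hdu i)
          _ = _ := by rw [← Finset.mul_sum, ← sumSq_prod, hd, mul_one]
    calc 1 - g ≤ 4 * A ^ 2 * (σ ^ 2 * (F ^ 2 / n ^ 2)) + r * (4 * A * (σ * F / n)) ^ 2 := by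
          linarith
      _ = C0 * (σ ^ 2 * (F ^ 2 / n ^ 2)) := by simp only [C0]; field_simp; ring
      _ ≤ _ := by gcongr
  set X := qform B ((1 - UB * UBᴴ) *ᵥ y) with hX
  have hX0 : 0 ≤ X := qform_nonneg hB _
  set L := leadTerm t2 B d n u z with hLdef
  have hL0 : 0 ≤ L := by
    have := qform_nonneg hB (steerCross n u z d)
    simp only [hLdef, leadTerm]; positivity
  have hfac : 0 ≤ δ * (F ^ 2 / n ^ 2) := by positivity
  have hbL : |t2 / σ ^ 2 * (T * X) - L| ≤ (C1 + C2) * (δ * (F ^ 2 / n ^ 2)) := by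
    -- For r = 0 the leakage is the leading term plus errors. For r ≥ 1 the rows of d lie in ker B,
    -- hence so does their combination `steerCross`, and the leading term is zero.
    rcases Nat.eq_zero_or_pos r with h0 | hrpos
    · subst h0
      have hXy : X = qform B y := by
        rw [hX, show UB * UBᴴ = 0 by ext i j; simp [Matrix.mul_apply], sub_zero,
          Matrix.one_mulVec]
      have hG : qform B (steerCross n u z d) ≤ b * q * F ^ 2 := by
        refine (qform_le B _).trans ?_
        rw [mul_assoc]
        refine mul_le_mul_of_nonneg_left ?_ hb
        refine (sumSq_steerCross_le hd n u z).trans ((sumSq_crossVec_le n u z).trans ?_)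
        rw [hF2]
        exact mul_le_mul_of_nonneg_left (le_add_of_nonneg_right (frobSq_nonneg _)) (by positivity)
      rw [hXy]
      refine (leakage_approx hc hn0 hH hK hσ hσδ he hs (by positivity) hTH hl hl2 ht2
        (qform_nonneg hB _) hG (by positivity)
        (abs_qform_contract_le B hσ.le hσ1 hd hdA ha hl3) (by positivity)).trans ?_
      exact mul_le_mul_of_nonneg_right (le_add_of_nonneg_right hC2) hfac
    · have hdB' := hdB.resolve_left hrpos.ne'
      have hdu' := hdu.resolve_left hrpos.ne'
      have hLz : L = 0 := by
        have : B *ᵥ steerCross n u z d = 0 := by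
          have h1 : steerCross n u z d = ∑ i, star (crossVec n u z i) • fun j => d (i, j) := by
            ext j; simp [steerCross, mul_comm]
          rw [h1, Matrix.mulVec_sum]
          exact Finset.sum_eq_zero fun i _ => by rw [Matrix.mulVec_smul, hdB', smul_zero]
        simp [hLdef, leadTerm, qform, this]
      have hyeq : y = ∑ i, star (a i) • fun j => d (i, j) := by
        ext j; simp [hydef, contract]
      have hBy : B *ᵥ y = 0 := by
        rw [hyeq, Matrix.mulVec_sum]
        exact Finset.sum_eq_zero fun i _ => by rw [Matrix.mulVec_smul, hdB', smul_zero]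
      have hyu : ∀ m < n, star y ⬝ᵥ u m = 0 := by
        intro m hm
        rw [hyeq, star_sum, sum_dotProduct]
        exact Finset.sum_eq_zero fun i _ => by
          rw [star_smul, smul_dotProduct, hdu' i m hm, smul_zero]
      -- Two small factors multiply: y has squared norm of order σ²F²/n², and the temporal
      -- components catch only a fraction of order δ² of it. The first factor pays for the division
      -- by σ²; the second makes the result negligible.
      have hX1 : X ≤ b * (r * (4 * A * δ) ^ 2 * (4 * A ^ 2 * (σ ^ 2 * (F ^ 2 / n ^ 2)))) := by
        refine (qform_projection_of_mulVec_eq_zero hB.isHermitian hUB1 hBy).trans ?_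
        refine mul_le_mul_of_nonneg_left ((hUd y hyu).trans ?_) hb
        have : σ * F / n ≤ δ := by rwa [div_le_iff₀ hn0]
        have := sumSq_nonneg y
        gcongr
      have hδ2 : δ ^ 2 ≤ δ := pow_le_of_le_one hδ0.le hδ1 two_ne_zero
      rw [hLz, sub_zero, abs_of_nonneg (by positivity)]
      calc t2 / σ ^ 2 * (T * X) ≤ t2 / σ ^ 2 * (H *
            (b * (r * (4 * A * δ) ^ 2 * (4 * A ^ 2 * (σ ^ 2 * (F ^ 2 / n ^ 2)))))) := by gcongr
        _ = C2 * (δ ^ 2 * (F ^ 2 / n ^ 2)) := by simp only [C2]; field_simp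
        _ ≤ C2 * (δ * (F ^ 2 / n ^ 2)) := by gcongr
        _ ≤ _ := mul_le_mul_of_nonneg_right (le_add_of_nonneg_left hC1) hfac
  rw [sinrLoss_kronFilter hB hα hd hdA hσ ht2 hUA1 hUB1, ← hF2]
  have hbn : 0 ≤ t2 / σ ^ 2 * (T * X) := by positivity
  constructor
  · have h1 := one_sub_div_le hg0 hbn
    have h2 := (abs_le.1 hbL).2
    linarith
  · have h1 := le_one_sub_div hg0 hg1 hbn hL0 hbL
    linarith

end Deterministic

/-! ### The coefficient κ, its equality case and its worst case at fixed rank. -/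

section Alignment

variable {p q : ℕ}

lemma star_dotProduct_one_kronecker (B : Matrix (Fin q) (Fin q) ℂ) (d : Fin p × Fin q → ℂ) :
    (star d ⬝ᵥ (((1 : Matrix (Fin p) (Fin p) ℂ) ⊗ₖ B) *ᵥ d)).re =
      ∑ i, qform B fun j => d (i, j) := by
  have e1 : ∀ x, (((1 : Matrix (Fin p) (Fin p) ℂ) ⊗ₖ B) *ᵥ d) x =
      (B *ᵥ fun j => d (x.1, j)) x.2 := by
    intro x
    simp only [Matrix.mulVec, dotProduct, Fintype.sum_prod_type, kroneckerMap_apply,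
      Matrix.one_apply, ite_mul, one_mul, zero_mul]
    rw [Finset.sum_comm]
    simp
  simp only [dotProduct, e1, Fintype.sum_prod_type, Complex.re_sum, qform, Pi.star_apply]

lemma alignment_eq (B : Matrix (Fin q) (Fin q) ℂ) (d : Fin p × Fin q → ℂ) :
    alignment B d = (∑ i, qform B fun j => d (i, j)) / B.trace.re := by
  rw [alignment, star_dotProduct_one_kronecker]

lemma qform_conjTranspose_mul_self {ι κ : Type*} [Fintype ι] [Fintype κ] (A : Matrix ι κ ℂ)
    (v : κ → ℂ) : qform (Aᴴ * A) v = sumSq (A *ᵥ v) := by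
  rw [qform, sumSq_eq_re, Matrix.star_mulVec, ← Matrix.dotProduct_mulVec, Matrix.mulVec_mulVec]

lemma trace_conjTranspose_mul_self {ι κ : Type*} [Fintype ι] [Fintype κ] (A : Matrix ι κ ℂ) :
    (Aᴴ * A).trace = (frobSq A : ℂ) := by
  rw [frobSq, Finset.sum_comm, Complex.ofReal_sum]
  refine Finset.sum_congr rfl fun j _ => ?_
  rw [Complex.ofReal_sum, Matrix.diag_apply, Matrix.mul_apply]
  refine Finset.sum_congr rfl fun i _ => ?_
  rw [conjTranspose_apply, Complex.star_def, Complex.conj_mul']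
  push_cast; rfl

-- Nonnegativity in the C⋆-algebra order supplies the factor. Through it, quadratic forms become
-- squared lengths and the trace becomes a Frobenius norm.
open scoped MatrixOrder Matrix.Norms.L2Operator in
lemma exists_conjTranspose_mul_self {B : Matrix (Fin q) (Fin q) ℂ} (hB : B.PosSemidef) :
    ∃ A : Matrix (Fin q) (Fin q) ℂ, B = Aᴴ * A :=
  CStarAlgebra.nonneg_iff_eq_star_mul_self.mp hB.nonneg

lemma trace_re_pos {B : Matrix (Fin q) (Fin q) ℂ} (hB : B.PosSemidef) (hB0 : B ≠ 0) :
    0 < B.trace.re := by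
  have h1 := hB.trace_nonneg
  have h2 : B.trace ≠ 0 := fun h => hB0 (hB.trace_eq_zero_iff.1 h)
  exact (Complex.pos_iff.1 (lt_of_le_of_ne h1 h2.symm)).1

lemma qform_le_trace {B : Matrix (Fin q) (Fin q) ℂ} (hB : B.PosSemidef) (v : Fin q → ℂ) :
    qform B v ≤ B.trace.re * sumSq v := by
  obtain ⟨A, rfl⟩ := exists_conjTranspose_mul_self hB
  rw [qform_conjTranspose_mul_self, trace_conjTranspose_mul_self, Complex.ofReal_re]
  exact sumSq_mulVec_le A v

lemma alignment_le_one {B : Matrix (Fin q) (Fin q) ℂ} (hB : B.PosSemidef) (hB0 : B ≠ 0)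
    {d : Fin p × Fin q → ℂ} (hd : sumSq d = 1) : alignment B d ≤ 1 := by
  rw [alignment_eq, div_le_one (trace_re_pos hB hB0)]
  calc _ ≤ ∑ i, B.trace.re * sumSq (fun j => d (i, j)) :=
        Finset.sum_le_sum fun i _ => qform_le_trace hB _
    _ = _ := by rw [← Finset.mul_sum, ← sumSq_prod, hd, mul_one]

/-- The residual of projecting w on v has squared norm `sumSq w` - |vᴴw|², which is zero here. -/
lemma eq_smul_of_norm_dotProduct_eq {ι : Type*} [Fintype ι] {v w : ι → ℂ} (hv : sumSq v = 1)
    (h : ‖star v ⬝ᵥ w‖ ^ 2 = sumSq w) : w = (star v ⬝ᵥ w) • v := by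
  set c := star v ⬝ᵥ w with hc
  have h1 : star w ⬝ᵥ v = star c := by rw [hc, ← Matrix.star_dotProduct]
  have h2 : star (w - c • v) ⬝ᵥ (w - c • v) = 0 := by
    have h3 : star c * c = (sumSq w : ℂ) := by
      rw [Complex.star_def, Complex.conj_mul', ← h]; push_cast; rfl
    simp only [star_sub, star_smul, sub_dotProduct, dotProduct_sub, smul_dotProduct,
      dotProduct_smul, star_dotProduct_self, hv, h1, smul_eq_mul, ← hc, ← h3]
    push_cast; ring
  exact sub_eq_zero.1 (dotProduct_star_self_eq_zero.1 h2)

/-- With B = AᴴA the assumption reads ‖Ab‖² = ‖A‖_F². Cauchy–Schwarz holds row by row, so equality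
of the sums forces it in every row, and each row of A is a multiple of bᴴ. -/
lemma eq_rankOne_of_qform_eq {B : Matrix (Fin q) (Fin q) ℂ} (hB : B.PosSemidef) {b : Fin q → ℂ}
    (hb : sumSq b = 1) (h : qform B b = B.trace.re) :
    B = B.trace • vecMulVec b (star b) := by
  obtain ⟨A, rfl⟩ := exists_conjTranspose_mul_self hB
  rw [qform_conjTranspose_mul_self, trace_conjTranspose_mul_self, Complex.ofReal_re] at h
  have h1 : ∀ k, ‖star b ⬝ᵥ star (A k)‖ ^ 2 = sumSq (star (A k)) := by
    have h2 : ∀ k, ‖star b ⬝ᵥ star (A k)‖ = ‖(A *ᵥ b) k‖ := by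
      intro k
      rw [norm_star_dotProduct_comm, star_star]; rfl
    have h3 : ∀ k ∈ Finset.univ, ‖(A *ᵥ b) k‖ ^ 2 ≤ ∑ j, ‖A k j‖ ^ 2 := by
      intro k _
      have := norm_dotProduct_sq_le (A k) b
      rwa [hb, mul_one] at this
    intro k
    rw [h2, sumSq_star]
    exact (Finset.sum_eq_sum_iff_of_le h3).1 h k (Finset.mem_univ k)
  have h4 : ∀ k j, A k j = (A *ᵥ b) k * star (b j) := by
    intro k j
    have h5 := congrArg star (congrFun (eq_smul_of_norm_dotProduct_eq hb (h1 k)) j)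
    rw [Pi.smul_apply, Pi.star_apply, star_star, smul_eq_mul, star_mul',
      ← Matrix.star_dotProduct, star_star] at h5
    exact h5
  rw [trace_conjTranspose_mul_self, ← h]
  ext i j
  rw [Matrix.mul_apply, Matrix.smul_apply, vecMulVec_apply, smul_eq_mul, Pi.star_apply, sumSq,
    Complex.ofReal_sum, Finset.sum_mul]
  refine Finset.sum_congr rfl fun k _ => ?_
  rw [conjTranspose_apply, h4 k i, h4 k j, star_mul', star_star, Complex.ofReal_pow,
    ← Complex.conj_mul', Complex.star_def]
  ring

lemma qform_trace_smul_vecMulVec (t : ℂ) (b v : Fin q → ℂ) :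
    qform (t • vecMulVec b (star b)) v = t.re * ‖star b ⬝ᵥ v‖ ^ 2 := by
  have h1 : star v ⬝ᵥ b = star (star b ⬝ᵥ v) := by rw [← Matrix.star_dotProduct]
  rw [qform, Matrix.smul_mulVec, dotProduct_smul, vecMulVec_bilin, h1, smul_eq_mul,
    Complex.star_def, Complex.conj_mul', ← Complex.ofReal_pow, Complex.re_mul_ofReal]

/-- Equality in the sum forces equality for each row of d. A normalized nonzero row serves as b and
makes B rank one; the equality in the remaining rows then makes them multiples of b. -/
lemma alignment_eq_one_iff {B : Matrix (Fin q) (Fin q) ℂ} (hB : B.PosSemidef) (hB0 : B ≠ 0)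
    {d : Fin p × Fin q → ℂ} (hd : sumSq d = 1) :
    alignment B d = 1 ↔ ∃ (a : Fin p → ℂ) (b : Fin q → ℂ), star b ⬝ᵥ b = 1 ∧
      d = kronVec a b ∧ B = B.trace • vecMulVec b (star b) := by
  have ht := trace_re_pos hB hB0
  constructor
  · intro h
    rw [alignment_eq, div_eq_one_iff_eq ht.ne'] at h
    have hsum : ∑ i, B.trace.re * sumSq (fun j => d (i, j)) = B.trace.re := by
      rw [← Finset.mul_sum, ← sumSq_prod, hd, mul_one]
    have h1 : ∀ i, qform B (fun j => d (i, j)) = B.trace.re * sumSq (fun j => d (i, j)) :=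
      fun i => (Finset.sum_eq_sum_iff_of_le fun i _ => qform_le_trace hB fun j => d (i, j)).1
        (h.trans hsum.symm) i (Finset.mem_univ i)
    obtain ⟨i₀, hi₀⟩ : ∃ i, (fun j => d (i, j)) ≠ 0 := by
      by_contra! h2
      rw [sumSq_prod, Finset.sum_eq_zero fun i _ => sumSq_eq_zero.2 (h2 i)] at hd
      exact zero_ne_one hd
    set v : Fin q → ℂ := fun j => d (i₀, j)
    have hv := sumSq_pos hi₀
    set b : Fin q → ℂ := (((√(sumSq v))⁻¹ : ℝ) : ℂ) • v with hbdef
    have hs2 : ‖(((√(sumSq v))⁻¹ : ℝ) : ℂ)‖ ^ 2 = (sumSq v)⁻¹ := by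
      rw [Complex.norm_real, Real.norm_eq_abs, sq_abs, inv_pow, Real.sq_sqrt hv.le]
    have hb : sumSq b = 1 := by
      rw [hbdef, sumSq_smul, hs2, inv_mul_cancel₀ hv.ne']
    have hqb : qform B b = B.trace.re := by
      rw [hbdef, qform_smul, hs2, h1 i₀, mul_left_comm, inv_mul_cancel₀ hv.ne', mul_one]
    have hBeq := eq_rankOne_of_qform_eq hB hb hqb
    refine ⟨fun i => star b ⬝ᵥ fun j => d (i, j), b, ?_, ?_, hBeq⟩
    · rw [star_dotProduct_self, hb, Complex.ofReal_one]
    · ext x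
      have h2 : ‖star b ⬝ᵥ fun j => d (x.1, j)‖ ^ 2 = sumSq fun j => d (x.1, j) := by
        have h3 := h1 x.1
        rw [hBeq, qform_trace_smul_vecMulVec, ← hBeq] at h3
        exact mul_left_cancel₀ ht.ne' h3
      exact congrFun (eq_smul_of_norm_dotProduct_eq hb h2) x.2
  · rintro ⟨a, b, hb, rfl, hBeq⟩
    have hb1 : sumSq b = 1 := by rw [sumSq_eq_re, hb, Complex.one_re]
    rw [alignment_eq, div_eq_one_iff_eq ht.ne']
    have h1 : ∀ i, qform B (fun j => kronVec a b (i, j)) =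
        B.trace.re * sumSq fun j => kronVec a b (i, j) := by
      intro i
      have h2 : (fun j => kronVec a b (i, j)) = a i • b := rfl
      conv_lhs => rw [hBeq]
      rw [qform_trace_smul_vecMulVec, h2, dotProduct_smul, hb, sumSq_smul, hb1]
      simp
    rw [Finset.sum_congr rfl fun i _ => h1 i, ← Finset.mul_sum, ← sumSq_prod, hd, mul_one]

/-- The worst-case alignment is one for every temporal rank. -/
lemma isLUB_alignment {h : Fin p → ℂ} {d : Fin p × Fin q → ℂ} (hd : sumSq d = 1)
    (hdA : ∀ j, ∑ i, star (h i) * d (i, j) = 0) {s : ℕ} (hs1 : 1 ≤ s) (hsq : s ≤ q) :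
    IsLUB {κ : ℝ | ∃ (B' : Matrix (Fin q) (Fin q) ℂ) (d' : Fin p × Fin q → ℂ),
        B'.PosSemidef ∧ B'.rank = s ∧ star d' ⬝ᵥ d' = 1 ∧
        (∀ j, ∑ i, star (h i) * d' (i, j) = 0) ∧ κ = alignment B' d'} 1 := by
  constructor
  · rintro κ ⟨B', d', hB', hrank, hd', -, rfl⟩
    refine alignment_le_one hB' ?_ (by rw [sumSq_eq_re, hd', Complex.one_re])
    rintro rfl
    rw [Matrix.rank_zero] at hrank
    omega
  · intro x hx
    obtain ⟨j₀, hj₀⟩ : ∃ j, (fun i => d (i, j)) ≠ 0 := by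
      by_contra! h2
      rw [sumSq_prod_right, Finset.sum_eq_zero fun j _ => sumSq_eq_zero.2 (h2 j)] at hd
      exact zero_ne_one hd
    -- A nonzero column of the given d guarantees that a unit spatial vector orthogonal to h exists.
    set v : Fin p → ℂ := fun i => d (i, j₀)
    have hv := sumSq_pos hj₀
    set a : Fin p → ℂ := (((√(sumSq v))⁻¹ : ℝ) : ℂ) • v with hadef
    have ha : sumSq a = 1 := by
      rw [hadef, sumSq_smul, Complex.norm_real, Real.norm_eq_abs, sq_abs, inv_pow,
        Real.sq_sqrt hv.le, inv_mul_cancel₀ hv.ne']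
    have hah : ∑ i, star (h i) * a i = 0 := by
      have : ∑ i, star (h i) * a i = (((√(sumSq v))⁻¹ : ℝ) : ℂ) * ∑ i, star (h i) * d (i, j₀) := by
        rw [Finset.mul_sum]
        exact Finset.sum_congr rfl fun i _ => by simp only [hadef, Pi.smul_apply, smul_eq_mul, v]; ring
      rw [this, hdA, mul_zero]
    let i₀ : Fin q := ⟨0, by omega⟩
    have key : ∀ ε : ℝ, 0 < ε → 1 / (1 + q * ε) ≤ x := by
      intro ε hε
      -- One unit eigenvalue aligned with the target and s - 1 eigenvalues ε: the rank is s, while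
      -- the trace tends to 1 as ε → 0.
      set w : Fin q → ℝ := fun j => if j = i₀ then 1 else if (j : ℕ) < s then ε else 0 with hw
      have hw0 : ∀ j, 0 ≤ w j := by
        intro j; simp only [hw]; split_ifs <;> linarith
      have hpsd : (diagonal fun j => (w j : ℂ)).PosSemidef :=
        Matrix.PosSemidef.diagonal fun j => Complex.zero_le_real.2 (hw0 j)
      have hwne : ∀ j, (w j : ℂ) ≠ 0 ↔ (j : ℕ) < s := by
        intro j
        simp only [hw, ne_eq, Complex.ofReal_eq_zero]
        split_ifs with h1 h2
        · subst h1; simpa [i₀] using (by omega : 0 < s)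
        · simp [h2, hε.ne']
        · simp [h2]
      have hrank : (diagonal fun j => (w j : ℂ)).rank = s := by
        rw [Matrix.rank_diagonal, Fintype.card_congr (Equiv.subtypeEquivRight hwne)]
        rw [Fintype.card_subtype]
        exact Fin.card_filter_val_lt.trans (min_eq_right hsq)
      set d' : Fin p × Fin q → ℂ := kronVec a (Pi.single i₀ 1)
      have hrow : ∀ i, (fun j => d' (i, j)) = a i • (Pi.single i₀ 1 : Fin q → ℂ) := fun i => rfl
      have hs1' : sumSq (Pi.single i₀ 1 : Fin q → ℂ) = 1 := by
        simp [sumSq, Pi.single_apply, apply_ite]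
      have hd' : sumSq d' = 1 := by
        rw [sumSq_prod]
        simp only [hrow, sumSq_smul, hs1', mul_one]
        exact ha
      have hmem := hx ⟨_, d', hpsd, hrank, by rw [star_dotProduct_self, hd', Complex.ofReal_one],
        fun j => by
          simp only [d', kronVec, ← mul_assoc, ← Finset.sum_mul, hah, zero_mul], rfl⟩
      refine le_trans ?_ hmem
      have hform : ∑ i, qform (diagonal fun j => (w j : ℂ)) (fun j => d' (i, j)) = 1 := by
        have h1 : qform (diagonal fun j => (w j : ℂ)) (Pi.single i₀ 1) = 1 := by
          simp [qform, Matrix.mulVec_diagonal, dotProduct, Pi.single_apply, hw]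
        simp only [hrow, qform_smul, h1, mul_one]
        exact ha
      rw [alignment_eq, hform]
      have htr : (diagonal fun j => (w j : ℂ)).trace.re = ∑ j, w j := by
        simp [Matrix.trace, Complex.re_sum]
      rw [htr]
      have hle : ∑ j, w j ≤ 1 + q * ε := by
        calc ∑ j, w j ≤ ∑ j, ((if j = i₀ then 1 else 0) + ε) := by
              refine Finset.sum_le_sum fun j _ => ?_
              simp only [hw]; split_ifs <;> linarith
          _ = _ := by simp [Finset.sum_add_distrib]
      have hpos : 0 < ∑ j, w j := by
        refine lt_of_lt_of_le one_pos ?_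
        calc (1 : ℝ) = w i₀ := by simp [hw]
          _ ≤ _ := Finset.single_le_sum (fun j _ => hw0 j) (Finset.mem_univ i₀)
      exact one_div_le_one_div_of_le hpos hle
    have hlim : Tendsto (fun ε : ℝ => 1 / (1 + q * ε)) (𝓝[>] 0) (𝓝 1) := by
      have : ContinuousAt (fun ε : ℝ => 1 / (1 + q * ε)) 0 :=
        ContinuousAt.div (by fun_prop) (by fun_prop) (by simp)
      have h2 := this.tendsto
      simp only [mul_zero, add_zero, div_one] at h2
      exact h2.mono_left nhdsWithin_le_nhds
    exact le_of_tendsto hlim (eventually_nhdsWithin_of_forall fun ε hε => key ε hε)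

end Alignment

/-! ### Laws and moments of complex Gaussian vectors. -/

section Gaussian

variable {Ω ι : Type*} [MeasurableSpace Ω] [Fintype ι] {μ : Measure Ω} [IsProbabilityMeasure μ]

lemma exists_eq_re_star_dotProduct [DecidableEq ι] (L : StrongDual ℝ (ι → ℂ)) :
    ∃ w : ι → ℂ, ∀ x, L x = (star w ⬝ᵥ x).re := by
  refine ⟨fun i => ⟨L (Pi.single i 1), L (Pi.single i Complex.I)⟩, fun x => ?_⟩
  have hx : x = ∑ i, ((x i).re • (Pi.single i 1 : ι → ℂ) +
      (x i).im • (Pi.single i Complex.I : ι → ℂ)) := by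
    ext j
    simp only [Finset.sum_apply, Pi.add_apply, Pi.smul_apply, Pi.single_apply, Complex.real_smul,
      mul_ite, mul_one, mul_zero]
    simp only [Finset.sum_add_distrib, Finset.sum_ite_eq, Finset.mem_univ, if_true]
    exact (Complex.re_add_im (x j)).symm
  conv_lhs => rw [hx]
  simp only [map_sum, map_add, map_smul, smul_eq_mul, dotProduct, Complex.re_sum, Pi.star_apply,
    Complex.star_def, Complex.mul_re, Complex.conj_re, Complex.conj_im]
  exact Finset.sum_congr rfl fun i _ => by ring

/-- Cramér–Wold: every real-linear functional has the form Re(wᴴx), so the one-dimensional laws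
determine the characteristic function. This makes speckle and noise identically distributed across
samples. -/
lemma IsComplexGaussian.map_eq {X Y : Ω → ι → ℂ} {C : Matrix ι ι ℂ}
    (hXm : Measurable X) (hYm : Measurable Y) (hX : IsComplexGaussian X C μ)
    (hY : IsComplexGaussian Y C μ) : μ.map X = μ.map Y := by
  classical
  have := Measure.isProbabilityMeasure_map hXm.aemeasurable (μ := μ)
  have := Measure.isProbabilityMeasure_map hYm.aemeasurable (μ := μ)
  refine Measure.ext_of_charFunDual (funext fun L => ?_)
  obtain ⟨w, hw⟩ := exists_eq_re_star_dotProduct L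
  rw [charFunDual_eq_charFun_map_one, charFunDual_eq_charFun_map_one,
    Measure.map_map (by fun_prop) hXm, Measure.map_map (by fun_prop) hYm]
  have h1 : ∀ Z : Ω → ι → ℂ, L ∘ Z = fun ω => (star w ⬝ᵥ Z ω).re := fun Z => funext fun ω => hw _
  rw [h1, h1, hX w, hY w]

lemma measurable_re_star_dotProduct (w : ι → ℂ) :
    Measurable fun x : ι → ℂ => (star w ⬝ᵥ x).re := by
  unfold dotProduct
  fun_prop

variable {X : Ω → ι → ℂ} {C : Matrix ι ι ℂ}

lemma IsComplexGaussian.memLp_re (hXm : Measurable X) (hX : IsComplexGaussian X C μ)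
    (w : ι → ℂ) {r : ENNReal} (hr : r ≠ ⊤) : MemLp (fun ω => (star w ⬝ᵥ X ω).re) r μ := by
  have hm : Measurable fun ω => (star w ⬝ᵥ X ω).re := (measurable_re_star_dotProduct w).comp hXm
  have h1 := memLp_id_gaussianReal' (μ := 0)
    (v := Real.toNNReal ((star w ⬝ᵥ (C *ᵥ w)).re / 2)) r hr
  rw [← hX w, memLp_map_measure_iff (by fun_prop) hm.aemeasurable] at h1
  exact h1

lemma IsComplexGaussian.integral_re (hXm : Measurable X) (hX : IsComplexGaussian X C μ)
    (w : ι → ℂ) : ∫ ω, (star w ⬝ᵥ X ω).re ∂μ = 0 := by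
  have hm : Measurable fun ω => (star w ⬝ᵥ X ω).re := (measurable_re_star_dotProduct w).comp hXm
  have h1 := integral_id_gaussianReal (μ := 0)
    (v := Real.toNNReal ((star w ⬝ᵥ (C *ᵥ w)).re / 2))
  rw [← hX w, integral_map hm.aemeasurable (by fun_prop)] at h1
  exact h1

lemma IsComplexGaussian.integral_re_sq (hXm : Measurable X) (hX : IsComplexGaussian X C μ)
    (hC : C.PosSemidef) (w : ι → ℂ) :
    ∫ ω, (star w ⬝ᵥ X ω).re ^ 2 ∂μ = qform C w / 2 := by
  have hm : Measurable fun ω => (star w ⬝ᵥ X ω).re := (measurable_re_star_dotProduct w).comp hXm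
  have h1 := variance_id_gaussianReal (μ := 0)
    (v := Real.toNNReal ((star w ⬝ᵥ (C *ᵥ w)).re / 2))
  rw [variance_eq_sub (memLp_id_gaussianReal 2), Real.coe_toNNReal _
    (by have := qform_nonneg hC w; unfold qform at this; positivity)] at h1
  simp only [id, Pi.pow_apply, integral_id_gaussianReal] at h1
  rw [← hX w, integral_map hm.aemeasurable (by fun_prop)] at h1
  simpa [qform] using h1

lemma IsComplexGaussian.memLp_re_apply [DecidableEq ι] (hXm : Measurable X)
    (hX : IsComplexGaussian X C μ) (i : ι) {r : ENNReal} (hr : r ≠ ⊤) :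
    MemLp (fun ω => (X ω i).re) r μ := by
  simpa [dotProduct, Pi.single_apply, apply_ite] using hX.memLp_re hXm (Pi.single i 1) hr

lemma IsComplexGaussian.memLp_im_apply [DecidableEq ι] (hXm : Measurable X)
    (hX : IsComplexGaussian X C μ) (i : ι) {r : ENNReal} (hr : r ≠ ⊤) :
    MemLp (fun ω => (X ω i).im) r μ := by
  simpa [dotProduct, Pi.single_apply, apply_ite] using hX.memLp_re hXm (Pi.single i Complex.I) hr

lemma IsComplexGaussian.integral_re_apply [DecidableEq ι] (hXm : Measurable X)
    (hX : IsComplexGaussian X C μ) (i : ι) : ∫ ω, (X ω i).re ∂μ = 0 := by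
  simpa [dotProduct, Pi.single_apply, apply_ite] using hX.integral_re hXm (Pi.single i 1)

lemma IsComplexGaussian.integral_im_apply [DecidableEq ι] (hXm : Measurable X)
    (hX : IsComplexGaussian X C μ) (i : ι) : ∫ ω, (X ω i).im ∂μ = 0 := by
  simpa [dotProduct, Pi.single_apply, apply_ite] using hX.integral_re hXm (Pi.single i Complex.I)

lemma qform_one [DecidableEq ι] (w : ι → ℂ) : qform (1 : Matrix ι ι ℂ) w = sumSq w := by
  rw [qform, Matrix.one_mulVec, sumSq_eq_re]

/-- Polarization of the variance formula. -/
lemma IsComplexGaussian.integral_re_mul_re [DecidableEq ι] (hXm : Measurable X)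
    (hX : IsComplexGaussian X 1 μ) (v w : ι → ℂ) :
    ∫ ω, (star v ⬝ᵥ X ω).re * (star w ⬝ᵥ X ω).re ∂μ = (star v ⬝ᵥ w).re / 2 := by
  have h1 : ∀ ω, (star v ⬝ᵥ X ω).re * (star w ⬝ᵥ X ω).re =
      ((star (v + w) ⬝ᵥ X ω).re ^ 2 - (star (v - w) ⬝ᵥ X ω).re ^ 2) / 4 := by
    intro ω
    simp only [star_add, star_sub, add_dotProduct, sub_dotProduct, Complex.add_re, Complex.sub_re]
    ring
  simp only [h1]
  rw [integral_div, integral_sub (hX.memLp_re hXm _ (by simp)).integrable_sq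
    (hX.memLp_re hXm _ (by simp)).integrable_sq,
    hX.integral_re_sq hXm Matrix.PosSemidef.one, hX.integral_re_sq hXm Matrix.PosSemidef.one,
    qform_one, qform_one, sumSq_eq_re, sumSq_eq_re]
  have h2 : (star w ⬝ᵥ v).re = (star v ⬝ᵥ w).re := by
    rw [Matrix.star_dotProduct, Complex.star_def, Complex.conj_re]
  simp only [star_add, star_sub, add_dotProduct, sub_dotProduct, dotProduct_add, dotProduct_sub,
    Complex.add_re, Complex.sub_re, h2]
  ring

lemma IsComplexGaussian.integral_mul_apply [DecidableEq ι] (hXm : Measurable X)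
    (hX : IsComplexGaussian X 1 μ) (i j : ι) :
    ∫ ω, (X ω i * star (X ω j)).re ∂μ = (if i = j then 1 else 0) ∧
    ∫ ω, (X ω i * star (X ω j)).im ∂μ = 0 := by
  have e1 : ∀ (k : ι) ω, (X ω k).re = (star (Pi.single k 1 : ι → ℂ) ⬝ᵥ X ω).re := by
    intro k ω; simp [dotProduct, Pi.single_apply, apply_ite]
  have e2 : ∀ (k : ι) ω, (X ω k).im = (star (Pi.single k Complex.I : ι → ℂ) ⬝ᵥ X ω).re := by
    intro k ω; simp [dotProduct, Pi.single_apply, apply_ite]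
  have hint : ∀ v w : ι → ℂ, Integrable
      (fun ω => (star v ⬝ᵥ X ω).re * (star w ⬝ᵥ X ω).re) μ := fun v w =>
    (hX.memLp_re hXm v (r := 2) (by simp)).integrable_mul (hX.memLp_re hXm w (r := 2) (by simp))
  constructor
  · have h1 : ∀ ω, (X ω i * star (X ω j)).re =
        (X ω i).re * (X ω j).re + (X ω i).im * (X ω j).im := by
      intro ω; simp
    simp only [h1, e1, e2]
    rw [integral_add (hint _ _) (hint _ _), hX.integral_re_mul_re hXm,
      hX.integral_re_mul_re hXm]
    by_cases hij : i = j
    · subst hij; simp [dotProduct, Pi.single_apply, apply_ite]; norm_num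
    · simp [dotProduct, Pi.single_apply, hij, Ne.symm hij]
  · have h1 : ∀ ω, (X ω i * star (X ω j)).im =
        (X ω i).im * (X ω j).re - (X ω i).re * (X ω j).im := by
      intro ω; simp; ring
    simp only [h1, e1, e2]
    rw [integral_sub (hint _ _) (hint _ _), hX.integral_re_mul_re hXm,
      hX.integral_re_mul_re hXm]
    by_cases hij : i = j
    · subst hij; simp [dotProduct, Pi.single_apply, apply_ite]
    · simp [dotProduct, Pi.single_apply, Ne.symm hij]

end Gaussian

/-! ### Second moments of products and sums of independent variables. -/

section Independence

variable {Ω : Type*} [MeasurableSpace Ω] {μ : Measure Ω} [IsProbabilityMeasure μ]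

/-- Independence replaces Hölder's inequality, which would require higher moments; the texture has
only two. -/
lemma memLp_two_mul_of_indepFun {f g : Ω → ℝ} (hf : MemLp f 2 μ) (hg : MemLp g 2 μ)
    (hfg : IndepFun f g μ) : MemLp (fun ω => f ω * g ω) 2 μ := by
  have h1 : MemLp (f * g) 2 μ := by
    rw [memLp_two_iff_integrable_sq (hf.1.mul hg.1)]
    have h2 : IndepFun (fun ω => f ω ^ 2) (fun ω => g ω ^ 2) μ :=
      hfg.comp (φ := fun x => x ^ 2) (ψ := fun x => x ^ 2) (by fun_prop) (by fun_prop)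
    refine (h2.integrable_mul hf.integrable_sq hg.integrable_sq).congr
      (Eventually.of_forall fun ω => ?_)
    simp [mul_pow]
  exact h1

lemma integral_sq_sum_eq {X : ℕ → Ω → ℝ} (hind : iIndepFun X μ)
    (hid : ∀ m, IdentDistrib (X m) (X 0) μ μ) (hL2 : MemLp (X 0) 2 μ)
    (h0 : ∫ ω, X 0 ω ∂μ = 0) (n : ℕ) :
    Integrable (fun ω => (∑ m ∈ Finset.range n, X m ω) ^ 2) μ ∧
    ∫ ω, (∑ m ∈ Finset.range n, X m ω) ^ 2 ∂μ = n * ∫ ω, X 0 ω ^ 2 ∂μ := by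
  have hL : ∀ m, MemLp (X m) 2 μ := fun m => (hid m).memLp_iff.2 hL2
  have hsum : MemLp (∑ m ∈ Finset.range n, X m) 2 μ := memLp_finsetSum' _ fun m _ => hL m
  have hmean : ∫ ω, (∑ m ∈ Finset.range n, X m) ω ∂μ = 0 := by
    simp only [Finset.sum_apply]
    rw [integral_finsetSum _ fun m _ => (hL m).integrable (by norm_num)]
    exact Finset.sum_eq_zero fun m _ => by rw [(hid m).integral_eq, h0]
  have hvar := IndepFun.variance_sum (s := Finset.range n) (fun m _ => hL m)
    fun i _ j _ hij => hind.indepFun hij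
  rw [variance_of_integral_eq_zero hsum.1.aemeasurable hmean] at hvar
  have e1 : ∀ ω, (∑ m ∈ Finset.range n, X m) ω = ∑ m ∈ Finset.range n, X m ω := fun ω =>
    Finset.sum_apply _ _ _
  refine ⟨by simpa only [e1] using hsum.integrable_sq, ?_⟩
  simp only [e1] at hvar
  rw [hvar, Finset.sum_congr rfl fun m _ => (hid m).variance_eq,
    variance_of_integral_eq_zero hL2.1.aemeasurable h0]
  simp

end Independence

/-! ### Common law and independence of the sample triples. -/

section Model

variable {Ω : Type*} [MeasurableSpace Ω] {p q : ℕ} {μ : Measure Ω} [IsProbabilityMeasure μ]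
  {B : Matrix (Fin q) (Fin q) ℂ} {τ : ℕ → Ω → ℝ} {c : ℕ → Ω → Fin q → ℂ}
  {z : ℕ → Ω → Fin p × Fin q → ℂ}

/-- The law of one triple, as a product. -/
lemma IsSIRVTraining.map_triple (H : IsSIRVTraining μ B τ c z) (m : ℕ) :
    μ.map (fun ω => ((τ m ω, c m ω), z m ω)) =
      ((μ.map (τ 0)).prod (μ.map (c 0))).prod (μ.map (z 0)) := by
  have h1 := (indepFun_iff_map_prod_eq_prod_map_map
    ((H.measurable_texture m).prodMk (H.measurable_speckle m)).aemeasurable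
    (H.measurable_noise m).aemeasurable).1 (H.indep_clutter_noise m)
  have h2 := (indepFun_iff_map_prod_eq_prod_map_map
    (H.measurable_texture m).aemeasurable
    (H.measurable_speckle m).aemeasurable).1 (H.indep_texture_speckle m)
  rw [h1, h2, (H.texture_identDistrib m).map_eq,
    IsComplexGaussian.map_eq (H.measurable_speckle m) (H.measurable_speckle 0)
      (H.speckle_gaussian m) (H.speckle_gaussian 0),
    IsComplexGaussian.map_eq (H.measurable_noise m) (H.measurable_noise 0)
      (H.noise_gaussian m) (H.noise_gaussian 0)]

lemma IsSIRVTraining.measurable_triple (H : IsSIRVTraining μ B τ c z) (m : ℕ) :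
    Measurable fun ω => ((τ m ω, c m ω), z m ω) :=
  ((H.measurable_texture m).prodMk (H.measurable_speckle m)).prodMk (H.measurable_noise m)

lemma IsSIRVTraining.identDistrib (H : IsSIRVTraining μ B τ c z) (m : ℕ) :
    IdentDistrib (fun ω => ((τ m ω, c m ω), z m ω)) (fun ω => ((τ 0 ω, c 0 ω), z 0 ω)) μ μ :=
  ⟨(H.measurable_triple m).aemeasurable, (H.measurable_triple 0).aemeasurable, by
    rw [H.map_triple m, H.map_triple 0]⟩

lemma IsSIRVTraining.iIndepFun_triple (H : IsSIRVTraining μ B τ c z) :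
    iIndepFun (fun m ω => ((τ m ω, c m ω), z m ω)) μ :=
  H.indep_samples.comp (fun _ (x : ℝ × (Fin q → ℂ) × (Fin p × Fin q → ℂ)) =>
    ((x.1, x.2.1), x.2.2)) fun _ => by fun_prop

/-- A sum of centred square-integrable functions of the triples. -/
lemma IsSIRVTraining.integral_sq_sum (H : IsSIRVTraining μ B τ c z)
    {φ : (ℝ × (Fin q → ℂ)) × (Fin p × Fin q → ℂ) → ℝ} (hφ : Measurable φ)
    (hL2 : MemLp (fun ω => φ ((τ 0 ω, c 0 ω), z 0 ω)) 2 μ)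
    (h0 : ∫ ω, φ ((τ 0 ω, c 0 ω), z 0 ω) ∂μ = 0) (n : ℕ) :
    Integrable (fun ω => (∑ m ∈ Finset.range n, φ ((τ m ω, c m ω), z m ω)) ^ 2) μ ∧
    ∫ ω, (∑ m ∈ Finset.range n, φ ((τ m ω, c m ω), z m ω)) ^ 2 ∂μ =
      n * ∫ ω, φ ((τ 0 ω, c 0 ω), z 0 ω) ^ 2 ∂μ :=
  integral_sq_sum_eq (X := fun m ω => φ ((τ m ω, c m ω), z m ω))
    (H.iIndepFun_triple.comp (fun _ => φ) fun _ => hφ)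
    (fun m => (H.identDistrib m).comp hφ) hL2 h0 n

end Model

/-! ### Linear growth in n of the mean squared fluctuations. -/

section Moments

variable {Ω : Type*} [MeasurableSpace Ω] {p q : ℕ} {μ : Measure Ω} [IsProbabilityMeasure μ]
  {B : Matrix (Fin q) (Fin q) ℂ} {τ : ℕ → Ω → ℝ} {c : ℕ → Ω → Fin q → ℂ}
  {z : ℕ → Ω → Fin p × Fin q → ℂ}

lemma IsSIRVTraining.integral_norm_sq_sum (H : IsSIRVTraining μ B τ c z)
    {ψ : (ℝ × (Fin q → ℂ)) × (Fin p × Fin q → ℂ) → ℂ} (hψ : Measurable ψ)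
    (hre : MemLp (fun ω => (ψ ((τ 0 ω, c 0 ω), z 0 ω)).re) 2 μ)
    (him : MemLp (fun ω => (ψ ((τ 0 ω, c 0 ω), z 0 ω)).im) 2 μ)
    (hre0 : ∫ ω, (ψ ((τ 0 ω, c 0 ω), z 0 ω)).re ∂μ = 0)
    (him0 : ∫ ω, (ψ ((τ 0 ω, c 0 ω), z 0 ω)).im ∂μ = 0) :
    ∃ C : ℝ, ∀ n : ℕ,
      Integrable (fun ω => ‖∑ m ∈ Finset.range n, ψ ((τ m ω, c m ω), z m ω)‖ ^ 2) μ ∧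
      ∫ ω, ‖∑ m ∈ Finset.range n, ψ ((τ m ω, c m ω), z m ω)‖ ^ 2 ∂μ = n * C := by
  refine ⟨∫ ω, (ψ ((τ 0 ω, c 0 ω), z 0 ω)).re ^ 2 ∂μ +
    ∫ ω, (ψ ((τ 0 ω, c 0 ω), z 0 ω)).im ^ 2 ∂μ, fun n => ?_⟩
  have h1 := H.integral_sq_sum (φ := fun x => (ψ x).re) (by fun_prop) hre hre0 n
  have h2 := H.integral_sq_sum (φ := fun x => (ψ x).im) (by fun_prop) him him0 n
  have e : ∀ ω, ‖∑ m ∈ Finset.range n, ψ ((τ m ω, c m ω), z m ω)‖ ^ 2 =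
      (∑ m ∈ Finset.range n, (ψ ((τ m ω, c m ω), z m ω)).re) ^ 2 +
      (∑ m ∈ Finset.range n, (ψ ((τ m ω, c m ω), z m ω)).im) ^ 2 := by
    intro ω
    rw [Complex.sq_norm, Complex.normSq_apply, Complex.re_sum, Complex.im_sum]
    ring
  simp only [e]
  exact ⟨h1.1.add h2.1, by rw [integral_add h1.1 h2.1, h1.2, h2.2, mul_add]⟩

lemma IsSIRVTraining.memLp_texture_mul (H : IsSIRVTraining μ B τ c z) {f : (Fin q → ℂ) → ℝ}
    (hf : Measurable f) (hL : MemLp (fun ω => f (c 0 ω)) 2 μ) :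
    MemLp (fun ω => τ 0 ω * f (c 0 ω)) 2 μ :=
  memLp_two_mul_of_indepFun H.texture_memLp hL
    ((H.indep_texture_speckle 0).comp measurable_id hf)

/-- Each real product of texture, speckle coordinate and noise coordinate is centred because the
noise is centred and independent of the other two. Square integrability also follows from
independence. -/
lemma IsSIRVTraining.crossSum_moment (H : IsSIRVTraining μ B τ c z) (k : Fin q)
    (x : Fin p × Fin q) :
    ∃ C : ℝ, ∀ n : ℕ,
      Integrable (fun ω => ‖crossSum n (fun m => (τ m ω : ℂ) • c m ω) (fun m => z m ω) k x‖ ^ 2) μ ∧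
      ∫ ω, ‖crossSum n (fun m => (τ m ω : ℂ) • c m ω) (fun m => z m ω) k x‖ ^ 2 ∂μ = n * C := by
  have hz := H.noise_gaussian 0
  have hzm := H.measurable_noise 0
  have hc := H.speckle_gaussian 0
  have hcm := H.measurable_speckle 0
  have hu : ∀ f : ℂ → ℝ, Measurable f → MemLp (fun ω => f (c 0 ω k)) 2 μ →
      ∀ g : ℂ → ℝ, Measurable g → MemLp (fun ω => g (z 0 ω x)) 2 μ →
      ∫ ω, g (z 0 ω x) ∂μ = 0 →
      MemLp (fun ω => τ 0 ω * f (c 0 ω k) * g (z 0 ω x)) 2 μ ∧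
      ∫ ω, τ 0 ω * f (c 0 ω k) * g (z 0 ω x) ∂μ = 0 := by
    intro f hf hfL g hg hgL hg0
    have h1 := H.memLp_texture_mul (f := fun y => f (y k)) (by fun_prop) hfL
    have h2 : IndepFun (fun ω => τ 0 ω * f (c 0 ω k)) (fun ω => g (z 0 ω x)) μ :=
      (H.indep_clutter_noise 0).comp (φ := fun y : ℝ × (Fin q → ℂ) => y.1 * f (y.2 k))
        (ψ := fun y : Fin p × Fin q → ℂ => g (y x))
        (by fun_prop) (by fun_prop)
    refine ⟨memLp_two_mul_of_indepFun h1 hgL h2, ?_⟩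
    rw [h2.integral_fun_mul_eq_mul_integral h1.1 hgL.1, hg0, mul_zero]
  have hre := Complex.measurable_re
  have him := Complex.measurable_im
  have c1 := hc.memLp_re_apply hcm k (r := 2) (by simp)
  have c2 := hc.memLp_im_apply hcm k (r := 2) (by simp)
  have z1 := hz.memLp_re_apply hzm x (r := 2) (by simp)
  have z2 := hz.memLp_im_apply hzm x (r := 2) (by simp)
  have a11 := hu _ hre c1 _ hre z1 (hz.integral_re_apply hzm x)
  have a12 := hu _ hre c1 _ him z2 (hz.integral_im_apply hzm x)
  have a21 := hu _ him c2 _ hre z1 (hz.integral_re_apply hzm x)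
  have a22 := hu _ him c2 _ him z2 (hz.integral_im_apply hzm x)
  have e1 : ∀ ω, ((τ 0 ω : ℂ) * c 0 ω k * star (z 0 ω x)).re =
      τ 0 ω * (c 0 ω k).re * (z 0 ω x).re + τ 0 ω * (c 0 ω k).im * (z 0 ω x).im := by
    intro ω; simp
  have e2 : ∀ ω, ((τ 0 ω : ℂ) * c 0 ω k * star (z 0 ω x)).im =
      τ 0 ω * (c 0 ω k).im * (z 0 ω x).re - τ 0 ω * (c 0 ω k).re * (z 0 ω x).im := by
    intro ω; simp; ring
  have hL1 : (1 : ENNReal) ≤ 2 := by norm_num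
  have key := H.integral_norm_sq_sum
    (ψ := fun y => (y.1.1 : ℂ) * y.1.2 k * star (y.2 x)) (by fun_prop)
    (by simp only [e1]; exact a11.1.add a22.1)
    (by simp only [e2]; exact a21.1.sub a12.1)
    (by simp only [e1]
        rw [integral_add (a11.1.integrable hL1) (a22.1.integrable hL1), a11.2, a22.2, add_zero])
    (by simp only [e2]
        rw [integral_sub (a21.1.integrable hL1) (a12.1.integrable hL1), a21.2, a12.2, sub_zero])
  simpa only [crossSum_apply, Pi.smul_apply, smul_eq_mul] using key

lemma IsSIRVTraining.noiseDev_moment (H : IsSIRVTraining μ B τ c z) (x y : Fin p × Fin q) :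
    ∃ C : ℝ, ∀ n : ℕ,
      Integrable (fun ω => ‖noiseDev n (fun m => z m ω) x y‖ ^ 2) μ ∧
      ∫ ω, ‖noiseDev n (fun m => z m ω) x y‖ ^ 2 ∂μ = n * C := by
  have hz := H.noise_gaussian 0
  have hzm := H.measurable_noise 0
  have z1 := fun x => hz.memLp_re_apply hzm x (r := 4) (by simp)
  have z2 := fun x => hz.memLp_im_apply hzm x (r := 4) (by simp)
  have hmul : ∀ f g : Ω → ℝ, MemLp f 4 μ → MemLp g 4 μ → MemLp (fun ω => f ω * g ω) 2 μ := by
    intro f g hf hg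
    -- Entries of z zᴴ are products of dependent coordinates, so independence is not available and
    -- fourth moments enter; for Gaussians they are finite.
    have : ENNReal.HolderTriple 4 4 2 := ⟨by
      rw [← two_mul, show (4 : ENNReal) = 2 * 2 by norm_num,
        ENNReal.mul_inv (by simp) (by simp), ← mul_assoc, ENNReal.mul_inv_cancel (by simp) (by simp),
        one_mul]⟩
    exact hg.mul hf
  set δ : ℂ := if x = y then 1 else 0 with hδ
  have e1 : ∀ ω, (z 0 ω x * star (z 0 ω y) - δ).re =
      (z 0 ω x).re * (z 0 ω y).re + (z 0 ω x).im * (z 0 ω y).im - δ.re := by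
    intro ω; simp
  have e2 : ∀ ω, (z 0 ω x * star (z 0 ω y) - δ).im =
      (z 0 ω x).im * (z 0 ω y).re - (z 0 ω x).re * (z 0 ω y).im - δ.im := by
    intro ω; simp; ring
  have m1 := ((hmul _ _ (z1 x) (z1 y)).add (hmul _ _ (z2 x) (z2 y))).sub (memLp_const δ.re)
  have m2 := ((hmul _ _ (z2 x) (z1 y)).sub (hmul _ _ (z1 x) (z2 y))).sub (memLp_const δ.im)
  have m1' : MemLp (fun ω => (z 0 ω x * star (z 0 ω y) - δ).re) 2 μ := by
    simp only [e1]; exact m1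
  have m2' : MemLp (fun ω => (z 0 ω x * star (z 0 ω y) - δ).im) 2 μ := by
    simp only [e2]; exact m2
  have hL1 : (1 : ENNReal) ≤ 2 := by norm_num
  have hcov := hz.integral_mul_apply hzm x y
  have i1 : Integrable (fun ω => (z 0 ω x * star (z 0 ω y)).re) μ := by
    refine ((m1'.integrable hL1).add (integrable_const δ.re)).congr
      (Eventually.of_forall fun ω => ?_)
    simp
  have i2 : Integrable (fun ω => (z 0 ω x * star (z 0 ω y)).im) μ := by
    refine ((m2'.integrable hL1).add (integrable_const δ.im)).congr
      (Eventually.of_forall fun ω => ?_)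
    simp
  have key := H.integral_norm_sq_sum
    (ψ := fun w => w.2 x * star (w.2 y) - δ) (by fun_prop) m1' m2'
    (by
      simp only [Complex.sub_re]
      rw [integral_sub i1 (integrable_const _), hcov.1]
      by_cases hxy : x = y <;> simp [hδ, hxy])
    (by
      simp only [Complex.sub_im]
      rw [integral_sub i2 (integrable_const _), hcov.2]
      by_cases hxy : x = y <;> simp [hδ, hxy])
  simpa only [noiseDev_apply] using key

lemma IsSIRVTraining.fluct_moment (H : IsSIRVTraining μ B τ c z) :
    ∃ C : ℝ, ∀ n : ℕ,
      Integrable (fun ω => fluct n (fun m => (τ m ω : ℂ) • c m ω) (fun m => z m ω)) μ ∧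
      ∫ ω, fluct n (fun m => (τ m ω : ℂ) • c m ω) (fun m => z m ω) ∂μ = n * C := by
  choose C1 hC1 using H.crossSum_moment
  choose C2 hC2 using H.noiseDev_moment
  refine ⟨(∑ k, ∑ x, C1 k x) + ∑ x, ∑ y, C2 x y, fun n => ?_⟩
  have i1 : ∀ k, Integrable (fun ω => ∑ x, ‖crossSum n (fun m => (τ m ω : ℂ) • c m ω)
      (fun m => z m ω) k x‖ ^ 2) μ := fun k => integrable_finsetSum _ fun x _ => (hC1 k x n).1
  have i2 : ∀ x, Integrable (fun ω => ∑ y, ‖noiseDev n (fun m => z m ω) x y‖ ^ 2) μ :=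
    fun x => integrable_finsetSum _ fun y _ => (hC2 x y n).1
  have j1 := integrable_finsetSum Finset.univ fun k _ => i1 k
  have j2 := integrable_finsetSum Finset.univ fun x _ => i2 x
  refine ⟨j1.add j2, ?_⟩
  unfold fluct frobSq
  rw [integral_add j1 j2, integral_finsetSum _ fun k _ => i1 k,
    integral_finsetSum _ fun x _ => i2 x, mul_add, Finset.mul_sum, Finset.mul_sum]
  congr 1
  · refine Finset.sum_congr rfl fun k _ => ?_
    rw [integral_finsetSum _ fun x _ => (hC1 k x n).1, Finset.mul_sum]
    exact Finset.sum_congr rfl fun x _ => (hC1 k x n).2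
  · refine Finset.sum_congr rfl fun x _ => ?_
    rw [integral_finsetSum _ fun y _ => (hC2 x y n).1, Finset.mul_sum]
    exact Finset.sum_congr rfl fun y _ => (hC2 x y n).2

end Moments

/-! ### Two-sided Hoeffding inequality for bounded samples. -/

section Hoeffding

variable {Ω : Type*} [MeasurableSpace Ω] {μ : Measure Ω} [IsProbabilityMeasure μ]

lemma measure_abs_sum_sub_gt_le {X : ℕ → Ω → ℝ} (hm : ∀ m, Measurable (X m))
    (hind : iIndepFun X μ) (hid : ∀ m, IdentDistrib (X m) (X 0) μ μ) (hb : ∀ m ω, |X m ω| ≤ 1)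
    {ε : ℝ} (hε : 0 < ε) (n : ℕ) :
    μ.real {ω | ε * n < |∑ m ∈ Finset.range n, X m ω - n * ∫ ω, X 0 ω ∂μ|} ≤
      2 * Real.exp (-(ε ^ 2 / 2) * n) := by
  rcases Nat.eq_zero_or_pos n with rfl | hn
  · simp
  set e := ∫ ω, X 0 ω ∂μ
  have hn0 : (0 : ℝ) < n := by exact_mod_cast hn
  -- The sub-Gaussian variance proxy is the squared half-length of [-1, 1].
  have hone : (‖(1 : ℝ) - -1‖₊ / 2) ^ 2 = 1 := by
    rw [← NNReal.coe_inj]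
    norm_num
  have hsub : ∀ m, HasSubgaussianMGF (fun ω => X m ω - e) 1 μ := by
    intro m
    have h1 := hasSubgaussianMGF_of_mem_Icc (μ := μ) (a := -1) (b := 1) (hm m).aemeasurable
      (Eventually.of_forall fun ω => abs_le.1 (hb m ω))
    rwa [hone, (hid m).integral_eq] at h1
  have hind' : iIndepFun (fun m ω => X m ω - e) μ :=
    hind.comp (fun _ x => x - e) fun _ => by fun_prop
  have hindn : iIndepFun (fun m ω => -(X m ω - e)) μ :=
    hind.comp (fun _ x => -(x - e)) fun _ => by fun_prop
  have hexp : Real.exp (-(ε * n) ^ 2 / (2 * n * ((1 : NNReal) : ℝ))) =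
      Real.exp (-(ε ^ 2 / 2) * n) := by
    congr 1
    push_cast
    field_simp
  have h1 := HasSubgaussianMGF.measure_sum_range_ge_le_of_iIndepFun hind' (n := n)
    (fun m _ => hsub m) (ε := ε * n) (by positivity)
  have h2 := HasSubgaussianMGF.measure_sum_range_ge_le_of_iIndepFun hindn (n := n)
    (fun m _ => (hsub m).neg) (ε := ε * n) (by positivity)
  rw [hexp] at h1 h2
  refine (measureReal_mono (s₂ := {ω | ε * n ≤ ∑ m ∈ Finset.range n, (X m ω - e)} ∪
    {ω | ε * n ≤ ∑ m ∈ Finset.range n, -(X m ω - e)}) fun ω hω => ?_).trans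
    ((measureReal_union_le _ _).trans (by linarith))
  have hs : ∑ m ∈ Finset.range n, (X m ω - e) = ∑ m ∈ Finset.range n, X m ω - n * e := by
    simp [Finset.sum_sub_distrib]
  simp only [Set.mem_ofPred_eq, Set.mem_union, Finset.sum_neg_distrib, hs] at hω ⊢
  exact (lt_abs.1 hω).imp le_of_lt le_of_lt

end Hoeffding

/-! ### Bounded surrogate for the clutter scatter. -/

section Scatter

variable {q : ℕ}

/-- The bounded weight attached to a texture and a speckle. -/
noncomputable def truncWeight (a : ℝ × (Fin q → ℂ)) : ℝ := min (a.1 ^ 2) 1 / (1 + sumSq a.2)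

/-- An entry of the bounded clutter scatter. -/
noncomputable def truncEntry (j k : Fin q) (a : ℝ × (Fin q → ℂ)) : ℂ :=
  (truncWeight a : ℂ) * (a.2 j * star (a.2 k))

/-- The event that the bounded clutter scatter is close to `n K`. -/
def scatterEvent (K : Matrix (Fin q) (Fin q) ℂ) (ε : ℝ) (n : ℕ) :
    Set (ℕ → ℝ × (Fin q → ℂ)) :=
  {a | ∀ j k, |∑ m ∈ Finset.range n, (truncEntry j k (a m)).re - n * (K j k).re| ≤ ε * n ∧
    |∑ m ∈ Finset.range n, (truncEntry j k (a m)).im - n * (K j k).im| ≤ ε * n}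

lemma measurable_sumSq {ι : Type*} [Fintype ι] : Measurable (sumSq : (ι → ℂ) → ℝ) := by
  unfold sumSq; fun_prop

lemma continuous_sumSq {ι : Type*} [Fintype ι] : Continuous (sumSq : (ι → ℂ) → ℝ) := by
  unfold sumSq; fun_prop

lemma measurable_truncWeight : Measurable (truncWeight : ℝ × (Fin q → ℂ) → ℝ) := by
  have := measurable_sumSq (ι := Fin q)
  unfold truncWeight; fun_prop

lemma measurable_truncEntry (j k : Fin q) : Measurable (truncEntry j k) := by
  have := measurable_truncWeight (q := q)
  unfold truncEntry; fun_prop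

lemma truncWeight_nonneg (a : ℝ × (Fin q → ℂ)) : 0 ≤ truncWeight a := by
  have := sumSq_nonneg a.2
  unfold truncWeight; positivity

lemma truncWeight_le (a : ℝ × (Fin q → ℂ)) : truncWeight a ≤ a.1 ^ 2 := by
  have := sumSq_nonneg a.2
  unfold truncWeight
  refine (div_le_self (by positivity) (by linarith)).trans (min_le_left _ _)

lemma norm_truncEntry_le (j k : Fin q) (a : ℝ × (Fin q → ℂ)) : ‖truncEntry j k a‖ ≤ 1 := by
  have h0 := sumSq_nonneg a.2
  have hj : ‖a.2 j‖ ^ 2 ≤ sumSq a.2 :=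
    Finset.single_le_sum (f := fun i => ‖a.2 i‖ ^ 2) (fun _ _ => by positivity) (Finset.mem_univ j)
  have hk : ‖a.2 k‖ ^ 2 ≤ sumSq a.2 :=
    Finset.single_le_sum (f := fun i => ‖a.2 i‖ ^ 2) (fun _ _ => by positivity) (Finset.mem_univ k)
  have hjk : ‖a.2 j‖ * ‖a.2 k‖ ≤ 1 + sumSq a.2 := by
    nlinarith [sq_nonneg (‖a.2 j‖ - ‖a.2 k‖)]
  rw [truncEntry, norm_mul, norm_mul, norm_star, Complex.norm_real,
    Real.norm_of_nonneg (truncWeight_nonneg a), truncWeight, div_mul_eq_mul_div,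
    div_le_one (by positivity)]
  calc _ ≤ 1 * (‖a.2 j‖ * ‖a.2 k‖) := by gcongr; exact min_le_right _ _
    _ ≤ _ := by rwa [one_mul]

lemma measurableSet_scatterEvent (K : Matrix (Fin q) (Fin q) ℂ) (ε : ℝ) (n : ℕ) :
    MeasurableSet (scatterEvent K ε n) := by
  have h1 : scatterEvent K ε n = ⋂ j, ⋂ k,
      {a | |∑ m ∈ Finset.range n, (truncEntry j k (a m)).re - n * (K j k).re| ≤ ε * n} ∩
      {a | |∑ m ∈ Finset.range n, (truncEntry j k (a m)).im - n * (K j k).im| ≤ ε * n} := by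
    ext a; simp [scatterEvent, Set.mem_iInter]
  rw [h1]
  refine MeasurableSet.iInter fun j => MeasurableSet.iInter fun k => MeasurableSet.inter ?_ ?_
  · have hm : ∀ m, Measurable fun a : ℕ → ℝ × (Fin q → ℂ) => (truncEntry j k (a m)).re := fun m =>
      Complex.measurable_re.comp ((measurable_truncEntry j k).comp (measurable_pi_apply m))
    exact measurableSet_le
      ((Finset.measurable_sum _ fun m _ => hm m).sub_const _).abs measurable_const
  · have hm : ∀ m, Measurable fun a : ℕ → ℝ × (Fin q → ℂ) => (truncEntry j k (a m)).im := fun m =>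
      Complex.measurable_im.comp ((measurable_truncEntry j k).comp (measurable_pi_apply m))
    exact measurableSet_le
      ((Finset.measurable_sum _ fun m _ => hm m).sub_const _).abs measurable_const

lemma star_dotProduct_truncEntry (v : Fin q → ℂ) (a : ℝ × (Fin q → ℂ)) :
    star v ⬝ᵥ ((Matrix.of fun j k => truncEntry j k a) *ᵥ v) =
      ((truncWeight a * ‖star v ⬝ᵥ a.2‖ ^ 2 : ℝ) : ℂ) := by
  have h1 : (Matrix.of fun j k => truncEntry j k a) =
      (truncWeight a : ℂ) • vecMulVec a.2 (star a.2) := by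
    ext j k; simp [truncEntry, vecMulVec_apply]
  have h2 : star a.2 ⬝ᵥ v = star (star v ⬝ᵥ a.2) := by rw [← Matrix.star_dotProduct]
  rw [h1, Matrix.smul_mulVec, dotProduct_smul, vecMulVec_bilin, h2, Complex.star_def,
    Complex.mul_conj', smul_eq_mul]
  push_cast; rfl

/-- The truncated weight is at most τ², so the true scatter dominates the surrogate. Entrywise
deviations εn in real and imaginary part give Frobenius norm at most 2qεn, hence the loss 2qε. -/
lemma scatterBound_of_mem {B K : Matrix (Fin q) (Fin q) ℂ} {k₀ ε : ℝ}
    (hK : ∀ v ∈ LinearMap.range B.mulVecLin, k₀ * sumSq v ≤ qform K v)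
    (hε : 0 ≤ ε) {n : ℕ} {a : ℕ → ℝ × (Fin q → ℂ)} (ha : a ∈ scatterEvent K ε n) :
    ScatterBound B ((k₀ - 2 * q * ε) * n) n (fun m => ((a m).1 : ℂ) • (a m).2) := by
  intro v hv
  set D : Matrix (Fin q) (Fin q) ℂ :=
    (∑ m ∈ Finset.range n, Matrix.of fun j k => truncEntry j k (a m)) - (n : ℂ) • K with hD
  have hDe : ∀ j k, ‖D j k‖ ^ 2 ≤ (2 * ε * n) ^ 2 := by
    intro j k
    obtain ⟨h1, h2⟩ := ha j k
    have e1 : (D j k).re = ∑ m ∈ Finset.range n, (truncEntry j k (a m)).re - n * (K j k).re := by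
      simp [hD, Matrix.sum_apply, Complex.re_sum]
    have e2 : (D j k).im = ∑ m ∈ Finset.range n, (truncEntry j k (a m)).im - n * (K j k).im := by
      simp [hD, Matrix.sum_apply, Complex.im_sum]
    rw [← e1] at h1
    rw [← e2] at h2
    have h3 : ‖D j k‖ ≤ 2 * ε * n := (Complex.norm_le_abs_re_add_abs_im _).trans (by linarith)
    gcongr
  have hfrob : √(frobSq D) ≤ 2 * q * ε * n := by
    rw [Real.sqrt_le_iff]
    refine ⟨by positivity, ?_⟩
    calc frobSq D ≤ ∑ _j : Fin q, ∑ _k : Fin q, (2 * ε * n) ^ 2 :=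
          Finset.sum_le_sum fun j _ => Finset.sum_le_sum fun k _ => hDe j k
      _ = _ := by simp; ring
  have h1 := (abs_le.1 (norm_re_le_of_bilin (norm_bilin_le D) v)).1
  have h2 : (star v ⬝ᵥ (D *ᵥ v)).re =
      ∑ m ∈ Finset.range n, truncWeight (a m) * ‖star v ⬝ᵥ (a m).2‖ ^ 2 - n * qform K v := by
    rw [hD, Matrix.sub_mulVec, dotProduct_sub, Matrix.sum_mulVec, dotProduct_sum,
      Matrix.smul_mulVec, dotProduct_smul, Complex.sub_re, Complex.re_sum,
      Finset.sum_congr rfl fun m _ => by rw [star_dotProduct_truncEntry, Complex.ofReal_re],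
      smul_eq_mul, ← Complex.ofReal_natCast, Complex.re_ofReal_mul]
    rfl
  rw [h2] at h1
  have h3 : ∑ m ∈ Finset.range n, truncWeight (a m) * ‖star v ⬝ᵥ (a m).2‖ ^ 2 ≤
      ∑ m ∈ Finset.range n, ‖star v ⬝ᵥ (((a m).1 : ℂ) • (a m).2)‖ ^ 2 := by
    refine Finset.sum_le_sum fun m _ => ?_
    rw [dotProduct_smul, smul_eq_mul, norm_mul, mul_pow, Complex.norm_real, Real.norm_eq_abs,
      sq_abs]
    gcongr
    exact truncWeight_le _
  have h4 := hK v hv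
  have h5 : √(frobSq D) * sumSq v ≤ 2 * q * ε * n * sumSq v :=
    mul_le_mul_of_nonneg_right hfrob (sumSq_nonneg v)
  have h6 : (n : ℝ) * (k₀ * sumSq v) ≤ n * qform K v := by gcongr
  refine le_trans ?_ h3
  have h7 : (k₀ - 2 * q * ε) * n * sumSq v = n * (k₀ * sumSq v) - 2 * q * ε * n * sumSq v := by ring
  rw [h7]
  linarith

/-- A quadratic form that is positive on a subspace is bounded below there. -/
lemma exists_qform_lower_bound (K : Matrix (Fin q) (Fin q) ℂ) (V : Submodule ℂ (Fin q → ℂ))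
    (hpos : ∀ v ∈ V, v ≠ 0 → 0 < qform K v) :
    ∃ k₀ : ℝ, 0 < k₀ ∧ ∀ v ∈ V, k₀ * sumSq v ≤ qform K v := by
  set S : Set (Fin q → ℂ) := {v | v ∈ V ∧ sumSq v = 1} with hS
  have hScomp : IsCompact S := by
    refine Metric.isCompact_of_isClosed_isBounded ?_ ?_
    · exact (Submodule.closed_of_finiteDimensional V).inter
        (isClosed_eq continuous_sumSq continuous_const)
    · refine (Metric.isBounded_iff_subset_closedBall 0).2 ⟨1, fun v hv => ?_⟩
      rw [mem_closedBall_zero_iff, pi_norm_le_iff_of_nonneg zero_le_one]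
      intro i
      have h1 : ‖v i‖ ^ 2 ≤ 1 := hv.2 ▸ Finset.single_le_sum (f := fun i => ‖v i‖ ^ 2)
        (fun _ _ => by positivity) (Finset.mem_univ i)
      exact (sq_le_one_iff₀ (norm_nonneg _)).1 h1
  have hcont : Continuous (qform K) := by
    unfold qform Matrix.mulVec dotProduct
    fun_prop
  have hscale : ∀ k₀ : ℝ, (∀ v ∈ S, k₀ ≤ qform K v) → ∀ v ∈ V, k₀ * sumSq v ≤ qform K v := by
    intro k₀ hk v hv
    rcases eq_or_ne v 0 with rfl | hv0
    · simp [sumSq, qform]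
    have hs := sumSq_pos hv0
    have e : ‖(((√(sumSq v))⁻¹ : ℝ) : ℂ)‖ ^ 2 = (sumSq v)⁻¹ := by
      rw [Complex.norm_real, Real.norm_eq_abs, sq_abs, inv_pow, Real.sq_sqrt hs.le]
    have h1 := hk ((((√(sumSq v))⁻¹ : ℝ) : ℂ) • v) ⟨V.smul_mem _ hv, by
      rw [sumSq_smul, e, inv_mul_cancel₀ hs.ne']⟩
    rwa [qform_smul, e, ← div_eq_inv_mul, le_div_iff₀ hs] at h1
  rcases S.eq_empty_or_nonempty with hemp | hne
  · exact ⟨1, one_pos, hscale 1 fun v hv => by rw [hemp] at hv; exact hv.elim⟩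
  · obtain ⟨v₀, hv₀, hmin⟩ := hScomp.exists_isMinOn hne hcont.continuousOn
    refine ⟨qform K v₀, hpos v₀ hv₀.1 ?_, hscale _ fun v hv => hmin hv⟩
    rintro rfl
    have := hv₀.2
    simp [sumSq] at this

end Scatter

/-! ### The clutter event and its exponentially small complement. -/

section Event

variable {Ω : Type*} [MeasurableSpace Ω] {p q : ℕ} {μ : Measure Ω} [IsProbabilityMeasure μ]
  {B : Matrix (Fin q) (Fin q) ℂ} {τ : ℕ → Ω → ℝ} {c : ℕ → Ω → Fin q → ℂ}
  {z : ℕ → Ω → Fin p × Fin q → ℂ}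

lemma IsSIRVTraining.measurable_clutter (H : IsSIRVTraining μ B τ c z) (m : ℕ) :
    Measurable fun ω => (τ m ω, c m ω) := (H.measurable_texture m).prodMk (H.measurable_speckle m)

lemma integrable_truncEntry (H : IsSIRVTraining μ B τ c z) (j k : Fin q) :
    Integrable (fun ω => truncEntry j k (τ 0 ω, c 0 ω)) μ :=
  Integrable.of_bound ((measurable_truncEntry j k).comp
    (H.measurable_clutter 0)).aestronglyMeasurable 1
    (Eventually.of_forall fun _ => norm_truncEntry_le j k _)

/-- A Gaussian linear functional with positive variance is almost surely nonzero. -/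
lemma IsSIRVTraining.ae_star_dotProduct_ne_zero (H : IsSIRVTraining μ B τ c z)
    {v : Fin q → ℂ} (hv : 0 < qform B v) (m : ℕ) : ∀ᵐ ω ∂μ, star v ⬝ᵥ c m ω ≠ 0 := by
  have hm : Measurable fun ω => (star v ⬝ᵥ c m ω).re :=
    (measurable_re_star_dotProduct v).comp (H.measurable_speckle m)
  have hne : Real.toNNReal ((star v ⬝ᵥ (B *ᵥ v)).re / 2) ≠ 0 := by
    rw [Ne, Real.toNNReal_eq_zero, not_le]; unfold qform at hv; positivity
  have h1 : μ.map (fun ω => (star v ⬝ᵥ c m ω).re) {0} = 0 := by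
    rw [H.speckle_gaussian m v]
    have := nullSingletonClass_gaussianReal (μ := 0) hne
    exact measure_singleton 0
  rw [Measure.map_apply hm (measurableSet_singleton 0)] at h1
  have h2 : ∀ᵐ ω ∂μ, (star v ⬝ᵥ c m ω).re ≠ 0 := by
    rw [ae_iff]; simpa [Set.preimage] using h1
  filter_upwards [h2] with ω hω h0
  exact hω (by rw [h0, Complex.zero_re])

/-- The variance is zero, so the law of the real part is a Dirac mass; replacing v by iv treats the
imaginary part. -/
lemma IsSIRVTraining.ae_star_dotProduct_eq_zero (H : IsSIRVTraining μ B τ c z)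
    {v : Fin q → ℂ} (hv : B *ᵥ v = 0) (m : ℕ) : ∀ᵐ ω ∂μ, star v ⬝ᵥ c m ω = 0 := by
  have key : ∀ w : Fin q → ℂ, B *ᵥ w = 0 → ∀ᵐ ω ∂μ, (star w ⬝ᵥ c m ω).re = 0 := by
    intro w hw
    have hm : Measurable fun ω => (star w ⬝ᵥ c m ω).re :=
      (measurable_re_star_dotProduct w).comp (H.measurable_speckle m)
    have h1 := H.speckle_gaussian m w
    rw [hw, dotProduct_zero, Complex.zero_re, zero_div, Real.toNNReal_zero,
      gaussianReal_zero_var] at h1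
    have h2 : ∀ᵐ x ∂(μ.map fun ω => (star w ⬝ᵥ c m ω).re), x = 0 := by
      rw [h1, ae_dirac_eq]; rfl
    exact ae_of_ae_map hm.aemeasurable h2
  filter_upwards [key v hv, key (Complex.I • v) (by rw [Matrix.mulVec_smul, hv, smul_zero])]
    with ω h1 h2
  apply Complex.ext h1
  simpa [star_smul, smul_dotProduct] using h2

/-- The mean K of the bounded surrogate is positive definite on the range of B: there vᴴc is almost
surely nonzero and the weight is positive. Hoeffding for each entry then gives exponential
concentration, whatever the tail of τ. -/
lemma IsSIRVTraining.exists_scatterEvent (H : IsSIRVTraining μ B τ c z) (hB : B.PosSemidef) :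
    ∃ (c₀ : ℝ) (G : ℕ → Set (ℕ → ℝ × (Fin q → ℂ))), 0 < c₀ ∧ (∀ n, MeasurableSet (G n)) ∧
      (∀ n a, a ∈ G n → ScatterBound B (c₀ * n) n (fun m => ((a m).1 : ℂ) • (a m).2)) ∧
      Tendsto (fun n : ℕ => (n : ℝ) * μ.real {ω | (fun m => (τ m ω, c m ω)) ∉ G n})
        atTop (𝓝 0) := by
  set K : Matrix (Fin q) (Fin q) ℂ :=
    Matrix.of fun j k => ∫ ω, truncEntry j k (τ 0 ω, c 0 ω) ∂μ with hKdef
  have hint := integrable_truncEntry H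
  have hKform : ∀ v, qform K v =
      ∫ ω, truncWeight (τ 0 ω, c 0 ω) * ‖star v ⬝ᵥ c 0 ω‖ ^ 2 ∂μ := by
    intro v
    have h1 : ∀ (M : Matrix (Fin q) (Fin q) ℂ),
        star v ⬝ᵥ (M *ᵥ v) = ∑ j, ∑ k, star (v j) * v k * M j k := by
      intro M
      simp only [dotProduct, Matrix.mulVec, Finset.mul_sum, Pi.star_apply]
      exact Finset.sum_congr rfl fun _ _ => Finset.sum_congr rfl fun _ _ => by ring
    have h2 : star v ⬝ᵥ (K *ᵥ v) =
        ∫ ω, star v ⬝ᵥ ((Matrix.of fun j k => truncEntry j k (τ 0 ω, c 0 ω)) *ᵥ v) ∂μ := by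
      simp only [h1, hKdef, Matrix.of_apply]
      rw [integral_finsetSum _ fun j _ => integrable_finsetSum _ fun k _ =>
        (hint j k).const_mul _]
      refine Finset.sum_congr rfl fun j _ => ?_
      rw [integral_finsetSum _ fun k _ => (hint j k).const_mul _]
      exact Finset.sum_congr rfl fun k _ => (integral_const_mul _ _).symm
    rw [qform, h2]
    simp only [star_dotProduct_truncEntry]
    rw [integral_complex_ofReal, Complex.ofReal_re]
  have hpos : ∀ v ∈ LinearMap.range B.mulVecLin, v ≠ 0 → 0 < qform K v := by
    rintro v ⟨x, rfl⟩ hv0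
    set v := B.mulVecLin x
    -- A vanishing form would put v in ker B, which is orthogonal to the range of B, where v already
    -- lies.
    have hBv : 0 < qform B v := by
      refine lt_of_le_of_ne (qform_nonneg hB v) fun h0 => hv0 ?_
      have h1 : star v ⬝ᵥ (B *ᵥ v) = 0 := by
        have h2 := hB.dotProduct_mulVec_nonneg v
        exact Complex.ext h0.symm (Complex.nonneg_iff.1 h2).2.symm
      have h3 : B *ᵥ v = 0 := (hB.dotProduct_mulVec_zero_iff v).1 h1
      have h4 : star v ⬝ᵥ v = 0 := by
        change star v ⬝ᵥ (B *ᵥ x) = 0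
        rw [Matrix.dotProduct_mulVec]
        have : star v ᵥ* B = star (B *ᵥ v) := by
          rw [Matrix.star_mulVec B v, hB.isHermitian.eq]
        rw [this, h3, star_zero, zero_dotProduct]
      exact dotProduct_star_self_eq_zero.1 h4
    rw [hKform]
    have hnn : ∀ ω, 0 ≤ truncWeight (τ 0 ω, c 0 ω) * ‖star v ⬝ᵥ c 0 ω‖ ^ 2 := fun ω =>
      mul_nonneg (truncWeight_nonneg _) (by positivity)
    have hi : Integrable (fun ω => truncWeight (τ 0 ω, c 0 ω) * ‖star v ⬝ᵥ c 0 ω‖ ^ 2) μ := by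
      have h5 : Measurable fun ω => star v ⬝ᵥ c 0 ω := by
        have := H.measurable_speckle 0
        unfold dotProduct; fun_prop
      have h6 : Measurable fun ω => truncWeight (τ 0 ω, c 0 ω) :=
        measurable_truncWeight.comp (H.measurable_clutter 0)
      refine Integrable.of_bound (by fun_prop) (sumSq v) (Eventually.of_forall fun ω => ?_)
      rw [Real.norm_of_nonneg (hnn ω)]
      have h7 := sumSq_nonneg (c 0 ω)
      have h8 := sumSq_nonneg v
      calc _ ≤ 1 / (1 + sumSq (c 0 ω)) * (sumSq v * sumSq (c 0 ω)) := by
            unfold truncWeight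
            gcongr
            · exact min_le_right _ _
            · exact norm_star_dotProduct_sq_le _ _
        _ ≤ sumSq v := by
            rw [div_mul_eq_mul_div, one_mul, div_le_iff₀ (by positivity)]
            nlinarith
    rw [integral_pos_iff_support_of_nonneg hnn hi]
    have hae : ∀ᵐ ω ∂μ, ω ∈ Function.support
        fun ω => truncWeight (τ 0 ω, c 0 ω) * ‖star v ⬝ᵥ c 0 ω‖ ^ 2 := by
      filter_upwards [H.ae_star_dotProduct_ne_zero hBv 0, H.texture_pos 0] with ω h1 h2
      rw [Function.mem_support]
      have h7 := sumSq_nonneg (c 0 ω)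
      have h8 := norm_pos_iff.2 h1
      unfold truncWeight
      positivity
    have h9 := measure_congr (eventuallyEq_univ.2 hae)
    rw [measure_univ] at h9
    exact h9.symm ▸ one_pos
  obtain ⟨k₀, hk₀, hK⟩ := exists_qform_lower_bound K _ hpos
  -- Chosen so that the loss 2qε is at most k₀/2.
  set ε : ℝ := k₀ / (4 * (q + 1)) with hε
  have hε0 : 0 < ε := by positivity
  have hεk : k₀ / 2 ≤ k₀ - 2 * q * ε := by
    rw [hε]
    have : 2 * q * (k₀ / (4 * (q + 1))) ≤ k₀ / 2 := by
      rw [mul_div_assoc', div_le_div_iff₀ (by positivity) (by positivity)]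
      nlinarith
    linarith
  refine ⟨k₀ - 2 * q * ε, scatterEvent K ε, by linarith [half_pos hk₀],
    measurableSet_scatterEvent K ε,
    fun n a ha => scatterBound_of_mem hK hε0.le ha, ?_⟩
  have hbound : ∀ n : ℕ, μ.real {ω | (fun m => (τ m ω, c m ω)) ∉ scatterEvent K ε n} ≤
      (q * q * 4) * Real.exp (-(ε ^ 2 / 2) * n) := by
    intro n
    have hid : ∀ m, IdentDistrib (fun ω => (τ m ω, c m ω)) (fun ω => (τ 0 ω, c 0 ω)) μ μ :=
      fun m => (H.identDistrib m).comp measurable_fst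
    have hind : iIndepFun (fun m ω => (τ m ω, c m ω)) μ :=
      H.iIndepFun_triple.comp (fun _ => Prod.fst) fun _ => measurable_fst
    have hone : ∀ φ : ℝ × (Fin q → ℂ) → ℝ, Measurable φ → (∀ a, |φ a| ≤ 1) →
        μ.real {ω | ε * n < |∑ m ∈ Finset.range n, φ (τ m ω, c m ω) -
          n * ∫ ω, φ (τ 0 ω, c 0 ω) ∂μ|} ≤ 2 * Real.exp (-(ε ^ 2 / 2) * n) := by
      intro φ hφ hb
      exact measure_abs_sum_sub_gt_le (X := fun m ω => φ (τ m ω, c m ω))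
        (fun m => hφ.comp (H.measurable_clutter m)) (hind.comp (fun _ => φ) fun _ => hφ)
        (fun m => (hid m).comp hφ) (fun m ω => hb _) hε0 n
    have hre : ∀ j k, (K j k).re = ∫ ω, (truncEntry j k (τ 0 ω, c 0 ω)).re ∂μ := fun j k =>
      (integral_re (hint j k)).symm
    have him : ∀ j k, (K j k).im = ∫ ω, (truncEntry j k (τ 0 ω, c 0 ω)).im ∂μ := fun j k =>
      (integral_im (hint j k)).symm
    set b := 2 * Real.exp (-(ε ^ 2 / 2) * n) with hb
    calc _ ≤ μ.real (⋃ x : Fin q × Fin q,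
          {ω | ε * n < |∑ m ∈ Finset.range n, (truncEntry x.1 x.2 (τ m ω, c m ω)).re -
            n * (K x.1 x.2).re|} ∪
          {ω | ε * n < |∑ m ∈ Finset.range n, (truncEntry x.1 x.2 (τ m ω, c m ω)).im -
            n * (K x.1 x.2).im|}) := by
          refine measureReal_mono fun ω hω => ?_
          simp only [scatterEvent, Set.mem_ofPred_eq, not_forall, not_and_or, not_le] at hω
          obtain ⟨j, k, h⟩ := hω
          exact Set.mem_iUnion.2 ⟨(j, k), h⟩
      _ ≤ ∑ x : Fin q × Fin q, (b + b) := by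
          refine (measureReal_iUnion_fintype_le _).trans (Finset.sum_le_sum fun x _ => ?_)
          refine (measureReal_union_le _ _).trans (add_le_add ?_ ?_)
          · rw [hre]
            exact hone (fun a => (truncEntry x.1 x.2 a).re)
              (Complex.measurable_re.comp (measurable_truncEntry x.1 x.2)) fun a =>
              (Complex.abs_re_le_norm _).trans (norm_truncEntry_le _ _ _)
          · rw [him]
            exact hone (fun a => (truncEntry x.1 x.2 a).im)
              (Complex.measurable_im.comp (measurable_truncEntry x.1 x.2)) fun a =>
              (Complex.abs_im_le_norm _).trans (norm_truncEntry_le _ _ _)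
      _ = _ := by simp [hb]; ring
  have hlim : Tendsto (fun n : ℕ => (q * q * 4 : ℝ) *
      ((n : ℝ) * Real.exp (-(ε ^ 2 / 2) * n))) atTop (𝓝 0) := by
    have h1 := (Real.tendsto_pow_mul_exp_neg_atTop_nhds_zero 1).comp
      (tendsto_natCast_atTop_atTop.const_mul_atTop (by positivity : 0 < ε ^ 2 / 2))
    have h2 := h1.const_mul ((q * q * 4 : ℝ) * (ε ^ 2 / 2)⁻¹)
    rw [mul_zero] at h2
    refine h2.congr fun n => ?_
    simp only [Function.comp_apply, pow_one, neg_mul]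
    field_simp
  refine squeeze_zero (fun n => by positivity) (fun n => ?_) hlim
  calc _ ≤ (n : ℝ) * ((q * q * 4) * Real.exp (-(ε ^ 2 / 2) * n)) := by
        gcongr; exact hbound n
    _ = _ := by ring

end Event

/-! ### Conditioning on the clutter, independence of sequences and Gaussian scaling. -/

section Conditioning

variable {Ω : Type*} [MeasurableSpace Ω] {μ : Measure Ω} [IsProbabilityMeasure μ]

/-- Fubini on the product law. The bound on the inner integrals, uniform in the frozen first
argument, also yields integrability. -/
lemma integral_comp_of_indepFun {α β : Type*} [MeasurableSpace α] [MeasurableSpace β]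
    {U : Ω → α} {Z : Ω → β} (hU : Measurable U) (hZ : Measurable Z) (hind : IndepFun U Z μ)
    {F : α × β → ℝ} (hF : Measurable F) (h0 : ∀ x, 0 ≤ F x) {b : ℝ}
    (hint : ∀ a, Integrable (fun ω => F (a, Z ω)) μ) (hb : ∀ a, ∫ ω, F (a, Z ω) ∂μ ≤ b) :
    Integrable (fun ω => F (U ω, Z ω)) μ ∧
    ∫ ω, F (U ω, Z ω) ∂μ = ∫ ω, ∫ ω', F (U ω, Z ω') ∂μ ∂μ ∧
    ∫ ω, F (U ω, Z ω) ∂μ ≤ b := by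
  have hmap := (indepFun_iff_map_prod_eq_prod_map_map hU.aemeasurable hZ.aemeasurable).1 hind
  have := Measure.isProbabilityMeasure_map hU.aemeasurable (μ := μ)
  have := Measure.isProbabilityMeasure_map hZ.aemeasurable (μ := μ)
  have hUZ := hU.prodMk hZ
  have e1 : ∀ a, ∫ y, F (a, y) ∂(μ.map Z) = ∫ ω, F (a, Z ω) ∂μ := fun a =>
    integral_map hZ.aemeasurable (hF.comp measurable_prodMk_left).aestronglyMeasurable
  have hm : StronglyMeasurable fun a => ∫ y, F (a, y) ∂(μ.map Z) :=
    StronglyMeasurable.integral_prod_right (f := fun a y => F (a, y)) hF.stronglyMeasurable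
  have hg0 : ∀ a, 0 ≤ ∫ y, F (a, y) ∂(μ.map Z) := fun a => integral_nonneg fun y => h0 _
  have hI : Integrable F ((μ.map U).prod (μ.map Z)) := by
    refine (integrable_prod_iff hF.aestronglyMeasurable).2 ⟨Eventually.of_forall fun a => ?_, ?_⟩
    · exact (integrable_map_measure (hF.comp measurable_prodMk_left).aestronglyMeasurable
        hZ.aemeasurable).2 (hint a)
    · simp only [Real.norm_of_nonneg (h0 _)]
      refine Integrable.of_bound hm.aestronglyMeasurable b (Eventually.of_forall fun a => ?_)
      rw [Real.norm_of_nonneg (hg0 a), e1]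
      exact hb a
  have e2 : ∫ ω, F (U ω, Z ω) ∂μ = ∫ ω, ∫ ω', F (U ω, Z ω') ∂μ ∂μ := by
    rw [← integral_map (φ := fun ω => (U ω, Z ω)) hUZ.aemeasurable hF.aestronglyMeasurable, hmap,
      integral_prod _ hI, integral_map hU.aemeasurable hm.aestronglyMeasurable]
    simp only [e1]
  refine ⟨?_, e2, ?_⟩
  · rw [← hmap] at hI
    exact (integrable_map_measure hF.aestronglyMeasurable hUZ.aemeasurable).1 hI
  · rw [e2]
    refine (integral_mono_of_nonneg (Eventually.of_forall fun ω => integral_nonneg fun _ => h0 _)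
      (integrable_const b) (Eventually.of_forall fun ω => hb _)).trans ?_
    simp

/-- If the pairs `(X m, Y m)` are independent, and `X m` is independent of `Y m` for each `m`,
then the sequences `X` and `Y` are independent. -/
lemma indepFun_sequences {α β : Type*} [MeasurableSpace α] [MeasurableSpace β]
    {X : ℕ → Ω → α} {Y : ℕ → Ω → β} (hX : ∀ m, Measurable (X m)) (hY : ∀ m, Measurable (Y m))
    (hXY : iIndepFun (fun m ω => (X m ω, Y m ω)) μ) (h : ∀ m, IndepFun (X m) (Y m) μ) :
    IndepFun (fun ω m => X m ω) (fun ω m => Y m ω) μ := by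
  have hP : ∀ m, IsProbabilityMeasure (μ.map (X m)) := fun m =>
    Measure.isProbabilityMeasure_map (hX m).aemeasurable
  have hQ : ∀ m, IsProbabilityMeasure (μ.map (Y m)) := fun m =>
    Measure.isProbabilityMeasure_map (hY m).aemeasurable
  -- For a finite prefix, the law of the pairs is a product of products; regrouping the coordinates
  -- separates the two families. The passage to sequences only needs finite index sets, each
  -- contained in some prefix.
  have hfin : ∀ n, IndepFun (fun ω (m : Fin n) => X m ω) (fun ω (m : Fin n) => Y m ω) μ := by
    intro n
    have hXm : Measurable fun ω (m : Fin n) => X m ω := measurable_pi_lambda _ fun m => hX m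
    have hYm : Measurable fun ω (m : Fin n) => Y m ω := measurable_pi_lambda _ fun m => hY m
    have h1 : iIndepFun (fun (m : Fin n) ω => (X m ω, Y m ω)) μ :=
      hXY.precomp Fin.val_injective
    have hXi : iIndepFun (fun (m : Fin n) ω => X m ω) μ :=
      h1.comp (fun _ => Prod.fst) fun _ => measurable_fst
    have hYi : iIndepFun (fun (m : Fin n) ω => Y m ω) μ :=
      h1.comp (fun _ => Prod.snd) fun _ => measurable_snd
    rw [indepFun_iff_map_prod_eq_prod_map_map hXm.aemeasurable hYm.aemeasurable,
      (iIndepFun_iff_map_fun_eq_pi_map (f := fun (m : Fin n) ω => X m ω)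
        fun m => (hX m).aemeasurable).1 hXi,
      (iIndepFun_iff_map_fun_eq_pi_map (f := fun (m : Fin n) ω => Y m ω)
        fun m => (hY m).aemeasurable).1 hYi]
    have h2 := (iIndepFun_iff_map_fun_eq_pi_map (f := fun (m : Fin n) ω => (X m ω, Y m ω))
      fun m => ((hX m).prodMk (hY m)).aemeasurable).1 h1
    have h3 := (measurePreserving_arrowProdEquivProdArrow α β (Fin n)
      (fun m => μ.map (X m)) (fun m => μ.map (Y m))).map_eq
    rw [← h3, ← funext fun m : Fin n => (indepFun_iff_map_prod_eq_prod_map_map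
      (hX m).aemeasurable (hY m).aemeasurable).1 (h m), ← h2,
      Measure.map_map (f := fun ω (i : Fin n) => (X i ω, Y i ω)) (MeasurableEquiv.measurable _)
        (measurable_pi_lambda _ fun m => (hX m).prodMk (hY m))]
    rfl
  refine IndepFun.process_indepFun_process hX hY fun I J => ?_
  set n := (I ∪ J).sup id + 1 with hn
  have hI : ∀ i ∈ I, i < n := fun i hi =>
    Nat.lt_succ_of_le (Finset.le_sup (f := id) (Finset.mem_union_left J hi))
  have hJ : ∀ j ∈ J, j < n := fun j hj =>
    Nat.lt_succ_of_le (Finset.le_sup (f := id) (Finset.mem_union_right I hj))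
  exact (hfin n).comp (φ := fun a (i : I) => a ⟨i, hI i i.2⟩) (ψ := fun a (j : J) => a ⟨j, hJ j j.2⟩)
    (by fun_prop) (by fun_prop)

lemma integral_pow_of_map_eq_gaussianReal {X : Ω → ℝ} (hX : Measurable X) {v : ℝ} (hv : 0 ≤ v)
    (hmap : μ.map X = gaussianReal 0 v.toNNReal) (k : ℕ) :
    Integrable (fun ω => X ω ^ k) μ ∧
    ∫ ω, X ω ^ k ∂μ = √v ^ k * ∫ x, x ^ k ∂(gaussianReal 0 1) := by
  have h1 : Integrable (fun x : ℝ => x ^ k) (gaussianReal 0 v.toNNReal) := by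
    have := (memLp_id_gaussianReal' (μ := 0) (v := v.toNNReal) k (by simp))
    exact (this.integrable_norm_pow' ).mono' (by fun_prop) (Eventually.of_forall fun x => by simp)
  refine ⟨?_, ?_⟩
  · rw [← hmap] at h1
    exact (integrable_map_measure (measurable_id.pow_const k).aestronglyMeasurable hX.aemeasurable).1 h1
  · have h2 : gaussianReal 0 v.toNNReal = (gaussianReal 0 1).map (fun x => √v * x) := by
      rw [gaussianReal_map_const_mul, mul_zero, mul_one]
      congr 1
      ext
      simp [Real.sq_sqrt hv, Real.coe_toNNReal _ hv]
    rw [← integral_map (f := fun x => x ^ k) hX.aemeasurable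
      (measurable_id.pow_const k).aestronglyMeasurable, hmap, h2,
      integral_map (by fun_prop) (by fun_prop)]
    simp only [mul_pow]
    rw [integral_const_mul]

end Conditioning

/-! ### Exact law and moments of linear noise sums. -/

section NoiseSums

variable {Ω : Type*} [MeasurableSpace Ω] {p q : ℕ} {μ : Measure Ω} [IsProbabilityMeasure μ]
  {B : Matrix (Fin q) (Fin q) ℂ} {τ : ℕ → Ω → ℝ} {c : ℕ → Ω → Fin q → ℂ}
  {z : ℕ → Ω → Fin p × Fin q → ℂ}

/-- The fourth moment of a standard Gaussian variable. -/
noncomputable def gaussianFourth : ℝ := ∫ x, x ^ 4 ∂(gaussianReal 0 1)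

lemma integral_sq_gaussianReal : ∫ x, x ^ 2 ∂(gaussianReal 0 1) = 1 := by
  have h := variance_id_gaussianReal (μ := 0) (v := 1)
  rw [variance_eq_sub (memLp_id_gaussianReal 2)] at h
  simpa using h

lemma IsSIRVTraining.map_noise_sum (H : IsSIRVTraining μ B τ c z)
    (w : ℕ → Fin p × Fin q → ℂ) (n : ℕ) :
    μ.map (fun ω => ∑ m ∈ Finset.range n, (star (w m) ⬝ᵥ z m ω).re) =
      gaussianReal 0 (Real.toNNReal (∑ m ∈ Finset.range n, sumSq (w m) / 2)) := by
  have hm : ∀ m, Measurable fun ω => (star (w m) ⬝ᵥ z m ω).re := fun m =>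
    (measurable_re_star_dotProduct _).comp (H.measurable_noise m)
  have hind : iIndepFun (fun m ω => (star (w m) ⬝ᵥ z m ω).re) μ :=
    H.iIndepFun_triple.comp (fun m x => (star (w m) ⬝ᵥ x.2).re) fun m =>
      (measurable_re_star_dotProduct _).comp measurable_snd
  induction n with
  | zero => simp [Measure.map_const, gaussianReal_zero_var]
  | succ n ih =>
    have h1 : IndepFun (∑ m ∈ Finset.range n, fun ω => (star (w m) ⬝ᵥ z m ω).re)
        (fun ω => (star (w n) ⬝ᵥ z n ω).re) μ :=
      hind.indepFun_finsetSum_of_notMem hm Finset.notMem_range_self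
    have e1 : (∑ m ∈ Finset.range n, fun ω => (star (w m) ⬝ᵥ z m ω).re) =
        fun ω => ∑ m ∈ Finset.range n, (star (w m) ⬝ᵥ z m ω).re := by
      ext ω; rw [Finset.sum_apply]
    rw [e1] at h1
    have h2 := H.noise_gaussian n (w n)
    rw [Matrix.one_mulVec, ← sumSq_eq_re] at h2
    have h3 := gaussianReal_add_gaussianReal_of_indepFun h1 ih h2
    rw [add_zero, ← Real.toNNReal_add (Finset.sum_nonneg fun m _ =>
      div_nonneg (sumSq_nonneg _) zero_le_two) (div_nonneg (sumSq_nonneg _) zero_le_two)] at h3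
    simp only [Finset.sum_range_succ]
    exact h3

lemma IsSIRVTraining.noise_sum_moments (H : IsSIRVTraining μ B τ c z)
    (w : ℕ → Fin p × Fin q → ℂ) (n : ℕ) :
    (Integrable (fun ω => ‖∑ m ∈ Finset.range n, star (w m) ⬝ᵥ z m ω‖ ^ 2) μ ∧
      ∫ ω, ‖∑ m ∈ Finset.range n, star (w m) ⬝ᵥ z m ω‖ ^ 2 ∂μ =
        ∑ m ∈ Finset.range n, sumSq (w m)) ∧
    Integrable (fun ω => (‖∑ m ∈ Finset.range n, star (w m) ⬝ᵥ z m ω‖ ^ 2) ^ 2) μ ∧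
      ∫ ω, (‖∑ m ∈ Finset.range n, star (w m) ⬝ᵥ z m ω‖ ^ 2) ^ 2 ∂μ ≤
        gaussianFourth * (∑ m ∈ Finset.range n, sumSq (w m)) ^ 2 := by
  have hm : ∀ w : ℕ → Fin p × Fin q → ℂ,
      Measurable fun ω => ∑ m ∈ Finset.range n, (star (w m) ⬝ᵥ z m ω).re := fun w =>
    Finset.measurable_sum _ fun m _ =>
      (measurable_re_star_dotProduct _).comp (H.measurable_noise m)
  set W := ∑ m ∈ Finset.range n, sumSq (w m) with hW
  have hW0 : 0 ≤ W := Finset.sum_nonneg fun m _ => sumSq_nonneg _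
  have hI : ∑ m ∈ Finset.range n, sumSq (Complex.I • w m) = W := by simp [sumSq_smul, hW]
  set X := fun ω => ∑ m ∈ Finset.range n, (star (w m) ⬝ᵥ z m ω).re with hX
  -- Multiplying the weights by i turns the imaginary part into a real part with the same variance.
  -- The joint law of `X` and `Y` is not needed.
  set Y := fun ω => ∑ m ∈ Finset.range n, (star (Complex.I • w m) ⬝ᵥ z m ω).re with hY
  have hXm := H.map_noise_sum w n
  have hYm := H.map_noise_sum (fun m => Complex.I • w m) n
  rw [← Finset.sum_div] at hXm hYm
  rw [hI] at hYm
  have mX := fun k => integral_pow_of_map_eq_gaussianReal (hm w) (div_nonneg hW0 zero_le_two) hXm k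
  have mY := fun k => integral_pow_of_map_eq_gaussianReal (hm fun m => Complex.I • w m)
    (div_nonneg hW0 zero_le_two) hYm k
  have e : ∀ ω, ‖∑ m ∈ Finset.range n, star (w m) ⬝ᵥ z m ω‖ ^ 2 = X ω ^ 2 + Y ω ^ 2 := by
    intro ω
    rw [Complex.sq_norm, Complex.normSq_apply, Complex.re_sum, Complex.im_sum, hX, hY]
    simp only [star_smul, smul_dotProduct, smul_eq_mul, Complex.star_def, Complex.conj_I, neg_mul,
      Complex.neg_re, Complex.I_mul_re, neg_neg]
    ring
  simp only [e]
  have s2 : √(W / 2) ^ 2 = W / 2 := Real.sq_sqrt (by positivity)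
  have s4 : √(W / 2) ^ 4 = W ^ 2 / 4 := by
    rw [show 4 = 2 * 2 by norm_num, pow_mul, s2]; ring
  have hle : ∀ ω, (X ω ^ 2 + Y ω ^ 2) ^ 2 ≤ 2 * (X ω ^ 4 + Y ω ^ 4) := fun ω => by
    nlinarith [sq_nonneg (X ω ^ 2 - Y ω ^ 2)]
  have hi : Integrable (fun ω => 2 * (X ω ^ 4 + Y ω ^ 4)) μ := ((mX 4).1.add (mY 4).1).const_mul 2
  refine ⟨⟨(mX 2).1.add (mY 2).1, ?_⟩, ?_, ?_⟩
  · rw [integral_add (mX 2).1 (mY 2).1, (mX 2).2, (mY 2).2, s2, integral_sq_gaussianReal]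
    ring
  · have hXmeas := hm w
    have hYmeas := hm fun m => Complex.I • w m
    refine hi.mono' (((hXmeas.pow_const 2).add (hYmeas.pow_const 2)).pow_const 2).aestronglyMeasurable
      (Eventually.of_forall fun ω => ?_)
    rw [Real.norm_of_nonneg (by positivity)]
    exact hle ω
  · calc _ ≤ ∫ ω, 2 * (X ω ^ 4 + Y ω ^ 4) ∂μ :=
          integral_mono_of_nonneg (Eventually.of_forall fun ω => by positivity) hi
            (Eventually.of_forall hle)
      _ = _ := by
          rw [integral_const_mul, integral_add (mX 4).1 (mY 4).1, (mX 4).2, (mY 4).2, s4,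
            gaussianFourth]
          ring

end NoiseSums

/-! ### Conditional moments of the leading quadratic form. -/

section LeadTerm

variable {p q : ℕ}

/-- The linear functional of the cross term that belongs to a row of a factor of `B`. -/
noncomputable def rowSteer (A : Matrix (Fin q) (Fin q) ℂ) (d : Fin p × Fin q → ℂ) (l : Fin q) :
    Fin p → ℂ := fun i => ∑ j, A l j * d (i, j)

lemma mulVec_steerCross (A : Matrix (Fin q) (Fin q) ℂ) (d : Fin p × Fin q → ℂ) (n : ℕ)
    (u : ℕ → Fin q → ℂ) (z : ℕ → Fin p × Fin q → ℂ) (l : Fin q) :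
    (A *ᵥ steerCross n u z d) l =
      star (∑ m ∈ Finset.range n, star (kronVec (rowSteer A d l) (u m)) ⬝ᵥ z m) := by
  have h1 : (A *ᵥ steerCross n u z d) l = ∑ i, rowSteer A d l i * star (crossVec n u z i) := by
    simp only [Matrix.mulVec, dotProduct, steerCross, rowSteer, Finset.mul_sum, Finset.sum_mul,
      mul_assoc]
    exact Finset.sum_comm
  rw [h1, star_sum]
  simp only [crossVec_apply, star_sum, Finset.mul_sum]
  rw [Finset.sum_comm]
  refine Finset.sum_congr rfl fun m _ => ?_
  rw [dotProduct, star_sum, Fintype.sum_prod_type]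
  refine Finset.sum_congr rfl fun i _ => Finset.sum_congr rfl fun k _ => ?_
  simp only [kronVec, star_mul', star_star, Pi.star_apply]
  ring

/-- For frozen clutter each summand is the squared modulus of a linear noise sum with Kronecker
weights, so its mean factors into `sumSq (rowSteer A d l)` times the clutter energy. -/
lemma qform_steerCross (A : Matrix (Fin q) (Fin q) ℂ) (d : Fin p × Fin q → ℂ) (n : ℕ)
    (u : ℕ → Fin q → ℂ) (z : ℕ → Fin p × Fin q → ℂ) :
    qform (Aᴴ * A) (steerCross n u z d) =
      ∑ l, ‖∑ m ∈ Finset.range n, star (kronVec (rowSteer A d l) (u m)) ⬝ᵥ z m‖ ^ 2 := by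
  rw [qform_conjTranspose_mul_self, sumSq]
  simp only [mulVec_steerCross, norm_star]

lemma sumSq_kronVec (a : Fin p → ℂ) (b : Fin q → ℂ) :
    sumSq (kronVec a b) = sumSq a * sumSq b := by
  simp only [sumSq, kronVec, norm_mul, mul_pow, Fintype.sum_prod_type, Finset.sum_mul_sum]

lemma sum_sumSq_rowSteer (A : Matrix (Fin q) (Fin q) ℂ) (d : Fin p × Fin q → ℂ) :
    ∑ l, sumSq (rowSteer A d l) = ∑ i, qform (Aᴴ * A) fun j => d (i, j) := by
  simp only [qform_conjTranspose_mul_self]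
  exact Finset.sum_comm

variable {Ω : Type*} [MeasurableSpace Ω] {μ : Measure Ω} [IsProbabilityMeasure μ]
  {B : Matrix (Fin q) (Fin q) ℂ} {τ : ℕ → Ω → ℝ} {c : ℕ → Ω → Fin q → ℂ}
  {z : ℕ → Ω → Fin p × Fin q → ℂ}

/-- The moments of the cross term over the noise, for given clutter. -/
lemma IsSIRVTraining.qform_steerCross_moments (H : IsSIRVTraining μ B τ c z) (hB : B.PosSemidef)
    (d : Fin p × Fin q → ℂ) (n : ℕ) (u : ℕ → Fin q → ℂ) :
    (Integrable (fun ω => qform B (steerCross n u (fun m => z m ω) d)) μ ∧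
      ∫ ω, qform B (steerCross n u (fun m => z m ω) d) ∂μ =
        (∑ i, qform B fun j => d (i, j)) * energy n u) ∧
    Integrable (fun ω => qform B (steerCross n u (fun m => z m ω) d) ^ 2) μ ∧
      ∫ ω, qform B (steerCross n u (fun m => z m ω) d) ^ 2 ∂μ ≤
        q * gaussianFourth * (∑ i, qform B fun j => d (i, j)) ^ 2 * energy n u ^ 2 := by
  obtain ⟨A, rfl⟩ := exists_conjTranspose_mul_self hB
  have hW : ∀ l, ∑ m ∈ Finset.range n, sumSq (kronVec (rowSteer A d l) (u m)) =
      sumSq (rowSteer A d l) * energy n u := by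
    intro l
    simp only [sumSq_kronVec, energy, Finset.mul_sum]
  have M := fun l => H.noise_sum_moments (fun m => kronVec (rowSteer A d l) (u m)) n
  simp only [hW] at M
  simp only [qform_steerCross, ← sum_sumSq_rowSteer]
  have hM4 : 0 ≤ gaussianFourth := integral_nonneg fun x => by positivity
  have hle : ∀ f : Fin q → ℝ, (∑ l, f l) ^ 2 ≤ q * ∑ l, f l ^ 2 := fun f => by
    simpa using sq_sum_le_card_mul_sum_sq (s := Finset.univ) (f := f)
  have hi := (integrable_finsetSum Finset.univ fun l _ => (M l).2.1).const_mul (q : ℝ)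
  refine ⟨⟨integrable_finsetSum _ fun l _ => (M l).1.1, ?_⟩, ?_, ?_⟩
  · rw [integral_finsetSum _ fun l _ => (M l).1.1, Finset.sum_mul]
    exact Finset.sum_congr rfl fun l _ => (M l).1.2
  · refine hi.mono' ((integrable_finsetSum _ fun l _ => (M l).1.1).aestronglyMeasurable.pow 2)
      (Eventually.of_forall fun ω => ?_)
    rw [Real.norm_of_nonneg (by positivity)]
    exact hle _
  · refine (integral_mono_of_nonneg (Eventually.of_forall fun ω => by positivity) hi
      (Eventually.of_forall fun ω => hle _)).trans ?_
    rw [integral_const_mul, integral_finsetSum _ fun l _ => (M l).2.1]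
    calc _ ≤ (q : ℝ) * ∑ l, gaussianFourth * (sumSq (rowSteer A d l) * energy n u) ^ 2 := by
          gcongr with l
          exact (M l).2.2
      _ = q * gaussianFourth * (∑ l, sumSq (rowSteer A d l) ^ 2) * energy n u ^ 2 := by
          simp only [mul_pow, Finset.mul_sum, Finset.sum_mul, mul_assoc]
      _ ≤ _ := by
          have : ∑ l, sumSq (rowSteer A d l) ^ 2 ≤ (∑ l, sumSq (rowSteer A d l)) ^ 2 :=
            Finset.sum_sq_le_sq_sum_of_nonneg fun l _ => sumSq_nonneg _
          gcongr

end LeadTerm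

/-! ### The strong law for the clutter energy. -/

section Energy

variable {Ω : Type*} [MeasurableSpace Ω] {p q : ℕ} {μ : Measure Ω} [IsProbabilityMeasure μ]
  {B : Matrix (Fin q) (Fin q) ℂ} {τ : ℕ → Ω → ℝ} {c : ℕ → Ω → Fin q → ℂ}
  {z : ℕ → Ω → Fin p × Fin q → ℂ}

lemma IsSIRVTraining.integral_sumSq_speckle (H : IsSIRVTraining μ B τ c z) (hB : B.PosSemidef) :
    Integrable (fun ω => sumSq (c 0 ω)) μ ∧ ∫ ω, sumSq (c 0 ω) ∂μ = B.trace.re := by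
  have hc := H.speckle_gaussian 0
  have hcm := H.measurable_speckle 0
  have e1 : ∀ (i : Fin q) ω, (c 0 ω i).re = (star (Pi.single i 1 : Fin q → ℂ) ⬝ᵥ c 0 ω).re := by
    intro k ω; simp [dotProduct, Pi.single_apply, apply_ite]
  have e2 : ∀ (i : Fin q) ω,
      (c 0 ω i).im = (star (Pi.single i Complex.I : Fin q → ℂ) ⬝ᵥ c 0 ω).re := by
    intro k ω; simp [dotProduct, Pi.single_apply, apply_ite]
  have q1 : ∀ i : Fin q, qform B (Pi.single i 1 : Fin q → ℂ) = (B i i).re := by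
    intro i; simp [qform, dotProduct, Pi.single_apply, apply_ite]
  have q2 : ∀ i : Fin q, qform B (Pi.single i Complex.I : Fin q → ℂ) = (B i i).re := by
    intro i
    have : (Pi.single i Complex.I : Fin q → ℂ) = Complex.I • Pi.single i 1 := by
      rw [← Pi.single_smul, smul_eq_mul, mul_one]
    rw [this, qform_smul, q1]; simp
  have i1 := fun i => (hc.memLp_re_apply hcm i (r := 2) (by simp)).integrable_sq
  have i2 := fun i => (hc.memLp_im_apply hcm i (r := 2) (by simp)).integrable_sq
  have e : ∀ ω, sumSq (c 0 ω) = ∑ i, ((c 0 ω i).re ^ 2 + (c 0 ω i).im ^ 2) := fun ω =>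
    Finset.sum_congr rfl fun i _ => by rw [Complex.sq_norm, Complex.normSq_apply]; ring
  simp only [e]
  have i12 : ∀ i, Integrable (fun ω => (c 0 ω i).re ^ 2 + (c 0 ω i).im ^ 2) μ := fun i =>
    (i1 i).add (i2 i)
  refine ⟨integrable_finsetSum _ fun i _ => i12 i, ?_⟩
  rw [integral_finsetSum _ fun i _ => i12 i, Matrix.trace, Complex.re_sum]
  refine Finset.sum_congr rfl fun i _ => ?_
  rw [integral_add (i1 i) (i2 i)]
  simp only [e1, e2]
  rw [hc.integral_re_sq hcm hB, hc.integral_re_sq hcm hB, q1, q2, Matrix.diag_apply]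
  ring

lemma IsSIRVTraining.texture_sq_pos (H : IsSIRVTraining μ B τ c z) : 0 < ∫ ω, τ 0 ω ^ 2 ∂μ := by
  rw [integral_pos_iff_support_of_nonneg (fun ω => by positivity) H.texture_memLp.integrable_sq]
  have hae : ∀ᵐ ω ∂μ, ω ∈ Function.support fun ω => τ 0 ω ^ 2 := by
    filter_upwards [H.texture_pos 0] with ω h
    rw [Function.mem_support]
    positivity
  have h9 := measure_congr (eventuallyEq_univ.2 hae)
  rw [measure_univ] at h9
  exact h9.symm ▸ one_pos

/-- The summands τ²‖c‖² are integrable by independence of texture and speckle, and a finite first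
moment suffices for the strong law. -/
lemma IsSIRVTraining.tendsto_energy (H : IsSIRVTraining μ B τ c z) (hB : B.PosSemidef) :
    ∀ᵐ ω ∂μ, Tendsto (fun n : ℕ => energy n (fun m => (τ m ω : ℂ) • c m ω) / n) atTop
      (𝓝 ((∫ ω, τ 0 ω ^ 2 ∂μ) * B.trace.re)) := by
  have hφ : Measurable fun a : ℝ × (Fin q → ℂ) => a.1 ^ 2 * sumSq a.2 := by
    have := measurable_sumSq (ι := Fin q)
    fun_prop
  have hind : iIndepFun (fun m ω => τ m ω ^ 2 * sumSq (c m ω)) μ :=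
    H.iIndepFun_triple.comp (fun _ x => x.1.1 ^ 2 * sumSq x.1.2) fun _ => hφ.comp measurable_fst
  have hid : ∀ m, IdentDistrib (fun ω => τ m ω ^ 2 * sumSq (c m ω))
      (fun ω => τ 0 ω ^ 2 * sumSq (c 0 ω)) μ μ := fun m =>
    (H.identDistrib m).comp (hφ.comp measurable_fst)
  have hi : IndepFun (fun ω => τ 0 ω ^ 2) (fun ω => sumSq (c 0 ω)) μ :=
    (H.indep_texture_speckle 0).comp (φ := fun x => x ^ 2) (by fun_prop) measurable_sumSq
  have hc := H.integral_sumSq_speckle hB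
  have hI := hi.integrable_mul H.texture_memLp.integrable_sq hc.1
  have hE : ∫ ω, τ 0 ω ^ 2 * sumSq (c 0 ω) ∂μ = (∫ ω, τ 0 ω ^ 2 ∂μ) * B.trace.re := by
    rw [← hc.2]
    exact hi.integral_fun_mul_eq_mul_integral H.texture_memLp.integrable_sq.aestronglyMeasurable
      hc.1.aestronglyMeasurable
  have h := strong_law_ae_real (fun m ω => τ m ω ^ 2 * sumSq (c m ω)) hI
    (fun i j hij => hind.indepFun hij) hid
  filter_upwards [h] with ω hω
  rw [hE] at hω
  refine hω.congr fun n => ?_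
  simp only [energy, sumSq_smul, Complex.norm_real, Real.norm_eq_abs, sq_abs]

end Energy

/-! ### Mean and second moment of the truncated leading term. -/

section Leading

variable {Ω : Type*} [MeasurableSpace Ω] {p q : ℕ} {μ : Measure Ω} [IsProbabilityMeasure μ]
  {B : Matrix (Fin q) (Fin q) ℂ} {τ : ℕ → Ω → ℝ} {c : ℕ → Ω → Fin q → ℂ}
  {z : ℕ → Ω → Fin p × Fin q → ℂ}

/-- The clutter vectors `τ_m c_m`. -/
def clutter (a : ℕ → ℝ × (Fin q → ℂ)) (m : ℕ) : Fin q → ℂ := ((a m).1 : ℂ) • (a m).2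

/-- The leading term of the deficit, cut off outside an event of the clutter. -/
noncomputable def condLead (t2 : ℝ) (B : Matrix (Fin q) (Fin q) ℂ) (d : Fin p × Fin q → ℂ)
    (n : ℕ) (G : Set (ℕ → ℝ × (Fin q → ℂ)))
    (x : (ℕ → ℝ × (Fin q → ℂ)) × (ℕ → Fin p × Fin q → ℂ)) : ℝ :=
  G.indicator (fun a => leadTerm t2 B d n (clutter a) x.2) x.1

lemma measurable_energy (n : ℕ) :
    Measurable fun a : ℕ → ℝ × (Fin q → ℂ) => energy n (clutter a) := by
  have := measurable_sumSq (ι := Fin q)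
  unfold energy clutter
  fun_prop

lemma measurable_condLead (t2 : ℝ) (B : Matrix (Fin q) (Fin q) ℂ) (d : Fin p × Fin q → ℂ)
    (n : ℕ) {G : Set (ℕ → ℝ × (Fin q → ℂ))} (hG : MeasurableSet G) :
    Measurable (condLead t2 B d n G) := by
  have h1 : Measurable fun x : (ℕ → ℝ × (Fin q → ℂ)) × (ℕ → Fin p × Fin q → ℂ) =>
      leadTerm t2 B d n (clutter x.1) x.2 := by
    have h2 : Measurable fun x : (ℕ → ℝ × (Fin q → ℂ)) × (ℕ → Fin p × Fin q → ℂ) =>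
        energy n (clutter x.1) := (measurable_energy n).comp measurable_fst
    have h3 : Measurable fun x : (ℕ → ℝ × (Fin q → ℂ)) × (ℕ → Fin p × Fin q → ℂ) =>
        qform B (steerCross n (clutter x.1) x.2 d) := by
      unfold qform steerCross Matrix.mulVec dotProduct
      simp only [crossVec_apply, clutter, Pi.star_apply, Pi.smul_apply]
      fun_prop
    exact (h3.const_mul t2).div (h2.pow_const 2)
  exact h1.indicator (measurable_fst hG)

lemma condLead_of_mem {t2 : ℝ} {d : Fin p × Fin q → ℂ} {n : ℕ}
    {G : Set (ℕ → ℝ × (Fin q → ℂ))} {a : ℕ → ℝ × (Fin q → ℂ)} (ha : a ∈ G)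
    (ζ : ℕ → Fin p × Fin q → ℂ) :
    condLead t2 B d n G (a, ζ) = leadTerm t2 B d n (clutter a) ζ := Set.indicator_of_mem ha _

lemma condLead_of_notMem {t2 : ℝ} {d : Fin p × Fin q → ℂ} {n : ℕ}
    {G : Set (ℕ → ℝ × (Fin q → ℂ))} {a : ℕ → ℝ × (Fin q → ℂ)} (ha : a ∉ G)
    (ζ : ℕ → Fin p × Fin q → ℂ) : condLead t2 B d n G (a, ζ) = 0 := Set.indicator_of_notMem ha _

lemma condLead_nonneg {t2 : ℝ} (ht2 : 0 ≤ t2) (hB : B.PosSemidef) (d : Fin p × Fin q → ℂ) (n : ℕ)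
    (G : Set (ℕ → ℝ × (Fin q → ℂ)))
    (x : (ℕ → ℝ × (Fin q → ℂ)) × (ℕ → Fin p × Fin q → ℂ)) : 0 ≤ condLead t2 B d n G x :=
  Set.indicator_nonneg (fun _ _ =>
    div_nonneg (mul_nonneg ht2 (qform_nonneg hB _)) (sq_nonneg _)) _

lemma IsSIRVTraining.indepFun_clutter_noise (H : IsSIRVTraining μ B τ c z) :
    IndepFun (fun ω m => (τ m ω, c m ω)) (fun ω m => z m ω) μ :=
  indepFun_sequences H.measurable_clutter H.measurable_noise H.iIndepFun_triple
    H.indep_clutter_noise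

/-- Given the clutter, the quadratic form has mean proportional to the energy and second moment of
order energy², against energy² and energy⁴ in the denominators. On G the energy is at least c₀n,
which makes both bounds uniform. -/
lemma IsSIRVTraining.condLead_moments (H : IsSIRVTraining μ B τ c z) (hB : B.PosSemidef)
    (hB0 : B ≠ 0) {t2 : ℝ} (ht2 : 0 ≤ t2) (d : Fin p × Fin q → ℂ) {c₀ : ℝ} (hc₀ : 0 < c₀)
    {n : ℕ} (hn : n ≠ 0) {G : Set (ℕ → ℝ × (Fin q → ℂ))} (hG : MeasurableSet G)
    (hs : ∀ a ∈ G, ScatterBound B (c₀ * n) n (clutter a)) :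
    Integrable (fun ω => condLead t2 B d n G (fun m => (τ m ω, c m ω), fun m => z m ω)) μ ∧
    ∫ ω, condLead t2 B d n G (fun m => (τ m ω, c m ω), fun m => z m ω) ∂μ =
      t2 * (∑ i, qform B fun j => d (i, j)) * ∫ ω, G.indicator (fun a => (energy n (clutter a))⁻¹)
        (fun m => (τ m ω, c m ω)) ∂μ ∧
    Integrable (fun ω => condLead t2 B d n G (fun m => (τ m ω, c m ω), fun m => z m ω) ^ 2) μ ∧
    ∫ ω, condLead t2 B d n G (fun m => (τ m ω, c m ω), fun m => z m ω) ^ 2 ∂μ ≤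
      t2 ^ 2 * (q * gaussianFourth * (∑ i, qform B fun j => d (i, j)) ^ 2) / (c₀ * n) ^ 2 := by
  set K := ∑ i, qform B fun j => d (i, j) with hK
  have hK0 : 0 ≤ K := Finset.sum_nonneg fun i _ => qform_nonneg hB _
  have hM4 : 0 ≤ gaussianFourth := integral_nonneg fun x => by positivity
  have hn0 : (0 : ℝ) < n := by exact_mod_cast Nat.pos_of_ne_zero hn
  have hU : Measurable fun ω (m : ℕ) => (τ m ω, c m ω) :=
    measurable_pi_lambda _ H.measurable_clutter
  have hZ : Measurable fun ω (m : ℕ) => z m ω := measurable_pi_lambda _ H.measurable_noise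
  have hFm := measurable_condLead t2 B d n hG
  have hF0 := condLead_nonneg ht2 hB d n G
  have hsG : ∀ a ∈ G, c₀ * n ≤ energy n (clutter a) := fun a ha => (hs a ha).le_energy hB0
  have i1 : ∀ a, Integrable (fun ω => condLead t2 B d n G (a, fun m => z m ω)) μ ∧
      ∫ ω, condLead t2 B d n G (a, fun m => z m ω) ∂μ =
        t2 * K * G.indicator (fun a => (energy n (clutter a))⁻¹) a := by
    intro a
    by_cases ha : a ∈ G
    · have hs0 : 0 < energy n (clutter a) := lt_of_lt_of_le (by positivity) (hsG a ha)
      have M := (H.qform_steerCross_moments hB d n (clutter a)).1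
      simp only [condLead_of_mem ha, leadTerm, Set.indicator_of_mem ha]
      refine ⟨(M.1.const_mul t2).div_const _, ?_⟩
      rw [integral_div, integral_const_mul, M.2, ← hK]
      field_simp
    · simp [condLead_of_notMem ha, Set.indicator_of_notMem ha]
  have i2 : ∀ a, Integrable (fun ω => condLead t2 B d n G (a, fun m => z m ω) ^ 2) μ ∧
      ∫ ω, condLead t2 B d n G (a, fun m => z m ω) ^ 2 ∂μ ≤
        t2 ^ 2 * (q * gaussianFourth * K ^ 2) / (c₀ * n) ^ 2 := by
    intro a
    by_cases ha : a ∈ G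
    · have hs0 : 0 < energy n (clutter a) := lt_of_lt_of_le (by positivity) (hsG a ha)
      have M := (H.qform_steerCross_moments hB d n (clutter a)).2
      simp only [condLead_of_mem ha, leadTerm, div_pow, mul_pow]
      refine ⟨(M.1.const_mul (t2 ^ 2)).div_const _, ?_⟩
      rw [integral_div, integral_const_mul]
      calc _ ≤ t2 ^ 2 * (q * gaussianFourth * K ^ 2 * energy n (clutter a) ^ 2) /
            (energy n (clutter a) ^ 2) ^ 2 := by gcongr; exact M.2
        _ = t2 ^ 2 * (q * gaussianFourth * K ^ 2) / energy n (clutter a) ^ 2 := by field_simp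
        _ ≤ t2 ^ 2 * (q * gaussianFourth * K ^ 2) / (c₀ * n) ^ 2 := by
            gcongr; exact hsG a ha
        _ = _ := by rw [mul_pow]
    · simp only [condLead_of_notMem ha]
      refine ⟨by simp, ?_⟩
      simp only [ne_eq, OfNat.ofNat_ne_zero, not_false_eq_true, zero_pow, integral_zero]
      positivity
  have hb : ∀ a, ∫ ω, condLead t2 B d n G (a, fun m => z m ω) ∂μ ≤ t2 * K * (c₀ * n)⁻¹ := by
    intro a
    rw [(i1 a).2]
    gcongr
    by_cases ha : a ∈ G
    · rw [Set.indicator_of_mem ha]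
      exact inv_anti₀ (by positivity) (hsG a ha)
    · rw [Set.indicator_of_notMem ha]
      positivity
  have R1 := integral_comp_of_indepFun hU hZ H.indepFun_clutter_noise hFm hF0
    (fun a => (i1 a).1) hb
  have R2 := integral_comp_of_indepFun hU hZ H.indepFun_clutter_noise (hFm.pow_const 2)
    (fun x => sq_nonneg _) (fun a => (i2 a).1) fun a => (i2 a).2
  refine ⟨R1.1, ?_, R2.1, R2.2.2⟩
  rw [R1.2.1]
  simp only [(i1 _).2]
  rw [integral_const_mul]

lemma IsSIRVTraining.tendsto_integral_inv_energy (H : IsSIRVTraining μ B τ c z)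
    (hB : B.PosSemidef) (hB0 : B ≠ 0) {c₀ : ℝ} (hc₀ : 0 < c₀)
    {G : ℕ → Set (ℕ → ℝ × (Fin q → ℂ))} (hG : ∀ n, MeasurableSet (G n))
    (hs : ∀ n, ∀ a ∈ G n, ScatterBound B (c₀ * n) n (clutter a))
    (hP : Tendsto (fun n : ℕ => μ.real {ω | (fun m => (τ m ω, c m ω)) ∉ G n}) atTop (𝓝 0)) :
    Tendsto (fun n : ℕ => (n : ℝ) * ∫ ω, (G n).indicator (fun a => (energy n (clutter a))⁻¹)
        (fun m => (τ m ω, c m ω)) ∂μ) atTop (𝓝 ((∫ ω, τ 0 ω ^ 2 ∂μ) * B.trace.re)⁻¹) := by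
  set e := (∫ ω, τ 0 ω ^ 2 ∂μ) * B.trace.re with he
  have he0 : 0 < e := mul_pos H.texture_sq_pos (trace_re_pos hB hB0)
  -- Level c₀⁻¹ leaves the truncated inverse unchanged on G; level e⁻¹ leaves its limit unchanged.
  set C := max c₀⁻¹ e⁻¹ with hC
  have hC0 : 0 < C := lt_max_of_lt_left (by positivity)
  have hU : Measurable fun ω (m : ℕ) => (τ m ω, c m ω) :=
    measurable_pi_lambda _ H.measurable_clutter
  set s : ℕ → Ω → ℝ := fun n ω => energy n (clutter fun m => (τ m ω, c m ω)) with hs_def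
  have hs0 : ∀ n ω, 0 ≤ s n ω := fun n ω => energy_nonneg _ _
  have hsm : ∀ n, Measurable (s n) := fun n => (measurable_energy n).comp hU
  have hYm : ∀ n : ℕ, Measurable fun ω => min ((s n ω / n)⁻¹) C := fun n =>
    ((hsm n).div_const _).inv.min measurable_const
  have hYb : ∀ (n : ℕ) ω, |min ((s n ω / n)⁻¹) C| ≤ C := fun n ω => by
    rw [abs_of_nonneg (le_min (inv_nonneg.2 (div_nonneg (hs0 n ω) n.cast_nonneg)) hC0.le)]
    exact min_le_right _ _
  have hYi : ∀ n : ℕ, Integrable (fun ω => min ((s n ω / n)⁻¹) C) μ := fun n =>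
    Integrable.of_bound (hYm n).aestronglyMeasurable C (Eventually.of_forall (hYb n))
  have hlim : Tendsto (fun n : ℕ => ∫ ω, min ((s n ω / n)⁻¹) C ∂μ) atTop (𝓝 e⁻¹) := by
    have h1 := tendsto_integral_of_dominated_convergence (μ := μ) (f := fun _ => e⁻¹)
      (F := fun (n : ℕ) ω => min ((s n ω / n)⁻¹) C) (fun _ => C)
      (fun n => (hYm n).aestronglyMeasurable) (integrable_const C)
      (fun n => Eventually.of_forall (hYb n)) ?_
    · simpa using h1
    · filter_upwards [H.tendsto_energy hB] with ω hω
      have h2 := (hω.inv₀ he0.ne').min (tendsto_const_nhds (x := C))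
      rwa [min_eq_left (le_max_right _ _)] at h2
  have hGm : ∀ n, MeasurableSet {ω | (fun m => (τ m ω, c m ω)) ∉ G n} := fun n =>
    hU (hG n).compl
  have hdiff : ∀ n : ℕ, n ≠ 0 →
      |(n : ℝ) * ∫ ω, (G n).indicator (fun a => (energy n (clutter a))⁻¹)
        (fun m => (τ m ω, c m ω)) ∂μ - ∫ ω, min ((s n ω / n)⁻¹) C ∂μ| ≤
      C * μ.real {ω | (fun m => (τ m ω, c m ω)) ∉ G n} := by
    intro n hn
    have hn0 : (0 : ℝ) < n := by exact_mod_cast Nat.pos_of_ne_zero hn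
    -- The two integrands agree on G, and off G the truncated one is at most C, so the difference
    -- costs C times the probability of the complement.
    have h3 : ∀ ω, (n : ℝ) * (G n).indicator (fun a => (energy n (clutter a))⁻¹)
        (fun m => (τ m ω, c m ω)) = min ((s n ω / n)⁻¹) C -
        {ω | (fun m => (τ m ω, c m ω)) ∉ G n}.indicator (fun ω => min ((s n ω / n)⁻¹) C) ω := by
      intro ω
      by_cases ha : (fun m => (τ m ω, c m ω)) ∈ G n
      · have h4 : c₀ * n ≤ s n ω := (hs n _ ha).le_energy hB0
        have h5 : (s n ω / n)⁻¹ ≤ C := by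
          refine le_trans (inv_anti₀ hc₀ ?_) (le_max_left _ _)
          rwa [le_div_iff₀ hn0]
        rw [Set.indicator_of_mem ha, Set.indicator_of_notMem (by simpa using ha),
          min_eq_left h5, sub_zero, inv_div, div_eq_mul_inv]
      · rw [Set.indicator_of_notMem ha, Set.indicator_of_mem (by simpa using ha), sub_self,
          mul_zero]
    have hI := (hYi n).indicator (hGm n)
    rw [← integral_const_mul]
    simp only [h3]
    rw [integral_sub (hYi n) hI, sub_sub_cancel_left, abs_neg]
    refine (abs_integral_le_integral_abs).trans ?_
    calc _ ≤ ∫ ω, {ω | (fun m => (τ m ω, c m ω)) ∉ G n}.indicator (fun _ => C) ω ∂μ := by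
          refine integral_mono hI.abs ((integrable_const C).indicator (hGm n)) fun ω => ?_
          by_cases ha : ω ∈ {ω | (fun m => (τ m ω, c m ω)) ∉ G n}
          · simp only [Set.indicator_of_mem ha]
            exact hYb n ω
          · simp only [Set.indicator_of_notMem ha, abs_zero, le_refl]
      _ = _ := by
          rw [integral_indicator_const _ (hGm n), smul_eq_mul, mul_comm]
  have h6 : Tendsto (fun n : ℕ => (n : ℝ) * ∫ ω, (G n).indicator
      (fun a => (energy n (clutter a))⁻¹) (fun m => (τ m ω, c m ω)) ∂μ -
        ∫ ω, min ((s n ω / n)⁻¹) C ∂μ) atTop (𝓝 0) := by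
    refine squeeze_zero_norm' ?_ (by simpa using hP.const_mul C)
    filter_upwards [eventually_ne_atTop 0] with n hn
    exact hdiff n hn
  simpa using h6.add hlim

end Leading

/-! ### Range and measurability of the SINR loss. -/

section Loss

variable {p q r : ℕ}

lemma sinrLoss_mem_Icc {h : Fin p → ℂ} {B : Matrix (Fin q) (Fin q) ℂ} (hB : B.PosSemidef)
    {t2 σ : ℝ} (ht2 : 0 ≤ t2) (hσ : 0 < σ) {α : ℂ} (hα : α ≠ 0) {d : Fin p × Fin q → ℂ}
    (hd : sumSq d = 1) (hdA : ∀ j, ∑ i, star (h i) * d (i, j) = 0)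
    {UA : Matrix (Fin p) (Fin 1) ℂ} {UB : Matrix (Fin q) (Fin r) ℂ}
    (hUA : UAᴴ * UA = 1) (hUB : UBᴴ * UB = 1) :
    sinrLoss α (clutterNoiseCov t2 h B σ) d (kronFilter UA UB) ∈ Set.Icc 0 1 := by
  rw [sinrLoss_kronFilter hB hα hd hdA hσ ht2 hUA hUB]
  have hg0 := sumSq_nonneg (kronFilter UA UB *ᵥ d)
  have hg1 : sumSq (kronFilter UA UB *ᵥ d) ≤ 1 := hd ▸ sumSq_kronFilter_le hUA hUB d
  set g := sumSq (kronFilter UA UB *ᵥ d)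
  have hb : 0 ≤ t2 / σ ^ 2 * (‖star h ⬝ᵥ UA.col 0‖ ^ 2 *
      qform B ((1 - UB * UBᴴ) *ᵥ contract (UA.col 0) d)) := by
    have := qform_nonneg hB ((1 - UB * UBᴴ) *ᵥ contract (UA.col 0) d)
    positivity
  refine ⟨by positivity, div_le_one_of_le₀ ?_ (by positivity)⟩
  nlinarith

lemma aemeasurable_sinrLoss {Ω : Type*} [MeasurableSpace Ω] {μ : Measure Ω} (α : ℂ)
    (Sig : Matrix (Fin p × Fin q) (Fin p × Fin q) ℂ) (d : Fin p × Fin q → ℂ)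
    {UA : Ω → Matrix (Fin p) (Fin 1) ℂ} {UB : Ω → Matrix (Fin q) (Fin r) ℂ}
    (hUA : ∀ i k, AEMeasurable (fun ω => UA ω i k) μ)
    (hUB : ∀ j k, AEMeasurable (fun ω => UB ω j k) μ) :
    AEMeasurable (fun ω => sinrLoss α Sig d (kronFilter (UA ω) (UB ω))) μ := by
  have hw : ∀ x, AEMeasurable (fun ω => (kronFilter (UA ω) (UB ω) *ᵥ d) x) μ := by
    intro x
    simp only [kronFilter, Matrix.mulVec, dotProduct, kroneckerMap_apply, Matrix.sub_apply,
      Matrix.mul_apply, conjTranspose_apply]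
    fun_prop
  have hq : ∀ M : (Fin p × Fin q → ℂ) → ℝ, Measurable M →
      AEMeasurable (fun ω => M (kronFilter (UA ω) (UB ω) *ᵥ d)) μ := fun M hM =>
    hM.comp_aemeasurable (aemeasurable_pi_lambda _ hw)
  refine (hq (sinr α Sig d) ?_).div_const _
  unfold sinr Matrix.mulVec dotProduct
  simp only [Pi.star_apply]
  fun_prop

end Loss

/-! ### From pointwise bounds to the expected deficit. -/

section Expectation

variable {p q r : ℕ} {Ω : Type*} [MeasurableSpace Ω] {μ : Measure Ω} [IsProbabilityMeasure μ]
  {h : Fin p → ℂ} {B : Matrix (Fin q) (Fin q) ℂ} {τ : ℕ → Ω → ℝ} {c : ℕ → Ω → Fin q → ℂ}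
  {z : ℕ → Ω → Fin p × Fin q → ℂ}

lemma sample_eq (h : Fin p → ℂ) (σ t : ℝ) (c : Fin q → ℂ) (z : Fin p × Fin q → ℂ) :
    sample h σ t c z = kronVec h ((t : ℂ) • c) + (σ : ℂ) • z := by
  ext x
  simp only [sample, kronVec, Pi.add_apply, Pi.smul_apply, smul_eq_mul]
  ring

/-- A bound that is known for small fluctuations extends to all of them. -/
lemma deficit_bounds_of_imp {X L C σ s Φ n : ℝ} (hX0 : 0 ≤ X) (hX1 : X ≤ 1) (hL : 0 ≤ L)
    (hC : 0 ≤ C) (hσ : 0 < σ) (hs : 0 ≤ s) (hsσ : s ^ 2 = σ) (hΦ : 0 ≤ Φ) (hn : 0 < n)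
    (h : σ ^ 2 * Φ ≤ s ^ 2 * n ^ 2 →
      X ≤ L + C * (s * (Φ / n ^ 2)) ∧ L - L ^ 2 - C * (s * (Φ / n ^ 2)) ≤ X) :
    X ≤ L + (C * s + σ) / n ^ 2 * Φ ∧ L - L ^ 2 - (C * s + σ) / n ^ 2 * Φ ≤ X := by
  have hsplit : (C * s + σ) / n ^ 2 * Φ = C * (s * (Φ / n ^ 2)) + σ * Φ / n ^ 2 := by ring
  have h1 : 0 ≤ C * (s * (Φ / n ^ 2)) := by positivity
  have h2 : 0 ≤ σ * Φ / n ^ 2 := by positivity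
  rw [hsplit]
  by_cases hfl : σ ^ 2 * Φ ≤ s ^ 2 * n ^ 2
  · obtain ⟨h3, h4⟩ := h hfl
    exact ⟨by linarith, by linarith⟩
  -- Large fluctuations make the extra error at least 1, so both inequalities follow from 0 ≤ X ≤ 1
  -- and L - L² ≤ 1/4.
  · have h3 : 1 ≤ σ * Φ / n ^ 2 := by
      rw [hsσ, not_le] at hfl
      rw [le_div_iff₀ (by positivity), one_mul]
      have : σ * n ^ 2 ≤ σ * (σ * Φ) := by linarith
      exact le_of_mul_le_mul_left this hσ
    exact ⟨by linarith, by linarith [sq_nonneg (L - 1 / 2)]⟩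

lemma IsSIRVTraining.ae_deficit_bounds (H : IsSIRVTraining μ B τ c z) (hh : h ≠ 0)
    (hB : B.PosSemidef) (hB0 : B ≠ 0) {α : ℂ} (hα : α ≠ 0) {d : Fin p × Fin q → ℂ}
    (hd : sumSq d = 1) (hdA : ∀ j, ∑ i, star (h i) * d (i, j) = 0) (hr : r ≤ B.rank)
    (hdB : r = 0 ∨ ∀ i, B *ᵥ (fun j => d (i, j)) = 0) {t2 : ℝ} (ht2 : 0 ≤ t2)
    {c₀ : ℝ} (hc₀ : 0 < c₀) {G : ℕ → Set (ℕ → ℝ × (Fin q → ℂ))}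
    (hs : ∀ n, ∀ a ∈ G n, ScatterBound B (c₀ * n) n (clutter a)) :
    ∃ C σ₀ : ℝ, 0 < C ∧ 0 < σ₀ ∧ ∀ n : ℕ, n ≠ 0 → ∀ σ : ℝ, 0 < σ → σ ≤ σ₀ →
      ∀ (UA : Ω → Matrix (Fin p) (Fin 1) ℂ) (UB : Ω → Matrix (Fin q) (Fin r) ℂ),
      (∀ᵐ ω ∂μ, IsPrincipalComponents (spatialAverage
        (sampleCov n fun m => sample h σ (τ m ω) (c m ω) (z m ω))) (UA ω)) →
      (∀ᵐ ω ∂μ, IsPrincipalComponents (temporalAverage (UA ω * (UA ω)ᴴ)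
        (sampleCov n fun m => sample h σ (τ m ω) (c m ω) (z m ω))) (UB ω)) →
      ∀ᵐ ω ∂μ,
        sinrLoss α (clutterNoiseCov t2 h B σ) d (kronFilter (UA ω) (UB ω)) ∈ Set.Icc 0 1 ∧
        1 - sinrLoss α (clutterNoiseCov t2 h B σ) d (kronFilter (UA ω) (UB ω)) ≤
          condLead t2 B d n (G n) (fun m => (τ m ω, c m ω), fun m => z m ω) +
          (C * √σ + σ) / n ^ 2 * fluct n (fun m => (τ m ω : ℂ) • c m ω) (fun m => z m ω) +
          {ω | (fun m => (τ m ω, c m ω)) ∉ G n}.indicator (fun _ => 1) ω ∧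
        condLead t2 B d n (G n) (fun m => (τ m ω, c m ω), fun m => z m ω) -
          condLead t2 B d n (G n) (fun m => (τ m ω, c m ω), fun m => z m ω) ^ 2 -
          (C * √σ + σ) / n ^ 2 * fluct n (fun m => (τ m ω : ℂ) • c m ω) (fun m => z m ω) ≤
        1 - sinrLoss α (clutterNoiseCov t2 h B σ) d (kronFilter (UA ω) (UB ω)) := by
  obtain ⟨C, δ₀, hC, hδ₀, hmain⟩ := sinrLoss_bounds hh hB hB0 hα hd hdA hr hdB ht2 hc₀
  -- The deterministic bounds are used with δ = √σ; this range of σ ensures σ ≤ √σ ≤ δ₀.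
  refine ⟨C, min 1 (δ₀ ^ 2), hC, by positivity, ?_⟩
  intro n hn σ hσ hσ₀ UA UB hUA hUB
  have hn0 : (0 : ℝ) < n := by exact_mod_cast Nat.pos_of_ne_zero hn
  have hσ1 : σ ≤ 1 := hσ₀.trans (min_le_left _ _)
  have hδδ₀ : √σ ≤ δ₀ := Real.sqrt_le_iff.2 ⟨hδ₀.le, hσ₀.trans (min_le_right _ _)⟩
  have hσδ : σ ≤ √σ := Real.le_sqrt_of_sq_le (by nlinarith)
  have hrow : ∀ᵐ ω ∂μ, r = 0 ∨ ∀ i, ∀ m < n,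
      star (fun j => d (i, j)) ⬝ᵥ ((τ m ω : ℂ) • c m ω) = 0 := by
    rcases hdB with h0 | h0
    · exact Eventually.of_forall fun ω => Or.inl h0
    · have : ∀ᵐ ω ∂μ, ∀ i m, star (fun j => d (i, j)) ⬝ᵥ c m ω = 0 :=
        ae_all_iff.2 fun i => ae_all_iff.2 fun m => H.ae_star_dotProduct_eq_zero (h0 i) m
      filter_upwards [this] with ω hω
      exact Or.inr fun i m _ => by rw [dotProduct_smul, hω, smul_zero]
  filter_upwards [hUA, hUB, hrow] with ω h1 h2 h3
  have h4 := sinrLoss_mem_Icc hB ht2 hσ hα hd hdA h1.1 h2.1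
  refine ⟨h4, ?_⟩
  have hX0 := sub_nonneg.2 h4.2
  have hX1 := sub_le_self (1 : ℝ) h4.1
  have hΦ0 := fluct_nonneg n (fun m => (τ m ω : ℂ) • c m ω) (fun m => z m ω)
  by_cases hω : (fun m => (τ m ω, c m ω)) ∈ G n
  · have hω' : ω ∉ {ω | (fun m => (τ m ω, c m ω)) ∉ G n} := not_not.2 hω
    rw [Set.indicator_of_notMem hω', add_zero]
    refine deficit_bounds_of_imp hX0 hX1 (condLead_nonneg ht2 hB d n (G n) _) hC.le hσ
      (Real.sqrt_nonneg σ) (Real.sq_sqrt hσ.le) hΦ0 hn0 fun hfl => ?_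
    rw [condLead_of_mem hω]
    simp only [sample_eq] at h1 h2
    exact hmain n hn σ (√σ) hσ hσδ hδδ₀ _ _ _ _ h1 h2 (hs n _ hω) h3 hfl
  · have hω' : ω ∈ {ω | (fun m => (τ m ω, c m ω)) ∉ G n} := hω
    have hcoef : 0 ≤ (C * √σ + σ) / n ^ 2 *
        fluct n (fun m => (τ m ω : ℂ) • c m ω) (fun m => z m ω) :=
      mul_nonneg (by positivity) hΦ0
    rw [Set.indicator_of_mem hω', condLead_of_notMem hω]
    refine ⟨by linarith, ?_⟩
    rw [zero_pow two_ne_zero]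
    linarith

lemma integral_deficit_bounds {ρ L Φ : Ω → ℝ} {E : Set Ω} {a : ℝ} (hρ : AEMeasurable ρ μ)
    (hL : Integrable L μ) (hL2 : Integrable (fun ω => L ω ^ 2) μ) (hΦ : Integrable Φ μ)
    (hE : MeasurableSet E)
    (hpt : ∀ᵐ ω ∂μ, ρ ω ∈ Set.Icc 0 1 ∧
      1 - ρ ω ≤ L ω + a * Φ ω + E.indicator (fun _ => 1) ω ∧ L ω - L ω ^ 2 - a * Φ ω ≤ 1 - ρ ω) :
    1 - ∫ ω, ρ ω ∂μ ≤ ∫ ω, L ω ∂μ + a * ∫ ω, Φ ω ∂μ + μ.real E ∧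
    ∫ ω, L ω ∂μ - ∫ ω, L ω ^ 2 ∂μ - a * ∫ ω, Φ ω ∂μ ≤ 1 - ∫ ω, ρ ω ∂μ := by
  have iρ : Integrable ρ μ := by
    refine Integrable.of_bound hρ.aestronglyMeasurable 1 ?_
    filter_upwards [hpt] with ω hω
    rw [Real.norm_of_nonneg hω.1.1]
    exact hω.1.2
  have iΦ : Integrable (fun ω => a * Φ ω) μ := hΦ.const_mul _
  have iE : Integrable (E.indicator fun _ => (1 : ℝ)) μ := (integrable_const 1).indicator hE
  have i1ρ : Integrable (fun ω => 1 - ρ ω) μ := (integrable_const 1).sub iρ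
  have e1ρ : ∫ ω, (1 - ρ ω) ∂μ = 1 - ∫ ω, ρ ω ∂μ := by
    rw [integral_sub (integrable_const 1) iρ]; simp
  have eE : ∫ ω, E.indicator (fun _ => (1 : ℝ)) ω ∂μ = μ.real E := by
    rw [integral_indicator_const _ hE]; simp
  have iA : Integrable (fun ω => L ω + a * Φ ω) μ := hL.add iΦ
  have iD : Integrable (fun ω => L ω - L ω ^ 2) μ := hL.sub hL2
  rw [← e1ρ, ← eE, ← integral_const_mul, ← integral_add hL iΦ, ← integral_add iA iE,
    ← integral_sub hL hL2, ← integral_sub iD iΦ]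
  exact ⟨integral_mono_ae i1ρ (iA.add iE) (hpt.mono fun ω hω => hω.2.1),
    integral_mono_ae (iD.sub iΦ) i1ρ (hpt.mono fun ω hω => hω.2.2)⟩

/-- The expected deficit is the mean of the leading term, up to errors that vanish faster
than `1 / n`. -/
lemma IsSIRVTraining.expected_deficit_bounds (H : IsSIRVTraining μ B τ c z) (hh : h ≠ 0)
    (hB : B.PosSemidef) (hB0 : B ≠ 0) {α : ℂ} (hα : α ≠ 0) {d : Fin p × Fin q → ℂ}
    (hd : sumSq d = 1) (hdA : ∀ j, ∑ i, star (h i) * d (i, j) = 0) (hr : r ≤ B.rank)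
    (hdB : r = 0 ∨ ∀ i, B *ᵥ (fun j => d (i, j)) = 0) {t2 : ℝ} (ht2 : 0 ≤ t2)
    {c₀ : ℝ} (hc₀ : 0 < c₀) {G : ℕ → Set (ℕ → ℝ × (Fin q → ℂ))} (hG : ∀ n, MeasurableSet (G n))
    (hs : ∀ n, ∀ a ∈ G n, ScatterBound B (c₀ * n) n (clutter a)) :
    ∃ C K σ₀ : ℝ, 0 < σ₀ ∧ ∀ n : ℕ, n ≠ 0 → ∀ σ : ℝ, 0 < σ → σ ≤ σ₀ →
      ∀ (UA : Ω → Matrix (Fin p) (Fin 1) ℂ) (UB : Ω → Matrix (Fin q) (Fin r) ℂ),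
      (∀ i k, AEMeasurable (fun ω => UA ω i k) μ) → (∀ j k, AEMeasurable (fun ω => UB ω j k) μ) →
      (∀ᵐ ω ∂μ, IsPrincipalComponents (spatialAverage
        (sampleCov n fun m => sample h σ (τ m ω) (c m ω) (z m ω))) (UA ω)) →
      (∀ᵐ ω ∂μ, IsPrincipalComponents (temporalAverage (UA ω * (UA ω)ᴴ)
        (sampleCov n fun m => sample h σ (τ m ω) (c m ω) (z m ω))) (UB ω)) →
      n * (1 - ∫ ω, sinrLoss α (clutterNoiseCov t2 h B σ) d (kronFilter (UA ω) (UB ω)) ∂μ) ≤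
        t2 * (∑ i, qform B fun j => d (i, j)) * (n * ∫ ω, (G n).indicator
          (fun a => (energy n (clutter a))⁻¹) (fun m => (τ m ω, c m ω)) ∂μ) +
        n * μ.real {ω | (fun m => (τ m ω, c m ω)) ∉ G n} + (C * √σ + σ) * K ∧
      t2 * (∑ i, qform B fun j => d (i, j)) * (n * ∫ ω, (G n).indicator
          (fun a => (energy n (clutter a))⁻¹) (fun m => (τ m ω, c m ω)) ∂μ) -
        C / n - (C * √σ + σ) * K ≤
      n * (1 - ∫ ω, sinrLoss α (clutterNoiseCov t2 h B σ) d (kronFilter (UA ω) (UB ω)) ∂μ) := by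
  obtain ⟨C, σ₀, hC, hσ₀, hmain⟩ := H.ae_deficit_bounds hh hB hB0 hα hd hdA hr hdB ht2 hc₀ hs
  obtain ⟨K, hK⟩ := H.fluct_moment
  set Q := t2 ^ 2 * (q * gaussianFourth * (∑ i, qform B fun j => d (i, j)) ^ 2) / c₀ ^ 2 with hQ
  refine ⟨max C Q, K, σ₀, hσ₀, ?_⟩
  intro n hn σ hσ hσσ₀ UA UB hUAm hUBm hUA hUB
  have hn0 : (0 : ℝ) < n := by exact_mod_cast Nat.pos_of_ne_zero hn
  have hpt := hmain n hn σ hσ hσσ₀ UA UB hUA hUB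
  have hM := H.condLead_moments hB hB0 ht2 d hc₀ hn (hG n) (hs n)
  have hEm : MeasurableSet {ω | (fun m => (τ m ω, c m ω)) ∉ G n} :=
    (measurable_pi_lambda _ H.measurable_clutter) (hG n).compl
  obtain ⟨up, lo⟩ := integral_deficit_bounds
    (aemeasurable_sinrLoss α (clutterNoiseCov t2 h B σ) d hUAm hUBm) hM.1 hM.2.2.1 (hK n).1 hEm hpt
  have hK0 : 0 ≤ K := by
    have h1 := (hK n).2 ▸ integral_nonneg (μ := μ) fun ω =>
      fluct_nonneg n (fun m => (τ m ω : ℂ) • c m ω) (fun m => z m ω)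
    exact nonneg_of_mul_nonneg_right h1 hn0
  have hL2 := hM.2.2.2
  rw [hM.2.1, (hK n).2] at up lo
  generalize ∫ ω, condLead t2 B d n (G n) (fun m => (τ m ω, c m ω), fun m => z m ω) ^ 2 ∂μ = L2
    at lo hL2
  generalize ∫ ω, sinrLoss α (clutterNoiseCov t2 h B σ) d (kronFilter (UA ω) (UB ω)) ∂μ = R
    at up lo ⊢
  generalize ∫ ω, (G n).indicator (fun a => (energy n (clutter a))⁻¹)
    (fun m => (τ m ω, c m ω)) ∂μ = I at up lo ⊢
  generalize μ.real {ω | (fun m => (τ m ω, c m ω)) ∉ G n} = P at up ⊢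
  set J := ∑ i, qform B fun j => d (i, j)
  have hCC : (C * √σ + σ) * K ≤ (max C Q * √σ + σ) * K := by
    gcongr
    exact le_max_left _ _
  -- The mean fluctuation nK exactly compensates 1/n² and the scaling by n, leaving an error that
  -- depends on σ alone and so permits a joint limit.
  have e1 : (n : ℝ) * ((C * √σ + σ) / n ^ 2 * (n * K)) = (C * √σ + σ) * K := by field_simp
  have e2 : (n : ℝ) * L2 ≤ max C Q / n := by
    calc (n : ℝ) * L2 ≤ n * (t2 ^ 2 * (q * gaussianFourth * J ^ 2) / (c₀ * n) ^ 2) := by gcongr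
      _ = Q / n := by rw [hQ]; field_simp
      _ ≤ _ := by gcongr; exact le_max_right _ _
  have h7 := mul_le_mul_of_nonneg_left up hn0.le
  have h8 := mul_le_mul_of_nonneg_left lo hn0.le
  rw [mul_add, mul_add, e1] at h7
  rw [mul_sub, mul_sub, e1] at h8
  have e3 : (n : ℝ) * (t2 * J * I) = t2 * J * (n * I) := by ring
  rw [e3] at h7 h8
  exact ⟨by linarith, by linarith⟩

end Expectation

end KronSTAP

theorem mainTheorem3 {p q r : ℕ} {Ω : Type*} [MeasurableSpace Ω] (μ : Measure Ω)
    [IsProbabilityMeasure μ]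
    (h : Fin p → ℂ) (hh : h ≠ 0)
    (B : Matrix (Fin q) (Fin q) ℂ) (hB : B.PosSemidef) (hB0 : B ≠ 0)
    (τ : ℕ → Ω → ℝ) (c : ℕ → Ω → Fin q → ℂ) (z : ℕ → Ω → Fin p × Fin q → ℂ)
    (hmodel : KronSTAP.IsSIRVTraining μ B τ c z)
    -- target amplitude and unit steering vector, orthogonal to the clutter subspace of each stage
    (α : ℂ) (hα : α ≠ 0)
    (d : Fin p × Fin q → ℂ) (hd : star d ⬝ᵥ d = 1)
    (hdA : ∀ j, ∑ i, star (h i) * d (i, j) = 0)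
    (hr : r ≤ B.rank) (hdB : r = 0 ∨ ∀ i, B *ᵥ (fun j => d (i, j)) = 0)
    -- the sample covariance matrix of `n` training samples with noise variance `σ²`
    (S : ℕ → ℝ → Ω → Matrix (Fin p × Fin q) (Fin p × Fin q) ℂ)
    (hS : ∀ n σ ω, S n σ ω =
      KronSTAP.sampleCov n (fun m => KronSTAP.sample h σ (τ m ω) (c m ω) (z m ω)))
    -- the estimated spatial subspace: the rank-one truncation of `(1/q) ∑_i S(i,i)`
    (UA : ℕ → ℝ → Ω → Matrix (Fin p) (Fin 1) ℂ)
    (hUA_meas : ∀ n σ i k, AEMeasurable (fun ω => UA n σ ω i k) μ)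
    (hUA : ∀ n σ, 1 ≤ n → 0 < σ → ∀ᵐ ω ∂μ,
      KronSTAP.IsPrincipalComponents (KronSTAP.spatialAverage (S n σ ω)) (UA n σ ω))
    -- the estimated temporal subspace of rank `r`, given the spatial one
    (UB : ℕ → ℝ → Ω → Matrix (Fin q) (Fin r) ℂ)
    (hUB_meas : ∀ n σ j k, AEMeasurable (fun ω => UB n σ ω j k) μ)
    (hUB : ∀ n σ, 1 ≤ n → 0 < σ → ∀ᵐ ω ∂μ,
      KronSTAP.IsPrincipalComponents
        (KronSTAP.temporalAverage (UA n σ ω * (UA n σ ω)ᴴ) (S n σ ω)) (UB n σ ω))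
    -- the expected SINR loss
    (Eρ : ℕ → ℝ → ℝ)
    (hEρ : ∀ n σ, Eρ n σ = ∫ ω, KronSTAP.sinrLoss α
      (KronSTAP.clutterNoiseCov (∫ ω', τ 0 ω' ^ 2 ∂μ) h B σ) d
      (KronSTAP.kronFilter (UA n σ ω) (UB n σ ω)) ∂μ) :
    -- `E[ρ] = 1 - κ / n + o(1 / n)` for large `n` and small `σ`
    Tendsto (fun x : ℕ × ℝ => (x.1 : ℝ) * (1 - Eρ x.1 x.2)) (atTop ×ˢ 𝓝[>] 0)
      (𝓝 (KronSTAP.alignment B d)) ∧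
    -- hence `E[ρ] ≥ 1 - 1 / n` up to `o(1 / n)`
    (∀ ε : ℝ, 0 < ε → ∀ᶠ x : ℕ × ℝ in atTop ×ˢ 𝓝[>] 0, 1 - (1 + ε) / x.1 ≤ Eρ x.1 x.2) ∧
    -- `κ ≤ 1`, with equality exactly for worst-case temporal correlations
    KronSTAP.alignment B d ≤ 1 ∧
    (KronSTAP.alignment B d = 1 ↔ ∃ (a : Fin p → ℂ) (b : Fin q → ℂ), star b ⬝ᵥ b = 1 ∧
      d = KronSTAP.kronVec a b ∧ B = B.trace • vecMulVec b (star b)) ∧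
    -- the worst case is the same for every temporal rank
    (∀ s : ℕ, 1 ≤ s → s ≤ q →
      IsLUB {κ : ℝ | ∃ (B' : Matrix (Fin q) (Fin q) ℂ) (d' : Fin p × Fin q → ℂ),
        B'.PosSemidef ∧ B'.rank = s ∧ star d' ⬝ᵥ d' = 1 ∧
        (∀ j, ∑ i, star (h i) * d' (i, j) = 0) ∧ κ = KronSTAP.alignment B' d'} 1) := by
  have hd1 : KronSTAP.sumSq d = 1 := by rw [KronSTAP.sumSq_eq_re, hd, Complex.one_re]
  have hκ1 := KronSTAP.alignment_le_one hB hB0 hd1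
  have ht2 := hmodel.texture_sq_pos
  have htr := KronSTAP.trace_re_pos hB hB0
  obtain ⟨c₀, G, hc₀, hG, hs, hP⟩ := hmodel.exists_scatterEvent hB
  -- Obtained by multiplying the limit of n times this probability by 1/n.
  have hP' : Tendsto (fun n : ℕ => μ.real {ω | (fun m => (τ m ω, c m ω)) ∉ G n}) atTop (𝓝 0) := by
    have h1 := hP.mul tendsto_inv_atTop_nhds_zero_nat
    rw [mul_zero] at h1
    refine h1.congr' ?_
    filter_upwards [eventually_ne_atTop 0] with n hn
    have : (n : ℝ) ≠ 0 := Nat.cast_ne_zero.2 hn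
    field_simp
  have hI := hmodel.tendsto_integral_inv_energy hB hB0 hc₀ hG hs hP'
  obtain ⟨C, K, σ₀, hσ₀, hbounds⟩ := hmodel.expected_deficit_bounds hh hB hB0 hα hd1 hdA hr hdB
    ht2.le hc₀ hG hs
  set t2 := ∫ ω', τ 0 ω' ^ 2 ∂μ with ht2def
  set J := ∑ i, KronSTAP.qform B fun j => d (i, j) with hJ
  -- The texture power cancels between the clutter covariance and the limiting energy.
  have hκ : KronSTAP.alignment B d = t2 * J * (t2 * B.trace.re)⁻¹ := by
    rw [KronSTAP.alignment_eq, ← hJ]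
    field_simp
  have hev : ∀ᶠ x : ℕ × ℝ in atTop ×ˢ 𝓝[>] 0, x.1 ≠ 0 ∧ 0 < x.2 ∧ x.2 ≤ σ₀ :=
    ((eventually_ne_atTop 0).prod_mk (Ioc_mem_nhdsGT hσ₀)).mono fun x hx => ⟨hx.1, hx.2.1, hx.2.2⟩
  have hfst : Tendsto (Prod.fst : ℕ × ℝ → ℕ) (atTop ×ˢ 𝓝[>] 0) atTop := tendsto_fst
  have hsnd : Tendsto (Prod.snd : ℕ × ℝ → ℝ) (atTop ×ˢ 𝓝[>] 0) (𝓝 0) :=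
    tendsto_snd.mono_right nhdsWithin_le_nhds
  have hmain : Tendsto (fun n : ℕ => t2 * J * ((n : ℝ) * ∫ ω, (G n).indicator
      (fun a => (KronSTAP.energy n (KronSTAP.clutter a))⁻¹) (fun m => (τ m ω, c m ω)) ∂μ)) atTop
      (𝓝 (KronSTAP.alignment B d)) := by
    rw [hκ]
    exact hI.const_mul _
  have hσlim : Tendsto (fun x : ℕ × ℝ => (C * √x.2 + x.2) * K) (atTop ×ˢ 𝓝[>] 0) (𝓝 0) := by
    have h1 : Continuous fun σ : ℝ => (C * √σ + σ) * K := by fun_prop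
    have h2 := (h1.tendsto 0).comp hsnd
    simp only [Real.sqrt_zero, mul_zero, add_zero, zero_mul] at h2
    exact h2
  have hClim : Tendsto (fun x : ℕ × ℝ => C / (x.1 : ℝ)) (atTop ×ˢ 𝓝[>] 0) (𝓝 0) :=
    (tendsto_const_div_atTop_nhds_zero_nat C).comp hfst
  have hb : ∀ᶠ x : ℕ × ℝ in atTop ×ˢ 𝓝[>] 0, _ ∧ _ := hev.mono fun x hx => by
    have h1 := hbounds x.1 hx.1 x.2 hx.2.1 hx.2.2 (UA x.1 x.2) (UB x.1 x.2) (hUA_meas _ _)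
      (hUB_meas _ _)
      ((hUA _ _ (Nat.pos_of_ne_zero hx.1) hx.2.1).mono fun ω hω => by rwa [hS] at hω)
      ((hUB _ _ (Nat.pos_of_ne_zero hx.1) hx.2.1).mono fun ω hω => by rwa [hS] at hω)
    rw [← hEρ] at h1
    exact h1
  have part1 : Tendsto (fun x : ℕ × ℝ => (x.1 : ℝ) * (1 - Eρ x.1 x.2)) (atTop ×ˢ 𝓝[>] 0)
      (𝓝 (KronSTAP.alignment B d)) := by
    refine tendsto_of_tendsto_of_tendsto_of_le_of_le' ?_ ?_ (hb.mono fun x hx => hx.2)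
      (hb.mono fun x hx => hx.1)
    · simpa using ((hmain.comp hfst).sub hClim).sub hσlim
    · simpa using ((hmain.comp hfst).add (hP.comp hfst)).add hσlim
  refine ⟨part1, fun ε hε => ?_, hκ1, KronSTAP.alignment_eq_one_iff hB hB0 hd1,
    fun s hs1 hsq => KronSTAP.isLUB_alignment hd1 hdA hs1 hsq⟩
  -- The limit κ lies strictly below 1 + ε, so the scaled deficit eventually does too.
  have h1 := part1.eventually (gt_mem_nhds (lt_of_le_of_lt hκ1 (lt_add_of_pos_right 1 hε)))
  filter_upwards [h1, hev] with x hx hx0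
  have hn : (0 : ℝ) < x.1 := by exact_mod_cast Nat.pos_of_ne_zero hx0.1
  rw [sub_le_comm, le_div_iff₀ hn, mul_comm]
  exact hx.le
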